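/- **Virial Theorem.** Let $W:\mathbb{R}^3\to\mathbb{R}$ be a $C^1$, radial, compactly supported pair potential such that $W=W_0+W_1$ with $W_0,W_1$ continuous, $W_0\ge 0$, $W_0(0)>0$, and $W_1$ positive definite (i.e. $\sum_{i,j}W_1(x_i-x_j)\overline{z_i}z_j\ge 0$ for all $n$, $x_i\in\mathbb{R}^3$, $z_i\in\mathbb{C}$). For $L>0$ let $\Lambda$ be the three-dimensional torus of side $L$, $|\Lambda|=L^3$, and consider on the (spinless) Fermion Fock space over $L^2(\Lambda)$, i.e. on the Hilbert sum over $N\ge 0$ of the antisymmetric functions in $L^2(\Lambda^N)$, the operators $$H_{0,\Lambda}=\tfrac12\int_\Lambda \nabla a_x^+\nabla a_x\,dx,\qquad V_\Lambda=\tfrac12\int_\Lambda\!\int_\Lambda W(x-y)\,a_x^+a_y^+a_ya_x\,dx\,dy,\qquad N_\Lambda=\int_\Lambda a_x^+a_x\,dx,$$ $$P_\Lambda=\tfrac i2\int_\Lambda(\nabla a_x^+a_x-a_x^+\nabla a_x)\,dx,\qquad \mathcal V_\Lambda(W)=\tfrac12\int_\Lambda\!\int_\Lambda \nabla W(x-y)\cdot(x-y)\,a_x^+a_y^+a_ya_x\,dx\,dy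 ,$$ which on the $N$-particle space are, respectively, $\sum_j-\tfrac12\Delta_j$, $\tfrac12\sum_{i\neq j}W(x_i-x_j)$, $N$, $\sum_j -i\nabla_j$ and $\tfrac12\sum_{i\ne j}\nabla W(x_i-x_j)\cdot(x_i-x_j)$, all with periodic boundary conditions (functions of $x_i-x_j$ are periodised). For $\beta>0$, $\alpha\in\mathbb{R}^3$, $\mu\in\mathbb{R}$ let $$Z_\Lambda(\beta,\alpha,\mu)=\operatorname{Tr}e^{-\beta(H_{0,\Lambda}+V_\Lambda-\alpha\cdot P_\Lambda-\mu N_\Lambda)},\qquad \omega^\Lambda_{\beta,\alpha,\mu}(X)=\frac{\operatorname{Tr}\,X e^{-\beta(H_{0,\Lambda}+V_\Lambda-\alpha\cdot P_\Lambda-\mu N_\Lambda)}}{Z_\Lambda(\beta,\alpha,\mu)} .$$ Suppose that on an open set $D$ of parameters $(\beta,\alpha,\mu)$ the pressure $$P(\beta,\alpha,\mu)=\lim_{L\to\infty}\frac1{\beta|\Lambda|}\log Z_\Lambda(\beta,\alpha,\mu)$$ exists and is continuously differentiable, and let $(\beta,\alpha,\mu)\in D$ with $\beta>0$. Then the particle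 density $\rho=\lim_{L\to\infty}|\Lambda|^{-1}\omega^\Lambda_{\beta,\alpha,\mu}(N_\Lambda)$ exists, and $$\lim_{L\to\infty}\left\{2\Big[\frac{\omega^\Lambda_{\beta,\alpha,\mu}(H_{0,\Lambda})}{|\Lambda|}-\tfrac12|\alpha|^2\rho\Big]-\frac{\omega^\Lambda_{\beta,\alpha,\mu}(\mathcal V_\Lambda(W))}{|\Lambda|}\right\}=3P(\beta,\alpha,\mu).$$ In particular, whenever the kinetic energy density $e_{\rm kin}(\beta,\alpha,\mu)=\lim_{L\to\infty}|\Lambda|^{-1}\omega^\Lambda_{\beta,\alpha,\mu}(H_{0,\Lambda})$ exists, the limit of $|\Lambda|^{-1}\omega^\Lambda_{\beta,\alpha,\mu}(\mathcal V_\Lambda(W))$ exists as well and $$2\Big[e_{\rm kin}(\beta,\alpha,\mu)-\tfrac12|\alpha|^2\rho\Big]-\lim_{L\to\infty}\frac1{|\Lambda|}\,\omega^\Lambda_{\beta,\alpha,\mu}(\mathcal V_\Lambda(W))=3\,P(\beta,\alpha,\mu).$$ -/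

import Mathlib

open MeasureTheory Filter Topology
open scoped ComplexOrder

noncomputable section

namespace FermiGas

/-! ### Configurations and the fermionic Fock space of the torus of side `L`

Functions on the torus `Λ` of side `L` are represented by their restrictions to the centred
cube `[-L/2, L/2)³`; the periodic boundary conditions enter through the plane waves and through
the periodised pair potential. -/

/-- One-particle position space. -/
abbrev Space : Type := EuclideanSpace ℝ (Fin 3)

/-- The cube of side `L` centred at the origin. -/
def cube (L : ℝ) : Set Space := {x | ∀ a, x a ∈ Set.Ico (-L / 2) (L / 2)}

/-- Configurations of `N` particles. -/
abbrev Conf (N : ℕ) : Type := Fin N → Space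

/-- Lebesgue measure on `Λ ^ N`. -/
def confMeasure (L : ℝ) (N : ℕ) : Measure (Conf N) :=
  Measure.pi fun _ => (volume : Measure Space).restrict (cube L)

/-- `L²(Λ ^ N)`. -/
abbrev NBody (L : ℝ) (N : ℕ) : Type := Lp ℂ 2 (confMeasure L N)

lemma ae_comp_perm {L : ℝ} {N : ℕ} (σ : Equiv.Perm (Fin N)) {p : Conf N → Prop}
    (h : ∀ᵐ x ∂(confMeasure L N), p x) : ∀ᵐ x ∂(confMeasure L N), p fun i => x (σ i) := by
  have hm : MeasurePreserving (MeasurableEquiv.piCongrLeft (fun _ : Fin N => Space) σ.symm)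
      (confMeasure L N) (confMeasure L N) :=
    measurePreserving_piCongrLeft
      (fun _ : Fin N => (volume : Measure Space).restrict (cube L)) σ.symm
  have h2 := hm.quasiMeasurePreserving.ae h
  filter_upwards [h2] with x hx
  convert hx using 2 with i
  have := Equiv.piCongrLeft_apply_apply (fun _ : Fin N => Space) σ.symm x (σ i)
  simpa [MeasurableEquiv.coe_piCongrLeft] using this.symm

/-- The `N`-fermion space: antisymmetric functions in `L²(Λ ^ N)`. -/
def fermi (L : ℝ) (N : ℕ) : Submodule ℂ (NBody L N) where
  carrier := {ψ | ∀ σ : Equiv.Perm (Fin N),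
    ∀ᵐ x ∂(confMeasure L N), ψ (fun i => x (σ i)) = ((Equiv.Perm.sign σ : ℤ) : ℂ) * ψ x}
  zero_mem' := by
    intro σ
    have h := Lp.coeFn_zero ℂ 2 (confMeasure L N)
    filter_upwards [h, ae_comp_perm σ h] with x h1 h2
    rw [h1, h2]
    simp
  add_mem' := by
    intro ψ φ hψ hφ σ
    have h := Lp.coeFn_add ψ φ
    filter_upwards [h, ae_comp_perm σ h, hψ σ, hφ σ] with x h1 h2 h3 h4
    simp only [h1, h2, Pi.add_apply, h3, h4]
    ring
  smul_mem' := by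
    intro c ψ hψ σ
    have h := Lp.coeFn_smul c ψ
    filter_upwards [h, ae_comp_perm σ h, hψ σ] with x h1 h2 h3
    simp only [h1, h2, Pi.smul_apply, h3, smul_eq_mul]
    ring

/-- The fermionic Fock space over `L²(Λ)`: the Hilbert sum of all `N`-fermion spaces. -/
abbrev Fock (L : ℝ) : Type := lp (fun N : ℕ => fermi L N) 2

/-- The wave function of the `N`-particle component of a Fock space vector. -/
def wave {L : ℝ} (ψ : Fock L) (N : ℕ) : Conf N → ℂ := ((ψ N : NBody L N) : Conf N → ℂ)

lemma wave_zero (L : ℝ) (N : ℕ) : wave (0 : Fock L) N =ᵐ[confMeasure L N] 0 :=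
  Lp.coeFn_zero ℂ 2 (confMeasure L N)

lemma wave_add {L : ℝ} (ψ φ : Fock L) (N : ℕ) :
    wave (ψ + φ) N =ᵐ[confMeasure L N] wave ψ N + wave φ N :=
  Lp.coeFn_add (ψ N : NBody L N) (φ N : NBody L N)

lemma wave_smul {L : ℝ} (c : ℂ) (ψ : Fock L) (N : ℕ) :
    wave (c • ψ) N =ᵐ[confMeasure L N] c • wave ψ N :=
  Lp.coeFn_smul c (ψ N : NBody L N)

/-! ### Operators on Fock space

Each is the (unbounded) operator on Fock space with the indicated graph. -/

/-- Wave vector of the plane wave with index `k`: momentum of the `j`-th particle. -/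
def wavevec (L : ℝ) {N : ℕ} (k : Fin N → Fin 3 → ℤ) (j : Fin N) : Space :=
  WithLp.toLp 2 fun a => 2 * Real.pi / L * (k j a : ℝ)

/-- The periodic plane wave `exp (i ∑ⱼ pⱼ · xⱼ)` on `Λ ^ N`. -/
def planeWave (L : ℝ) {N : ℕ} (k : Fin N → Fin 3 → ℤ) (x : Conf N) : ℂ :=
  Complex.exp (Complex.I * ((∑ j, inner ℝ (wavevec L k j) (x j) : ℝ) : ℂ))

/-- The (unnormalised) Fourier coefficient of an `N`-particle component. -/
def coeff {L : ℝ} (ψ : Fock L) (N : ℕ) (k : Fin N → Fin 3 → ℤ) : ℂ :=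
  ∫ x, starRingEnd ℂ (planeWave L k x) * wave ψ N x ∂(confMeasure L N)

lemma memLp_planeWave (L : ℝ) {N : ℕ} (k : Fin N → Fin 3 → ℤ) :
    MemLp (fun x => starRingEnd ℂ (planeWave L k x)) 2 (confMeasure L N) := by
  have hfin : IsFiniteMeasure ((volume : Measure Space).restrict (cube L)) := by
    refine ⟨?_⟩
    rw [Measure.restrict_apply_univ]
    have hb : Bornology.IsBounded (cube L) := by
      refine (Metric.isBounded_closedBall (x := (0 : Space)) (r := Real.sqrt 3 * |L|)).subset ?_
      intro x hx
      rw [mem_closedBall_zero_iff, EuclideanSpace.norm_eq]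
      have h3 : ∑ i, ‖x i‖ ^ 2 ≤ 3 * |L| ^ 2 := by
        have : ∀ i ∈ Finset.univ, ‖x i‖ ^ 2 ≤ |L| ^ 2 := by
          intro i _
          have h := hx i
          have : ‖x i‖ ≤ |L| := by
            rw [Real.norm_eq_abs, abs_le]
            have h1 := h.1
            have h2 := h.2
            have h4 := le_abs_self L
            have h5 := abs_nonneg L
            constructor <;> linarith
          gcongr
        have h4 := Finset.sum_le_sum this
        simpa using h4
      calc Real.sqrt (∑ i, ‖x i‖ ^ 2) ≤ Real.sqrt (3 * |L| ^ 2) := Real.sqrt_le_sqrt h3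
        _ = Real.sqrt 3 * |L| := by
          rw [Real.sqrt_mul (by norm_num), Real.sqrt_sq (abs_nonneg L)]
    exact hb.measure_lt_top
  have : IsFiniteMeasure (confMeasure L N) := by
    unfold confMeasure
    infer_instance
  have hc : Continuous fun x : Conf N => starRingEnd ℂ (planeWave L k x) := by
    unfold planeWave
    fun_prop
  refine MemLp.of_bound hc.aestronglyMeasurable 1 (Eventually.of_forall fun x => ?_)
  rw [RCLike.norm_conj, planeWave, mul_comm, Complex.norm_exp_ofReal_mul_I]

lemma integrable_coeff {L : ℝ} (ψ : Fock L) (N : ℕ) (k : Fin N → Fin 3 → ℤ) :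
    Integrable (fun x => starRingEnd ℂ (planeWave L k x) * wave ψ N x) (confMeasure L N) :=
  MemLp.integrable_mul (memLp_planeWave L k) (Lp.memLp (ψ N : NBody L N))

lemma coeff_zero (L : ℝ) (N : ℕ) (k : Fin N → Fin 3 → ℤ) : coeff (0 : Fock L) N k = 0 := by
  refine integral_eq_zero_of_ae ?_
  filter_upwards [wave_zero L N] with x hx
  simp [hx]

lemma coeff_add {L : ℝ} (ψ φ : Fock L) (N : ℕ) (k : Fin N → Fin 3 → ℤ) :
    coeff (ψ + φ) N k = coeff ψ N k + coeff φ N k := by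
  unfold coeff
  rw [← integral_add (integrable_coeff ψ N k) (integrable_coeff φ N k)]
  refine integral_congr_ae ?_
  filter_upwards [wave_add ψ φ N] with x hx
  simp [hx, mul_add]

lemma coeff_smul {L : ℝ} (c : ℂ) (ψ : Fock L) (N : ℕ) (k : Fin N → Fin 3 → ℤ) :
    coeff (c • ψ) N k = c * coeff ψ N k := by
  unfold coeff
  rw [← integral_const_mul]
  refine integral_congr_ae ?_
  filter_upwards [wave_smul c ψ N] with x hx
  simp only [hx, Pi.smul_apply, smul_eq_mul]
  ring

/-- The operator on Fock space that multiplies the Fourier coefficient with index `k` of the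
`N`-particle component by `m N k`, on its maximal domain. -/
def fourierMultiplier (L : ℝ) (m : ∀ N : ℕ, (Fin N → Fin 3 → ℤ) → ℝ) :
    Fock L →ₗ.[ℂ] Fock L :=
  Submodule.toLinearPMap
    { carrier := {p | ∀ N k, coeff p.2 N k = (m N k : ℂ) * coeff p.1 N k}
      zero_mem' := by
        intro N k
        simp [coeff_zero]
      add_mem' := by
        intro p q hp hq N k
        simp only [Prod.fst_add, Prod.snd_add, coeff_add, hp N k, hq N k]
        ring
      smul_mem' := by
        intro c p hp N k
        simp only [Prod.smul_fst, Prod.smul_snd, coeff_smul, hp N k]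
        ring }

/-- The operator on Fock space that acts on the `N`-particle component as multiplication by the
function `u N` on configurations, on its maximal domain. -/
def multiplication (L : ℝ) (u : ∀ N : ℕ, Conf N → ℝ) : Fock L →ₗ.[ℂ] Fock L :=
  Submodule.toLinearPMap
    { carrier := {p | ∀ N, ∀ᵐ x ∂(confMeasure L N),
        wave p.2 N x = (u N x : ℂ) * wave p.1 N x}
      zero_mem' := by
        intro N
        filter_upwards [wave_zero L N] with x hx
        simp [hx]
      add_mem' := by
        intro p q hp hq N
        filter_upwards [hp N, hq N, wave_add p.1 q.1 N, wave_add p.2 q.2 N] with x h1 h2 h3 h4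
        simp only [Prod.fst_add, Prod.snd_add, h3, h4, Pi.add_apply, h1, h2]
        ring
      smul_mem' := by
        intro c p hp N
        filter_upwards [hp N, wave_smul c p.1 N, wave_smul c p.2 N] with x h1 h2 h3
        simp only [Prod.smul_fst, Prod.smul_snd, h2, h3, Pi.smul_apply, smul_eq_mul, h1]
        ring }

/-- Kinetic energy `H₀ = ½ ∫ ∇a⁺ ∇a`: it is `∑ⱼ -½ Δⱼ` with periodic boundary conditions on
the `N`-particle space. -/
def kinetic (L : ℝ) : Fock L →ₗ.[ℂ] Fock L :=
  fourierMultiplier L fun _ k => ∑ j, ‖wavevec L k j‖ ^ 2 / 2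

/-- The component `α · P` of the total momentum `P = (i/2) ∫ (∇a⁺ a - a⁺ ∇a)`: it is
`∑ⱼ -i α · ∇ⱼ` with periodic boundary conditions on the `N`-particle space. -/
def momentum (L : ℝ) (α : Space) : Fock L →ₗ.[ℂ] Fock L :=
  fourierMultiplier L fun _ k => ∑ j, inner ℝ α (wavevec L k j)

/-- Particle number `∫ a⁺ a`. -/
def number (L : ℝ) : Fock L →ₗ.[ℂ] Fock L :=
  multiplication L fun N _ => (N : ℝ)

/-- The periodisation of a (compactly supported) function on space. -/
def periodise (L : ℝ) (U : Space → ℝ) (x : Space) : ℝ :=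
  ∑' n : Fin 3 → ℤ, U (x + WithLp.toLp 2 fun a => L * (n a : ℝ))

/-- The pair interaction `½ ∫∫ U(x - y) a⁺ₓ a⁺_y a_y aₓ dx dy` on the torus: it is
multiplication by `½ ∑_{i ≠ j} U(xᵢ - xⱼ)` on the `N`-particle space. -/
def interaction (L : ℝ) (U : Space → ℝ) : Fock L →ₗ.[ℂ] Fock L :=
  multiplication L fun _ x =>
    (1 / 2) * ∑ i, ∑ j ∈ Finset.univ.erase i, periodise L U (x i - x j)

/-- The virial: the pair interaction with `∇W(x - y) · (x - y)` in place of `W(x - y)`. -/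
def virial (L : ℝ) (W : Space → ℝ) : Fock L →ₗ.[ℂ] Fock L :=
  interaction L fun x => inner ℝ (gradient W x) x

/-- `H₀ + V - α · P - μ N`. -/
def hamiltonian (W : Space → ℝ) (L : ℝ) (α : Space) (μ : ℝ) : Fock L →ₗ.[ℂ] Fock L :=
  kinetic L + interaction L W - momentum L α - (μ : ℂ) • number L

/-! ### Traces with `exp (-β A)` -/

section Trace

variable {F : Type} [NormedAddCommGroup F] [InnerProductSpace ℂ F]

/-- An orthonormal basis of eigenvectors of `A` with real eigenvalues. -/
structure Eigenbasis (A : F →ₗ.[ℂ] F) where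
  ι : Type
  basis : HilbertBasis ι ℂ F
  energy : ι → ℝ
  mem_domain : ∀ i, basis i ∈ A.domain
  apply_eq : ∀ i, A ⟨basis i, mem_domain i⟩ = (energy i : ℂ) • basis i

open Classical in
/-- `⟨ψ, X ψ⟩` for `ψ` in the domain of `X`. -/
def expval (X : F →ₗ.[ℂ] F) (ψ : F) : ℂ :=
  if h : ψ ∈ X.domain then inner ℂ ψ (X ⟨ψ, h⟩) else 0

open Classical in
/-- `Tr exp (-β A)`, computed in an eigenbasis of `A`. -/
def heatTrace (β : ℝ) (A : F →ₗ.[ℂ] F) : ℝ :=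
  if h : Nonempty (Eigenbasis A) then ∑' i, Real.exp (-β * (Classical.choice h).energy i) else 0

open Classical in
/-- `Tr (X exp (-β A))`, computed in an eigenbasis of `A`. -/
def heatTraceMul (β : ℝ) (A X : F →ₗ.[ℂ] F) : ℂ :=
  if h : Nonempty (Eigenbasis A) then
    ∑' i, (Real.exp (-β * (Classical.choice h).energy i) : ℂ) *
      expval X ((Classical.choice h).basis i)
  else 0

end Trace

/-! ### Gibbs states and thermodynamic limits -/

/-- The partition function of the torus of side `L`. -/
def partition (W : Space → ℝ) (L β : ℝ) (α : Space) (μ : ℝ) : ℝ :=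
  heatTrace β (hamiltonian W L α μ)

/-- The expectation of `X` in the Gibbs state of the torus of side `L`. -/
def gibbs (W : Space → ℝ) (L β : ℝ) (α : Space) (μ : ℝ) (X : Fock L →ₗ.[ℂ] Fock L) : ℂ :=
  heatTraceMul β (hamiltonian W L α μ) X / (partition W L β α μ : ℂ)

/-- `p` is the pressure at `(β, α, μ)`: the limit of `(β |Λ|)⁻¹ log Z` as `Λ → ℝ³`. -/
def IsPressure (W : Space → ℝ) (β : ℝ) (α : Space) (μ : ℝ) (p : ℝ) : Prop :=
  Tendsto (fun L : ℝ => Real.log (partition W L β α μ) / (β * L ^ 3)) atTop (𝓝 p)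

/-- `e` is the kinetic energy density at `(β, α, μ)`. -/
def IsKineticDensity (W : Space → ℝ) (β : ℝ) (α : Space) (μ : ℝ) (e : ℝ) : Prop :=
  Tendsto (fun L : ℝ => gibbs W L β α μ (kinetic L) / (L : ℂ) ^ 3) atTop (𝓝 (e : ℂ))

/-- `ρ` is the particle density at `(β, α, μ)`. -/
def IsParticleDensity (W : Space → ℝ) (β : ℝ) (α : Space) (μ : ℝ) (ρ : ℝ) : Prop :=
  Tendsto (fun L : ℝ => gibbs W L β α μ (number L) / (L : ℂ) ^ 3) atTop (𝓝 (ρ : ℂ))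

/-- `v` is the limit of `|Λ|⁻¹ ω(𝒱_Λ(W))` at `(β, α, μ)`. -/
def IsVirialDensity (W : Space → ℝ) (β : ℝ) (α : Space) (μ : ℝ) (v : ℝ) : Prop :=
  Tendsto (fun L : ℝ => gibbs W L β α μ (virial L W) / (L : ℂ) ^ 3) atTop (𝓝 (v : ℂ))

/-- A function of positive type: all matrices `(f (xᵢ - xⱼ))ᵢⱼ` are positive semidefinite. -/
def PositiveType (f : Space → ℝ) : Prop :=
  ∀ (n : ℕ) (x : Fin n → Space),
    (Matrix.of fun i j => (f (x i - x j) : ℂ) : Matrix (Fin n) (Fin n) ℂ).PosSemidef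

/-- The admissible pair potentials: `C¹`, radial, of finite range, and superstable in the sense
that `W = W₀ + W₁` with `W₀ ≥ 0`, `W₀(0) > 0` and `W₁` of positive type. -/
structure AdmissiblePotential (W : Space → ℝ) : Prop where
  contDiff : ContDiff ℝ 1 W
  radial : ∀ x y, ‖x‖ = ‖y‖ → W x = W y
  compactSupport : HasCompactSupport W
  superstable : ∃ W₀ W₁ : Space → ℝ, Continuous W₀ ∧ Continuous W₁ ∧ (∀ x, W x = W₀ x + W₁ x) ∧
    (∀ x, 0 ≤ W₀ x) ∧ 0 < W₀ 0 ∧ PositiveType W₁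

end FermiGas

end

open FermiGas

open MeasureTheory Filter Topology
open scoped ComplexOrder

noncomputable section

namespace FermiGas

/-! The right-hand side is a derivative with respect to dilations. Since `log Z` on the torus of
side (1+ε)L, divided by β L³, tends to (1+ε)³ P, its limit has slope 3P at ε = 0. On a finite torus
the normalised dilation carries the Fock space over side L isometrically into that over side rL, r =
1+ε, and turns the Hamiltonian of the large torus into r⁻² H₀ + V(W(r ·)) - r⁻¹ α·P - μN on the
small one. To first order in ε this differs from the Hamiltonian of the small torus by -ε (2 H₀ -
α·P - 𝒱(W)).

No differentiation of `log Z` at finite volume is needed. The Peierls-Bogoliubov inequality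
`log_heatTrace_ge`, valid for two operators on two spaces linked by an isometry, gives `log Z` on
side rL at least `log Z` on side L plus βε ω(2 H₀ - α·P - 𝒱), up to o(ε) times the volume. As ε may
have either sign, these one-sided bounds squeeze the density of 2 H₀ - α·P - 𝒱 to the derivative of
the limit (`tendsto_of_slope`), which gives `tendsto_virial`. The same device with a shift of μ
gives the particle density ρ = ∂P/∂μ (`tendsto_density`).

The momentum term is identified by boosts. Multiplying wave functions by a plane wave of smallest
momentum ±2π/L in a coordinate direction, on the same torus and at the same parameters, changes the
mean energy by a non-negative amount. The two signs force each component of ω(P) to be α ω(N) up to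
(π/L) ω(N) (`abs_mean_mom_single_sub_le`), so ω(α·P)/|Λ| tends to |α|²ρ.

The errors must be small per unit volume. The remainder W(rx) - W(x) - ε ∇W(x)·x is uniformly o(ε)
and has fixed range, so it is bounded by o(ε) times the number of close pairs. By superstability
(`AdmissiblePotential.superstability`) that number is at most a constant, uniform in L, times the
shifted interaction 2V + W(0)N, which is the full double sum with its diagonal. The densities of H₀
and of the shifted interaction are bounded because the energy density is, by a comparison with one
smaller inverse temperature (`eventually_bounded`).

The traces are defined through an eigenbasis, which has to be produced. In each N-particle sector
the interaction is bounded and the rest has compact resolvent (`nonempty_eigenbasis_hamiltonian`).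
Finiteness of the partition function follows from superstability: the interaction dominates a
multiple of N², which beats the exponential growth in N of the free sums
(`TorusStable.hasFiniteTrace`). -/

section

/-! ### Trace inequalities, and eigenbases from compact operators -/

section Abstract

/-- The Peierls inequality for doubly substochastic weights. -/
lemma sum_exp_neg_le_tsum {ι κ : Type*} (s : Finset ι) {w : ι → κ → ℝ} {t : κ → ℝ} {x : ι → ℝ}
    (hw : ∀ i j, 0 ≤ w i j) (h1 : ∀ i, HasSum (w i) 1)
    (hx : ∀ i, HasSum (fun j => w i j * t j) (x i)) (hs : ∀ j, ∑ i ∈ s, w i j ≤ 1)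
    (ht : Summable fun j => Real.exp (-t j)) :
    ∑ i ∈ s, Real.exp (-x i) ≤ ∑' j, Real.exp (-t j) := by
  have hsum : ∀ i, Summable fun j => w i j * Real.exp (-t j) := fun i =>
    Summable.of_nonneg_of_le (fun j => mul_nonneg (hw i j) (Real.exp_pos _).le)
      (fun j => mul_le_of_le_one_left (Real.exp_pos _).le
        (le_hasSum (h1 i) j fun k _ => hw i k)) ht
  -- Jensen's inequality by hand: the tangent line of exp (-t) at t = x i lies below the curve, and
  -- since the weights have total mass 1 and mean x i it sums to exp (-x i).
  have hone : ∀ i, Real.exp (-x i) ≤ ∑' j, w i j * Real.exp (-t j) := by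
    intro i
    have h2 : HasSum (fun j => Real.exp (-x i) * ((1 + x i) * w i j - w i j * t j))
        (Real.exp (-x i) * ((1 + x i) * 1 - x i)) :=
      (((h1 i).mul_left _).sub (hx i)).mul_left _
    have h3 : Real.exp (-x i) * ((1 + x i) * 1 - x i) = Real.exp (-x i) := by ring
    rw [h3] at h2
    refine hasSum_le (fun j => ?_) h2 (hsum i).hasSum
    have h4 := Real.add_one_le_exp (x i - t j)
    have h5 : Real.exp (-t j) = Real.exp (-x i) * Real.exp (x i - t j) := by
      rw [← Real.exp_add]; ring_nf
    rw [h5]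
    have h6 : 0 ≤ w i j * Real.exp (-x i) := mul_nonneg (hw i j) (Real.exp_pos _).le
    nlinarith [mul_le_mul_of_nonneg_left h4 h6]
  calc ∑ i ∈ s, Real.exp (-x i) ≤ ∑ i ∈ s, ∑' j, w i j * Real.exp (-t j) :=
        Finset.sum_le_sum fun i _ => hone i
    _ = ∑' j, ∑ i ∈ s, w i j * Real.exp (-t j) := (Summable.tsum_finsetSum fun i _ => hsum i).symm
    _ ≤ ∑' j, Real.exp (-t j) := by
        refine Summable.tsum_le_tsum (fun j => ?_) (summable_sum fun i _ => hsum i) ht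
        rw [← Finset.sum_mul]
        exact mul_le_of_le_one_left (Real.exp_pos _).le (hs j)

/-- The Gibbs variational inequality. -/
lemma mul_exp_neg_mean_le_tsum {ι : Type*} {E x : ι → ℝ}
    (hE : Summable fun i => Real.exp (-E i)) (hpos : 0 < ∑' i, Real.exp (-E i))
    (hx : Summable fun i => Real.exp (-E i) * x i)
    (hEx : Summable fun i => Real.exp (-(E i + x i))) :
    (∑' i, Real.exp (-E i)) *
        Real.exp (-((∑' i, Real.exp (-E i) * x i) / ∑' i, Real.exp (-E i))) ≤
      ∑' i, Real.exp (-(E i + x i)) := by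
  set Z := ∑' i, Real.exp (-E i)
  set m := (∑' i, Real.exp (-E i) * x i) / Z with hm
  -- Again a tangent line, now at the Gibbs mean m, so that the linear term cancels after summation.
  have h2 : HasSum (fun i => Real.exp (-m) * ((1 + m) * Real.exp (-E i) - Real.exp (-E i) * x i))
      (Real.exp (-m) * ((1 + m) * Z - ∑' i, Real.exp (-E i) * x i)) :=
    ((hE.hasSum.mul_left _).sub hx.hasSum).mul_left _
  have h3 : Real.exp (-m) * ((1 + m) * Z - ∑' i, Real.exp (-E i) * x i) = Z * Real.exp (-m) := by
    have : m * Z = ∑' i, Real.exp (-E i) * x i := by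
      rw [hm]; field_simp
    rw [← this]; ring
  rw [h3] at h2
  refine hasSum_le (fun i => ?_) h2 hEx.hasSum
  have h4 := Real.add_one_le_exp (m - x i)
  have h5 : Real.exp (-(E i + x i)) = Real.exp (-m) * Real.exp (-E i) * Real.exp (m - x i) := by
    rw [← Real.exp_add, ← Real.exp_add]; ring_nf
  rw [h5]
  have h6 : 0 ≤ Real.exp (-m) * Real.exp (-E i) := by positivity
  nlinarith [mul_le_mul_of_nonneg_left h4 h6]

variable {F : Type} [NormedAddCommGroup F] [InnerProductSpace ℂ F]

/-- A contraction functional satisfies Bessel's inequality even without a representing vector: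
testing it on the combination y of the v i with coefficients conj (f (v i)) gives f y = S and ‖y‖² =
S, hence S ≤ √S. -/
lemma sum_sq_le_one_of_orthonormal {ι : Type*} {v : ι → F} (hv : Orthonormal ℂ v) (f : F →ₗ[ℂ] ℂ)
    (hf : ∀ x, ‖f x‖ ≤ ‖x‖) (s : Finset ι) : ∑ i ∈ s, ‖f (v i)‖ ^ 2 ≤ 1 := by
  set S := ∑ i ∈ s, ‖f (v i)‖ ^ 2
  have hS : 0 ≤ S := Finset.sum_nonneg fun _ _ => by positivity
  set y : F := ∑ i ∈ s, starRingEnd ℂ (f (v i)) • v i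
  have h1 : f y = (S : ℂ) := by
    simp only [y, S, map_sum, map_smul, smul_eq_mul]
    push_cast
    refine Finset.sum_congr rfl fun i _ => ?_
    rw [mul_comm, Complex.mul_conj, Complex.normSq_eq_norm_sq]
    norm_cast
  have h2 : ‖y‖ ^ 2 = S := by
    have := hv.inner_sum (fun i => starRingEnd ℂ (f (v i))) (fun i => starRingEnd ℂ (f (v i))) s
    rw [inner_self_eq_norm_sq_to_K] at this
    have h3 : ((‖y‖ ^ 2 : ℝ) : ℂ) = (S : ℂ) := by
      push_cast
      refine this.trans ?_
      simp only [S]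
      push_cast
      refine Finset.sum_congr rfl fun i _ => ?_
      rw [Complex.conj_conj, Complex.mul_conj, Complex.normSq_eq_norm_sq]
      norm_cast
    exact_mod_cast h3
  have h3 : S ≤ ‖y‖ := by
    have := hf y
    rwa [h1, Complex.norm_real, Real.norm_eq_abs, abs_of_nonneg hS] at this
  nlinarith [norm_nonneg y]

/-- Symmetry of an operator on its domain. -/
def IsSymm (A : F →ₗ.[ℂ] F) : Prop :=
  ∀ x y : A.domain, inner ℂ (A x) (y : F) = inner ℂ (x : F) (A y)

/-- Parseval for the pair x, A x; symmetry moves A onto the eigenvectors. Nothing beyond symmetry on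
the domain is required, in particular no self-adjointness. -/
lemma Eigenbasis.hasSum_energy {A : F →ₗ.[ℂ] F} (hA : IsSymm A) (e : Eigenbasis A)
    (x : A.domain) :
    HasSum (fun j => ‖(inner ℂ (e.basis j) (x : F) : ℂ)‖ ^ 2 * e.energy j)
      (inner ℂ (x : F) (A x)).re := by
  have h := e.basis.hasSum_inner_mul_inner (x : F) (A x)
  have h2 := Complex.hasSum_re h
  refine h2.congr_fun fun j => ?_
  have h3 : (inner ℂ (e.basis j) (A x) : ℂ) = e.energy j * inner ℂ (e.basis j) (x : F) := by
    have := hA ⟨e.basis j, e.mem_domain j⟩ x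
    rw [e.apply_eq, inner_smul_left] at this
    simpa using this.symm
  rw [h3, ← inner_conj_symm (x : F)]
  have : (starRingEnd ℂ) (inner ℂ (e.basis j) (x:F)) *
      ((e.energy j : ℂ) * inner ℂ (e.basis j) (x:F)) =
      ((‖(inner ℂ (e.basis j) (x : F) : ℂ)‖ ^ 2 * e.energy j : ℝ) : ℂ) := by
    rw [mul_comm, mul_assoc, Complex.mul_conj, Complex.normSq_eq_norm_sq]
    push_cast; ring
  rw [this, Complex.ofReal_re]

lemma hilbertBasis_hasSum_norm_sq {ι : Type*} (b : HilbertBasis ι ℂ F) (x : F) :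
    HasSum (fun j => ‖(inner ℂ (b j) x : ℂ)‖ ^ 2) (‖x‖ ^ 2) := by
  have h2 := Complex.hasSum_re (b.hasSum_inner_mul_inner x x)
  rw [inner_self_eq_norm_sq_to_K] at h2
  norm_cast at h2
  refine h2.congr_fun fun j => ?_
  rw [← inner_conj_symm x, mul_comm, Complex.mul_conj, Complex.normSq_eq_norm_sq, Complex.ofReal_re]

/-- The Peierls inequality, with weights |⟨e j, v i⟩|²: over the eigenbasis they sum to 1 by
Parseval, over the orthonormal family to at most 1 by Bessel. -/
lemma Eigenbasis.sum_exp_neg_le {A : F →ₗ.[ℂ] F} (hA : IsSymm A) (e : Eigenbasis A) {β : ℝ}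
    (he : Summable fun j => Real.exp (-β * e.energy j)) {ι : Type*} {v : ι → A.domain}
    (hv : Orthonormal ℂ fun i => (v i : F)) (s : Finset ι) :
    ∑ i ∈ s, Real.exp (-(β * (inner ℂ (v i : F) (A (v i))).re)) ≤
      ∑' j, Real.exp (-β * e.energy j) := by
  simp only [neg_mul] at he ⊢
  refine sum_exp_neg_le_tsum s (w := fun i j => ‖(inner ℂ (e.basis j) (v i : F) : ℂ)‖ ^ 2)
    (fun i j => by positivity) (fun i => ?_) (fun i => ?_) (fun j => ?_) he
  · have := hilbertBasis_hasSum_norm_sq e.basis (v i : F)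
    rwa [hv.1 i, one_pow] at this
  · exact ((e.hasSum_energy hA (v i)).mul_left β).congr_fun fun j => by ring
  · have := hv.sum_inner_products_le (e.basis j) (s := s)
    rw [e.basis.orthonormal.1 j, one_pow] at this
    refine le_trans (le_of_eq (Finset.sum_congr rfl fun i _ => ?_)) this
    rw [← inner_conj_symm, RCLike.norm_conj]

/-- Bessel form of the Peierls inequality for an arbitrary diagonal lower bound. -/
lemma sum_exp_neg_le_of_diag {κ ι : Type*} {v : ι → F} (hv : Orthonormal ℂ v)
    (f : κ → F →ₗ[ℂ] ℂ) (hf : ∀ x, HasSum (fun j => ‖f j x‖ ^ 2) (‖x‖ ^ 2)) {t : κ → ℝ}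
    (ht : Summable fun j => Real.exp (-t j)) {x : ι → ℝ}
    (hx : ∀ i, HasSum (fun j => ‖f j (v i)‖ ^ 2 * t j) (x i)) (s : Finset ι) :
    ∑ i ∈ s, Real.exp (-x i) ≤ ∑' j, Real.exp (-t j) := by
  refine sum_exp_neg_le_tsum s (w := fun i j => ‖f j (v i)‖ ^ 2)
    (fun i j => by positivity) (fun i => ?_) hx (fun j => ?_) ht
  · simpa [hv.1 i] using hf (v i)
  · refine sum_sq_le_one_of_orthonormal hv (f j) (fun y => ?_) s
    have := le_hasSum (hf y) j fun _ _ => by positivity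
    exact (pow_le_pow_iff_left₀ (norm_nonneg _) (norm_nonneg _) two_ne_zero).1 this

lemma hilbertBasis_ext_inner {κ : Type*} (b : HilbertBasis κ ℂ F) {x y : F}
    (h : ∀ k, inner ℂ (b k) x = (inner ℂ (b k) y : ℂ)) : x = y := by
  apply b.repr.injective
  ext k
  rw [b.repr_apply_apply, b.repr_apply_apply, h]

lemma isSymmetric_of_diagonal {κ : Type*} (b : HilbertBasis κ ℂ F) {r : κ → ℝ} {T : F →L[ℂ] F}
    (hT : ∀ x k, inner ℂ (b k) (T x) = (r k : ℂ) * inner ℂ (b k) x) :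
    (T : F →ₗ[ℂ] F).IsSymmetric := by
  intro x y
  change inner ℂ (T x) y = inner ℂ x (T y)
  rw [← b.tsum_inner_mul_inner, ← b.tsum_inner_mul_inner]
  refine tsum_congr fun k => ?_
  rw [hT, ← inner_conj_symm (T x), hT, map_mul, inner_conj_symm, Complex.conj_ofReal]
  ring

/-- A bounded diagonal operator. -/
lemma exists_diagonal {κ : Type*} (b : HilbertBasis κ ℂ F) {r : κ → ℝ} {C : ℝ} (hC : 0 ≤ C)
    (hr : ∀ k, |r k| ≤ C) :
    ∃ T : F →L[ℂ] F, ‖T‖ ≤ C ∧ ∀ x k, inner ℂ (b k) (T x) = (r k : ℂ) * inner ℂ (b k) x := by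
  have hmem : ∀ x : F, Memℓp (fun k => (r k : ℂ) * b.repr x k) 2 := by
    intro x
    have := (lp.memℓp (b.repr x)).const_smul (C : ℂ)
    refine this.mono' ?_
    intro k
    simp only [norm_mul, Complex.norm_real, Pi.smul_apply, smul_eq_mul, Real.norm_eq_abs]
    rw [abs_of_nonneg hC]
    exact mul_le_mul_of_nonneg_right (hr k) (norm_nonneg _)
  let T0 : F →ₗ[ℂ] F :=
    { toFun := fun x => b.repr.symm ⟨_, hmem x⟩
      map_add' := by
        intro x y
        rw [← map_add]
        congr 1
        ext k
        simp only [map_add, lp.coeFn_add, Pi.add_apply, mul_add]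
      map_smul' := by
        intro c x
        rw [RingHom.id_apply, ← map_smul]
        congr 1
        ext k
        simp [mul_left_comm] }
  have hT0 : ∀ x k, inner ℂ (b k) (T0 x) = (r k : ℂ) * inner ℂ (b k) x := by
    intro x k
    rw [← b.repr_apply_apply, ← b.repr_apply_apply]
    simp [T0]
  have hbd : ∀ x, ‖T0 x‖ ≤ C * ‖x‖ := by
    intro x
    refine (pow_le_pow_iff_left₀ (norm_nonneg _) (by positivity) two_ne_zero).1 ?_
    rw [mul_pow]
    refine hasSum_le (fun k => ?_) (hilbertBasis_hasSum_norm_sq b (T0 x))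
      ((hilbertBasis_hasSum_norm_sq b x).mul_left (C ^ 2))
    rw [hT0, norm_mul, Complex.norm_real, Real.norm_eq_abs, mul_pow]
    exact mul_le_mul_of_nonneg_right (pow_le_pow_left₀ (abs_nonneg _) (hr k) 2) (by positivity)
  exact ⟨T0.mkContinuous C hbd, T0.mkContinuous_norm_le hC hbd, hT0⟩

variable [CompleteSpace F]

/-- An injective compact symmetric operator has a Hilbert basis of eigenvectors. -/
lemma exists_hilbertBasis_of_isCompactOperator {T : F →L[ℂ] F} (hc : IsCompactOperator T)
    (hs : (T : F →ₗ[ℂ] F).IsSymmetric) (hi : ∀ x, T x = 0 → x = 0) :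
    ∃ (ι : Type) (b : HilbertBasis ι ℂ F) (l : ι → ℝ),
      ∀ i, l i ≠ 0 ∧ T (b i) = (l i : ℂ) • b i := by
  have hcomp : ∀ m : ℂ, CompleteSpace (Module.End.eigenspace (T : Module.End ℂ F) m) := by
    intro m
    have : IsClosed ((Module.End.eigenspace (T : Module.End ℂ F) m : Submodule ℂ F) : Set F) := by
      have : ((Module.End.eigenspace (T : Module.End ℂ F) m : Submodule ℂ F) : Set F) =
          {x | T x = m • x} := by
        ext x
        simp
      rw [this]
      exact isClosed_eq T.continuous (continuous_const_smul m)
    exact this.completeSpace_coe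
  choose w b hb using fun m : ℂ =>
    exists_hilbertBasis ℂ (Module.End.eigenspace (T : Module.End ℂ F) m)
  -- Bases of all eigenspaces are joined over every complex m; values that are not eigenvalues
  -- contribute an empty index set.
  let v : (Σ m : ℂ, w m) → F := fun p => (b p.1 p.2 : F)
  have hv : ∀ p, T (v p) = p.1 • v p := fun p =>
    Module.End.mem_eigenspace_iff.1 (b p.1 p.2).2
  have horth : Orthonormal ℂ v := by
    have := hs.orthogonalFamily_eigenspaces.orthonormal_sigma_orthonormal
      (v_family := fun m => (b m : w m → Module.End.eigenspace (T : Module.End ℂ F) m))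
      (fun m => (b m).orthonormal)
    exact this
  have hspan : (Submodule.span ℂ (Set.range v))ᗮ = ⊥ := by
    rw [eq_bot_iff, ← ContinuousLinearMap.orthogonalComplement_iSup_eigenspaces_eq_bot hc hs]
    intro x hx
    rw [Submodule.mem_orthogonal'] at hx ⊢
    intro y hy
    have hker : (⨆ m, Module.End.eigenspace (T : Module.End ℂ F) m) ≤
        LinearMap.ker (innerSL ℂ x : F →ₗ[ℂ] ℂ) := by
      refine iSup_le fun m z hz => ?_
      rw [LinearMap.mem_ker]
      have h1 := (b m).hasSum_repr ⟨z, hz⟩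
      have h2 := ((innerSL ℂ x).comp
        (Module.End.eigenspace (T : Module.End ℂ F) m).subtypeL).hasSum h1
      have h3 : (fun i => ((innerSL ℂ x).comp
        (Module.End.eigenspace (T : Module.End ℂ F) m).subtypeL) ((b m).repr ⟨z, hz⟩ i • b m i))
          = fun _ => 0 := by
        funext i
        have := hx (v ⟨m, i⟩) (Submodule.subset_span ⟨_, rfl⟩)
        simp only [v] at this
        rw [map_smul]
        simp [this]
      have h4 : HasSum (fun _ : w m => (0 : ℂ)) (inner ℂ x z) := by
        have h5 := h2
        rw [h3] at h5
        exact h5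
      exact h4.unique hasSum_zero
    exact LinearMap.mem_ker.1 (hker hy)
  refine ⟨_, HilbertBasis.mkOfOrthogonalEqBot horth hspan, fun p => p.1.re, fun p => ?_⟩
  rw [HilbertBasis.coe_mkOfOrthogonalEqBot]
  have hne : v p ≠ 0 := horth.ne_zero p
  have hre : ((p.1.re : ℝ) : ℂ) = p.1 := by
    have hev : Module.End.HasEigenvalue (T : Module.End ℂ F) p.1 :=
      Module.End.hasEigenvalue_of_hasEigenvector ⟨(b p.1 p.2).2, hne⟩
    exact Complex.conj_eq_iff_re.1 (hs.conj_eigenvalue_eq_self hev)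
  refine ⟨fun h0 => hne (hi _ ?_), ?_⟩
  · rw [hv, ← hre, show p.1.re = 0 from h0]; simp
  · rw [hre, hv]

/-- Eigenvectors of `R₀⁻¹ + V` for a compact positive `R₀` and a relatively small `V`. -/
lemma exists_hilbertBasis_of_resolvent {R V : F →L[ℂ] F} (hc : IsCompactOperator R)
    (hR : (R : F →ₗ[ℂ] F).IsSymmetric) (hi : ∀ x, R x = 0 → x = 0)
    (hV : (V : F →ₗ[ℂ] F).IsSymmetric) (hn : ‖V‖ * ‖R‖ < 1) :
    ∃ (ι : Type) (b : HilbertBasis ι ℂ F) (l : ι → ℝ) (χ : ι → F),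
      ∀ i, R (χ i) = b i ∧ χ i + V (b i) = (l i : ℂ) • b i := by
  -- The inverse of R⁻¹ + V is R (1 + V R)⁻¹, where 1 + V R is invertible by a Neumann series. It is
  -- compact, symmetric and injective, so its eigenvectors with inverted eigenvalues diagonalise R⁻¹
  -- + V; the vector χ i stands for R⁻¹ (b i).
  have hu : IsUnit (1 + V * R) := by
    have := isUnit_one_sub_of_norm_lt_one (x := -(V * R)) (by
      rw [norm_neg]; exact (norm_mul_le _ _).trans_lt hn)
    simpa using this
  obtain ⟨u, hu⟩ := hu
  set S : F →L[ℂ] F := (↑u⁻¹ : F →L[ℂ] F)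
  have h1 : ∀ x, S x + V (R (S x)) = x := by
    intro x
    have : (1 + V * R) * S = 1 := by rw [← hu]; exact u.mul_inv
    simpa using congrArg (fun f : F →L[ℂ] F => f x) this
  have hRs : ∀ x y, inner ℂ (R x) y = inner ℂ x (R y) := hR
  have hVs : ∀ x y, inner ℂ (V x) y = inner ℂ x (V y) := hV
  -- After substituting y = S y + V R S y on one side and the same for x on the other, both sides
  -- are the same expression in S x and S y.
  have hsymm : ((R ∘L S : F →L[ℂ] F) : F →ₗ[ℂ] F).IsSymmetric := by
    intro x y
    change inner ℂ (R (S x)) y = inner ℂ x (R (S y))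
    conv_lhs => rw [← h1 y]
    conv_rhs => rw [← h1 x]
    rw [inner_add_right, inner_add_left, hRs, hVs]
  have hinj : ∀ x, (R ∘L S) x = 0 → x = 0 := by
    intro x hx
    have h2 := hi _ hx
    have h2' : S x = 0 := h2
    rw [← h1 x, h2']; simp
  obtain ⟨ι, b, l, hb⟩ := exists_hilbertBasis_of_isCompactOperator (T := R ∘L S)
    (hc.comp_clm S) hsymm hinj
  refine ⟨ι, b, fun i => (l i)⁻¹, fun i => ((l i)⁻¹ : ℂ) • S (b i), fun i => ?_⟩
  have hl : (l i : ℂ) ≠ 0 := by exact_mod_cast (hb i).1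
  have h3 : R (S (b i)) = (l i : ℂ) • b i := (hb i).2
  have h4 : R (((l i)⁻¹ : ℂ) • S (b i)) = b i := by
    rw [map_smul, h3, smul_smul, inv_mul_cancel₀ hl, one_smul]
  refine ⟨h4, ?_⟩
  conv_lhs => rw [← h4]
  rw [h4]
  have h5 := h1 (b i)
  rw [h3, map_smul] at h5
  calc ((l i)⁻¹ : ℂ) • S (b i) + V (b i)
      = ((l i)⁻¹ : ℂ) • (S (b i) + (l i : ℂ) • V (b i)) := by
        rw [smul_add, smul_smul, inv_mul_cancel₀ hl, one_smul]
    _ = _ := by rw [h5]; push_cast; rfl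

/-- A diagonal operator whose entries tend to zero is compact. -/
lemma isCompactOperator_of_diagonal {κ : Type*} (b : HilbertBasis κ ℂ F) {r : κ → ℝ}
    (hr : Tendsto r cofinite (𝓝 0)) {T : F →L[ℂ] F}
    (hT : ∀ x k, inner ℂ (b k) (T x) = (r k : ℂ) * inner ℂ (b k) x) : IsCompactOperator T := by
  classical
  have hfin : ∀ n : ℕ, {k | 1 / ((n : ℝ) + 1) ≤ |r k|}.Finite := by
    intro n
    have := (hr.abs).eventually_lt_const (u := 1 / ((n : ℝ) + 1)) (by simp; positivity)
    rw [eventually_cofinite] at this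
    simpa using this
  let s : ℕ → Finset κ := fun n => (hfin n).toFinset
  -- Truncation to the finitely many entries of size at least 1/(n+1): finite rank, at operator
  -- distance at most 1/(n+1) from T.
  let G : ℕ → F →L[ℂ] F := fun n =>
    ∑ k ∈ s n, (r k : ℂ) • (innerSL ℂ (b k)).smulRight (b k)
  have hGc : ∀ n, IsCompactOperator (G n) := by
    intro n
    have h1 : ∀ x, G n x ∈ Submodule.span ℂ (b '' (s n : Set κ)) := by
      intro x
      simp only [G, _root_.sum_apply]
      refine Submodule.sum_mem _ fun k hk => ?_
      refine Submodule.smul_mem _ _ (Submodule.smul_mem _ _ (Submodule.subset_span ⟨k, hk, rfl⟩))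
    have hfd : FiniteDimensional ℂ (Submodule.span ℂ (b '' (s n : Set κ))) :=
      FiniteDimensional.span_of_finite ℂ ((s n).finite_toSet.image _)
    have hp : ProperSpace (Submodule.span ℂ (b '' (s n : Set κ))) := FiniteDimensional.proper ℂ _
    have h2 : IsCompactOperator ((G n).codRestrict (Submodule.span ℂ (b '' (s n : Set κ))) h1) :=
      isCompactOperator_of_locallyCompactSpace_dom _
    exact h2.clm_comp (Submodule.span ℂ (b '' (s n : Set κ))).subtypeL
  refine isCompactOperator_of_tendsto (F := G) (l := atTop) ?_ (Eventually.of_forall hGc)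
  rw [tendsto_iff_norm_sub_tendsto_zero]
  refine squeeze_zero (fun _ => norm_nonneg _) (fun n => ?_)
    (tendsto_one_div_add_atTop_nhds_zero_nat (𝕜 := ℝ))
  have hcoef : ∀ x k, inner ℂ (b k) ((G n - T) x) =
      (if k ∈ s n then 0 else -(r k : ℂ)) * inner ℂ (b k) x := by
    intro x k
    rw [_root_.sub_apply, inner_sub_right, hT]
    have : inner ℂ (b k) (G n x) = (if k ∈ s n then (r k : ℂ) else 0) * inner ℂ (b k) x := by
      simp only [G, _root_.sum_apply, _root_.smul_apply,
        ContinuousLinearMap.smulRight_apply, innerSL_apply_apply, inner_sum, inner_smul_right]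
      rw [ite_mul, zero_mul, ← Finset.sum_ite_eq (s n) k fun j => (r j : ℂ) * inner ℂ (b j) x]
      refine Finset.sum_congr rfl fun j _ => ?_
      rw [orthonormal_iff_ite.1 b.orthonormal k j]
      split_ifs <;> simp
    rw [this]
    split_ifs <;> ring
  refine ContinuousLinearMap.opNorm_le_bound _ (by positivity) fun x => ?_
  refine (pow_le_pow_iff_left₀ (norm_nonneg _) (by positivity) two_ne_zero).1 ?_
  rw [mul_pow]
  refine hasSum_le (fun k => ?_) (hilbertBasis_hasSum_norm_sq b ((G n - T) x))
    ((hilbertBasis_hasSum_norm_sq b x).mul_left ((1 / ((n : ℝ) + 1)) ^ 2))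
  rw [hcoef, norm_mul, mul_pow]
  refine mul_le_mul_of_nonneg_right (pow_le_pow_left₀ (norm_nonneg _) ?_ 2) (by positivity)
  split_ifs with h
  · simp; positivity
  · rw [norm_neg, Complex.norm_real, Real.norm_eq_abs]
    simp only [s, Set.Finite.mem_toFinset, Set.mem_ofPred_eq, not_le] at h
    exact h.le

end Abstract

end

section

/-! ### Plane waves as a Hilbert basis of the N-body space -/

section Fourier

lemma measurableSet_cube (L : ℝ) : MeasurableSet (cube L) := by
  have : cube L = ⋂ a, {x : Space | x a ∈ Set.Ico (-L / 2) (L / 2)} := by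
    ext x; simp [cube]
  rw [this]
  refine MeasurableSet.iInter fun a => ?_
  exact (by fun_prop : Measurable fun x : Space => x a) measurableSet_Ico

instance isFiniteMeasure_restrict_cube (L : ℝ) :
    IsFiniteMeasure ((volume : Measure Space).restrict (cube L)) := by
  refine ⟨?_⟩
  rw [Measure.restrict_apply_univ]
  have hsub : cube L ⊆ WithLp.ofLp ⁻¹' (Set.univ.pi fun _ : Fin 3 => Set.Ico (-L / 2) (L / 2)) := by
    intro x hx a _
    exact hx a
  refine (measure_mono hsub).trans_lt ?_
  rw [(PiLp.volume_preserving_ofLp (Fin 3)).measure_preimage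
    (MeasurableSet.univ_pi fun _ => measurableSet_Ico).nullMeasurableSet, volume_pi_pi]
  exact ENNReal.prod_lt_top fun _ _ => by simp

instance isFiniteMeasure_confMeasure (L : ℝ) (N : ℕ) : IsFiniteMeasure (confMeasure L N) := by
  unfold confMeasure
  infer_instance

lemma confMeasure_eq (L : ℝ) (N : ℕ) :
    confMeasure L N = (volume : Measure (Conf N)).restrict (Set.univ.pi fun _ => cube L) := by
  unfold confMeasure
  rw [volume_pi, Measure.restrict_pi_pi]

lemma ae_mem_cube (L : ℝ) (N : ℕ) : ∀ᵐ x ∂(confMeasure L N), ∀ i, x i ∈ cube L := by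
  rw [confMeasure_eq]
  filter_upwards [ae_restrict_mem (MeasurableSet.univ_pi fun _ => measurableSet_cube L)] with x hx i
  exact hx i (Set.mem_univ i)

lemma smul_mem_cube_iff {L r : ℝ} (hr : 0 < r) (x : Space) : r • x ∈ cube (r * L) ↔ x ∈ cube L := by
  simp only [cube, Set.mem_ofPred_eq, Set.mem_Ico, PiLp.smul_apply, smul_eq_mul]
  refine forall_congr' fun a => ?_
  rw [show -(r * L) / 2 = r * (-L / 2) by ring, show r * L / 2 = r * (L / 2) by ring,
    mul_le_mul_iff_right₀ hr, mul_lt_mul_iff_right₀ hr]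

lemma map_smul_confMeasure {r : ℝ} (hr : 0 < r) (L : ℝ) (N : ℕ) :
    Measure.map (fun x : Conf N => r • x) (confMeasure L N) =
      ENNReal.ofReal ((r ^ (3 * N))⁻¹) • confMeasure (r * L) N := by
  have hm : Measurable fun x : Conf N => r • x := measurable_const_smul r
  have hpre : (fun x : Conf N => r • x) ⁻¹' (Set.univ.pi fun _ => cube (r * L)) =
      Set.univ.pi fun _ => cube L := by
    ext x
    simp only [Set.mem_preimage, Set.mem_univ_pi, Pi.smul_apply, smul_mem_cube_iff hr]
  rw [confMeasure_eq, confMeasure_eq, ← hpre,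
    ← Measure.restrict_map hm (MeasurableSet.univ_pi fun _ => measurableSet_cube _),
    Measure.map_addHaar_smul _ hr.ne', Measure.restrict_smul]
  congr 2
  rw [abs_of_pos (by positivity)]
  congr 2
  simp [Module.finrank_pi_fintype, mul_comm]

/-- The normalised measure on the torus of dimension `3 N`. -/
abbrev torusMeasure (N : ℕ) : Measure (Fin N × Fin 3 → UnitAddCircle) :=
  Measure.pi fun _ => AddCircle.haarAddCircle

/-- The configuration in the unit cube represented by a point of the torus. -/
def torusSection (N : ℕ) (t : Fin N × Fin 3 → UnitAddCircle) : Conf N := fun j =>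
  WithLp.toLp 2 fun a => (AddCircle.equivIco (1 : ℝ) (-1 / 2) (t (j, a)) : ℝ)

lemma measurable_torusSection (N : ℕ) : Measurable (torusSection N) := by
  refine measurable_pi_lambda _ fun j => ?_
  refine (WithLp.measurable_toLp 2 (Fin 3 → ℝ)).comp (measurable_pi_lambda _ fun a => ?_)
  exact measurable_subtype_coe.comp ((AddCircle.measurableEquivIco (1 : ℝ) (-1 / 2)).measurable.comp
    (measurable_pi_apply _))

lemma volume_preimage_mk_inter (s : Set UnitAddCircle) (hs : MeasurableSet s) :
    volume ((fun x : ℝ => (x : UnitAddCircle)) ⁻¹' s ∩ Set.Ico (-1 / 2) (1 / 2)) =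
      AddCircle.haarAddCircle s := by
  have h := (AddCircle.measurePreserving_mk (1 : ℝ) (-1 / 2)).measure_preimage hs.nullMeasurableSet
  rw [AddCircle.volume_eq_smul_haarAddCircle, show (-1 / 2 + 1 : ℝ) = 1 / 2 by norm_num,
    ← Measure.restrict_congr_set Ico_ae_eq_Ioc, Measure.restrict_apply' measurableSet_Ico] at h
  simpa using h

lemma map_torus (N : ℕ) :
    Measure.map (fun (x : Conf N) (p : Fin N × Fin 3) => ((x p.1 p.2 : ℝ) : UnitAddCircle))
      (confMeasure 1 N) = torusMeasure N := by
  symm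
  refine Measure.pi_eq fun s hs => ?_
  have hm : Measurable fun (x : Conf N) (p : Fin N × Fin 3) =>
      ((x p.1 p.2 : ℝ) : UnitAddCircle) := by
    refine measurable_pi_lambda _ fun p => AddCircle.measurable_mk'.comp ?_
    fun_prop
  rw [Measure.map_apply hm (MeasurableSet.univ_pi hs)]
  have hpre : (fun (x : Conf N) (p : Fin N × Fin 3) => ((x p.1 p.2 : ℝ) : UnitAddCircle)) ⁻¹'
      Set.univ.pi s = Set.univ.pi fun j => {y : Space | ∀ a, ((y a : ℝ) : UnitAddCircle) ∈
        s (j, a)} := by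
    ext x
    simp
  rw [hpre, confMeasure, Measure.pi_pi, Fintype.prod_prod_type]
  refine Finset.prod_congr rfl fun j _ => ?_
  rw [Measure.restrict_apply' (measurableSet_cube 1)]
  have hset : {y : Space | ∀ a, ((y a : ℝ) : UnitAddCircle) ∈ s (j, a)} ∩ cube 1 =
      WithLp.ofLp ⁻¹' (Set.univ.pi fun a : Fin 3 => (fun x : ℝ => (x : UnitAddCircle)) ⁻¹' s (j, a) ∩
        Set.Ico (-1 / 2) (1 / 2)) := by
    ext x
    simp only [Set.mem_inter_iff, Set.mem_ofPred_eq, cube, Set.mem_preimage, Set.mem_univ_pi,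
      forall_and]
  rw [hset, (PiLp.volume_preserving_ofLp (Fin 3)).measure_preimage, volume_pi_pi]
  · exact Finset.prod_congr rfl fun a _ => volume_preimage_mk_inter _ (hs _)
  · refine (MeasurableSet.univ_pi fun a => ?_).nullMeasurableSet
    exact (AddCircle.measurable_mk' (hs _)).inter measurableSet_Ico

/-- Almost every point of the unit cube is recovered from its class, so the section inverts the
quotient map up to null sets. This brings the Fourier theory of `UnitAddTorus` to functions on a
cube. -/
lemma map_torusSection (N : ℕ) :
    Measure.map (torusSection N) (torusMeasure N) = confMeasure 1 N := by
  have hm : Measurable fun (x : Conf N) (p : Fin N × Fin 3) =>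
      ((x p.1 p.2 : ℝ) : UnitAddCircle) := by
    refine measurable_pi_lambda _ fun p => AddCircle.measurable_mk'.comp ?_
    fun_prop
  rw [← map_torus, Measure.map_map (measurable_torusSection N) hm]
  conv_rhs => rw [← Measure.map_id (μ := confMeasure 1 N)]
  refine Measure.map_congr ?_
  filter_upwards [ae_mem_cube 1 N] with x hx
  funext j
  ext a
  have h : x j a ∈ Set.Ico (-1 / 2 : ℝ) (-1 / 2 + 1) := by
    have := hx j a
    constructor
    · exact this.1
    · have := this.2; linarith
  simp only [Function.comp_apply, torusSection, id]
  rw [AddCircle.equivIco_coe_eq h]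

/-- The configuration in the cube of side `L` represented by a point of the torus. -/
def scaledSection (L : ℝ) (N : ℕ) (t : Fin N × Fin 3 → UnitAddCircle) : Conf N :=
  L • torusSection N t

/-- The factor L^(-3N) turns Lebesgue measure on the cube into a probability measure, as Haar
measure on the torus is. -/
lemma measurePreserving_scaledSection {L : ℝ} (hL : 0 < L) (N : ℕ) :
    MeasurePreserving (scaledSection L N) (torusMeasure N)
      (ENNReal.ofReal ((L ^ (3 * N))⁻¹) • confMeasure L N) := by
  refine ⟨(measurable_torusSection N).const_smul L, ?_⟩
  have h := map_smul_confMeasure hL 1 N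
  rw [mul_one, ← map_torusSection, Measure.map_map (measurable_const_smul L)
    (measurable_torusSection N)] at h
  exact h

lemma integral_scaledSection {L : ℝ} (hL : 0 < L) {N : ℕ} (g : Conf N → ℂ)
    (hg : AEStronglyMeasurable g (confMeasure L N)) :
    ∫ t, g (scaledSection L N t) ∂(torusMeasure N) =
      ((L ^ (3 * N))⁻¹ : ℝ) * ∫ x, g x ∂(confMeasure L N) := by
  have h := measurePreserving_scaledSection hL N
  rw [← integral_map h.measurable.aemeasurable (f := g), h.map_eq, integral_smul_measure,
    ENNReal.toReal_ofReal (by positivity)]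
  · rfl
  · rw [h.map_eq]; exact hg.smul_measure _

lemma planeWave_scaledSection {L : ℝ} (hL : 0 < L) {N : ℕ} (k : Fin N → Fin 3 → ℤ)
    (t : Fin N × Fin 3 → UnitAddCircle) :
    planeWave L k (scaledSection L N t) =
      UnitAddTorus.mFourier (fun p : Fin N × Fin 3 => k p.1 p.2) t := by
  have h1 : ∀ p : Fin N × Fin 3, fourier (k p.1 p.2) (t p) =
      Complex.exp (2 * Real.pi * Complex.I * k p.1 p.2 * (torusSection N t p.1 p.2 : ℝ)) := by
    intro p
    have h2 : t p = ((torusSection N t p.1 p.2 : ℝ) : UnitAddCircle) := by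
      simp [torusSection]
    rw [h2, fourier_coe_apply]
    simp
  change _ = ∏ p, fourier (k p.1 p.2) (t p)
  simp_rw [h1]
  rw [← Complex.exp_sum, planeWave]
  congr 1
  rw [Fintype.sum_prod_type]
  push_cast
  rw [Finset.mul_sum]
  refine Finset.sum_congr rfl fun j _ => ?_
  rw [PiLp.inner_apply]
  push_cast
  rw [Finset.mul_sum]
  refine Finset.sum_congr rfl fun a _ => ?_
  have hL' : (L : ℂ) ≠ 0 := by exact_mod_cast hL.ne'
  simp [wavevec, scaledSection]
  field_simp

lemma continuous_planeWave (L : ℝ) {N : ℕ} (k : Fin N → Fin 3 → ℤ) :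
    Continuous (planeWave L k) := by
  unfold planeWave
  fun_prop

lemma norm_planeWave (L : ℝ) {N : ℕ} (k : Fin N → Fin 3 → ℤ) (x : Conf N) :
    ‖planeWave L k x‖ = 1 := by
  rw [planeWave, mul_comm, Complex.norm_exp_ofReal_mul_I]

lemma memLp_planeWave' (L : ℝ) {N : ℕ} (k : Fin N → Fin 3 → ℤ) :
    MemLp (planeWave L k) 2 (confMeasure L N) :=
  MemLp.of_bound (continuous_planeWave L k).aestronglyMeasurable 1
    (Eventually.of_forall fun x => (norm_planeWave L k x).le)

/-- The Fourier coefficient of an `N`-body wave function. -/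
def bodyCoeff {L : ℝ} {N : ℕ} (f : NBody L N) (k : Fin N → Fin 3 → ℤ) : ℂ :=
  ∫ x, starRingEnd ℂ (planeWave L k x) * f x ∂(confMeasure L N)

/-- The normalisation constant of plane waves. -/
def waveNorm (L : ℝ) (N : ℕ) : ℝ := Real.sqrt ((L ^ (3 * N))⁻¹)

lemma waveNorm_pos {L : ℝ} (hL : 0 < L) (N : ℕ) : 0 < waveNorm L N :=
  Real.sqrt_pos.2 (by positivity)

lemma waveNorm_sq {L : ℝ} (hL : 0 < L) (N : ℕ) : waveNorm L N ^ 2 = (L ^ (3 * N))⁻¹ :=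
  Real.sq_sqrt (by positivity)

/-- The normalised plane wave. -/
def waveVector (L : ℝ) (N : ℕ) (k : Fin N → Fin 3 → ℤ) : NBody L N :=
  (waveNorm L N : ℂ) • (memLp_planeWave' L k).toLp

lemma inner_waveVector {L : ℝ} {N : ℕ} (k : Fin N → Fin 3 → ℤ) (f : NBody L N) :
    inner ℂ (waveVector L N k) f = waveNorm L N * bodyCoeff f k := by
  rw [waveVector, inner_smul_left, Complex.conj_ofReal, L2.inner_def, bodyCoeff]
  congr 1
  refine integral_congr_ae ?_
  filter_upwards [(memLp_planeWave' L k).coeFn_toLp] with x hx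
  rw [hx, RCLike.inner_apply, mul_comm]

lemma orthonormal_waveVector {L : ℝ} (hL : 0 < L) (N : ℕ) : Orthonormal ℂ (waveVector L N) := by
  classical
  have hinj : Function.Injective fun (k : Fin N → Fin 3 → ℤ) (p : Fin N × Fin 3) => k p.1 p.2 :=
    fun k l h => by
      funext j a
      exact congrFun h (j, a)
  have ho := (UnitAddTorus.orthonormal_mFourier (d := Fin N × Fin 3)).comp _ hinj
  rw [orthonormal_iff_ite] at ho ⊢
  intro k l
  rw [← ho k l, inner_waveVector, waveVector]
  have h1 : bodyCoeff ((waveNorm L N : ℂ) • (memLp_planeWave' L l).toLp) k =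
      waveNorm L N * ∫ x, starRingEnd ℂ (planeWave L k x) * planeWave L l x
        ∂(confMeasure L N) := by
    rw [bodyCoeff, ← integral_const_mul]
    refine integral_congr_ae ?_
    filter_upwards [(memLp_planeWave' L l).coeFn_toLp,
      Lp.coeFn_smul (waveNorm L N : ℂ) (memLp_planeWave' L l).toLp] with x hx hx2
    rw [hx2, Pi.smul_apply, hx, smul_eq_mul]
    ring
  have h2 := integral_scaledSection hL
    (fun x => starRingEnd ℂ (planeWave L k x) * planeWave L l x)
    (((Complex.continuous_conj.comp (continuous_planeWave L k)).mul
      (continuous_planeWave L l)).aestronglyMeasurable)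
  rw [h1, ← mul_assoc, ← sq]
  rw [show ((waveNorm L N : ℂ)) ^ 2 = (((L ^ (3 * N))⁻¹ : ℝ) : ℂ) by
    rw [← waveNorm_sq hL]; push_cast; rfl, ← h2]
  rw [Function.comp_apply, Function.comp_apply, ContinuousMap.inner_toLp]
  refine integral_congr_ae (Eventually.of_forall fun t => ?_)
  simp only [planeWave_scaledSection hL]
  rw [mul_comm]

/-- Completeness of the plane waves: composed with `scaledSection`, the function has vanishing
coefficients in `UnitAddTorus.mFourierBasis`, and vanishing almost everywhere is carried back by the
measure-preserving section. -/
lemma eq_zero_of_bodyCoeff {L : ℝ} (hL : 0 < L) {N : ℕ} (f : NBody L N)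
    (hf : ∀ k, bodyCoeff f k = 0) : f = 0 := by
  have hmp := measurePreserving_scaledSection hL N
  have hc : ENNReal.ofReal ((L ^ (3 * N))⁻¹) ≠ 0 := by
    rw [Ne, ENNReal.ofReal_eq_zero, not_le]; positivity
  have hfm : MemLp f 2 (ENNReal.ofReal ((L ^ (3 * N))⁻¹) • confMeasure L N) :=
    (Lp.memLp f).smul_measure ENNReal.ofReal_ne_top
  have hg : MemLp (f ∘ scaledSection L N) 2 (torusMeasure N) := hfm.comp_measurePreserving hmp
  have hrep : ∀ n : Fin N × Fin 3 → ℤ, UnitAddTorus.mFourierBasis.repr (hg.toLp) n = 0 := by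
    intro n
    rw [UnitAddTorus.mFourierBasis_repr, UnitAddTorus.mFourierCoeff]
    have h2 := integral_scaledSection hL
      (fun x => starRingEnd ℂ (planeWave L (fun j a => n (j, a)) x) * f x)
      ((Complex.continuous_conj.comp (continuous_planeWave L _)).aestronglyMeasurable.mul
        (Lp.aestronglyMeasurable f))
    have h3 := hf fun j a => n (j, a)
    rw [bodyCoeff] at h3
    rw [h3, mul_zero] at h2
    refine Eq.trans ?_ h2
    refine integral_congr_ae ?_
    filter_upwards [hg.coeFn_toLp] with t ht
    rw [ht, planeWave_scaledSection hL, UnitAddTorus.mFourier_neg]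
    rfl
  have hzero : hg.toLp = 0 := by
    apply UnitAddTorus.mFourierBasis.repr.injective
    ext n
    rw [hrep, map_zero]; rfl
  have h4 : ∀ᵐ t ∂(torusMeasure N), f (scaledSection L N t) = 0 := by
    have h5 := hg.coeFn_toLp
    rw [hzero] at h5
    have h6 := Lp.coeFn_zero ℂ 2 (torusMeasure N)
    filter_upwards [h5, h6] with t ht ht2
    have h7 := ht.symm.trans ht2
    simpa using h7
  have h5 : ∀ᵐ x ∂(ENNReal.ofReal ((L ^ (3 * N))⁻¹) • confMeasure L N), f x = 0 := by
    rw [← hmp.map_eq, ae_map_iff hmp.measurable.aemeasurable]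
    · exact h4
    · exact (Lp.stronglyMeasurable f).measurable (measurableSet_singleton 0)
  rw [Lp.eq_zero_iff_ae_eq_zero]
  exact (Measure.absolutelyContinuous_smul hc).ae_le h5

/-- The Hilbert basis of plane waves. -/
def waveBasis {L : ℝ} (hL : 0 < L) (N : ℕ) : HilbertBasis (Fin N → Fin 3 → ℤ) ℂ (NBody L N) :=
  HilbertBasis.mkOfOrthogonalEqBot (orthonormal_waveVector hL N) (by
    rw [eq_bot_iff]
    intro f hf
    rw [Submodule.mem_bot]
    refine eq_zero_of_bodyCoeff hL f fun k => ?_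
    have h := (Submodule.mem_orthogonal _ _).1 hf _ (Submodule.subset_span ⟨k, rfl⟩)
    rw [inner_waveVector] at h
    exact (mul_eq_zero.1 h).resolve_left (by exact_mod_cast (waveNorm_pos hL N).ne'))

lemma inner_waveBasis {L : ℝ} (hL : 0 < L) {N : ℕ} (k : Fin N → Fin 3 → ℤ) (f : NBody L N) :
    inner ℂ (waveBasis hL N k) f = waveNorm L N * bodyCoeff f k := by
  rw [waveBasis, HilbertBasis.coe_mkOfOrthogonalEqBot, inner_waveVector]

lemma ext_bodyCoeff {L : ℝ} (hL : 0 < L) {N : ℕ} {f g : NBody L N}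
    (h : ∀ k, bodyCoeff f k = bodyCoeff g k) : f = g :=
  hilbertBasis_ext_inner (waveBasis hL N) fun k => by
    rw [inner_waveBasis, inner_waveBasis, h]

end Fourier

end

section

/-! ### Antisymmetry in momentum space -/

section Permutations

lemma measurePreserving_perm (L : ℝ) {N : ℕ} (σ : Equiv.Perm (Fin N)) :
    MeasurePreserving (fun (x : Conf N) i => x (σ i)) (confMeasure L N) (confMeasure L N) := by
  have hm : MeasurePreserving (MeasurableEquiv.piCongrLeft (fun _ : Fin N => Space) σ.symm)
      (confMeasure L N) (confMeasure L N) :=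
    measurePreserving_piCongrLeft
      (fun _ : Fin N => (volume : Measure Space).restrict (cube L)) σ.symm
  convert hm using 1
  funext x i
  have := Equiv.piCongrLeft_apply_apply (fun _ : Fin N => Space) σ.symm x (σ i)
  simpa [MeasurableEquiv.coe_piCongrLeft] using this.symm

lemma planeWave_perm (L : ℝ) {N : ℕ} (σ : Equiv.Perm (Fin N)) (k : Fin N → Fin 3 → ℤ)
    (x : Conf N) : planeWave L (fun i => k (σ i)) (fun i => x (σ i)) = planeWave L k x := by
  unfold planeWave
  congr 3
  exact Equiv.sum_comp σ fun j => inner ℝ (wavevec L k j) (x j)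

lemma integral_perm_coeff {L : ℝ} {N : ℕ} (σ : Equiv.Perm (Fin N)) (k : Fin N → Fin 3 → ℤ)
    (f : NBody L N) :
    ∫ x, starRingEnd ℂ (planeWave L k x) * f (fun i => x (σ i)) ∂(confMeasure L N) =
      bodyCoeff f fun i => k (σ i) := by
  have h := measurePreserving_perm L σ
  have h2 := integral_map (μ := confMeasure L N) h.measurable.aemeasurable
    (f := fun x => starRingEnd ℂ (planeWave L (fun i => k (σ i)) x) * f x) (by
      rw [h.map_eq]
      exact (Complex.continuous_conj.comp (continuous_planeWave L _)).aestronglyMeasurable.mul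
        (Lp.aestronglyMeasurable f))
  rw [h.map_eq] at h2
  rw [bodyCoeff, h2]
  simp only [planeWave_perm]

lemma bodyCoeff_smul {L : ℝ} {N : ℕ} (c : ℂ) (f : NBody L N) (k : Fin N → Fin 3 → ℤ) :
    bodyCoeff (c • f) k = c * bodyCoeff f k := by
  rw [bodyCoeff, bodyCoeff, ← integral_const_mul]
  refine integral_congr_ae ?_
  filter_upwards [Lp.coeFn_smul c f] with x hx
  simp only [hx, Pi.smul_apply, smul_eq_mul]
  ring

/-- Permuting positions permutes momenta. In this form it is evident that a permutation-invariant
Fourier multiplier preserves antisymmetry and that the fermionic subspace is closed. -/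
lemma mem_fermi_iff_bodyCoeff {L : ℝ} (hL : 0 < L) {N : ℕ} (f : NBody L N) :
    f ∈ fermi L N ↔ ∀ (σ : Equiv.Perm (Fin N)) (k : Fin N → Fin 3 → ℤ),
      bodyCoeff f (fun i => k (σ i)) = ((Equiv.Perm.sign σ : ℤ) : ℂ) * bodyCoeff f k := by
  refine forall_congr' fun σ => ?_
  constructor
  · intro h k
    rw [← integral_perm_coeff σ k f, bodyCoeff, ← integral_const_mul]
    refine integral_congr_ae ?_
    filter_upwards [h] with x hx
    rw [hx]; ring
  · intro h
    have h1 : Lp.compMeasurePreserving _ (measurePreserving_perm L σ) f =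
        ((Equiv.Perm.sign σ : ℤ) : ℂ) • f := by
      refine ext_bodyCoeff hL fun k => ?_
      rw [bodyCoeff_smul, ← h, ← integral_perm_coeff σ k f, bodyCoeff]
      refine integral_congr_ae ?_
      filter_upwards [Lp.coeFn_compMeasurePreserving f (measurePreserving_perm L σ)] with x hx
      rw [hx]; rfl
    have h2 := Lp.coeFn_compMeasurePreserving f (measurePreserving_perm L σ)
    rw [h1] at h2
    filter_upwards [h2, Lp.coeFn_smul ((Equiv.Perm.sign σ : ℤ) : ℂ) f] with x hx hx2
    rw [hx2] at hx
    exact hx.symm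

lemma isClosed_fermi {L : ℝ} (hL : 0 < L) (N : ℕ) : IsClosed (fermi L N : Set (NBody L N)) := by
  have : (fermi L N : Set (NBody L N)) = ⋂ (σ : Equiv.Perm (Fin N)) (k : Fin N → Fin 3 → ℤ),
      {f | inner ℂ (waveBasis hL N fun i => k (σ i)) f =
        ((Equiv.Perm.sign σ : ℤ) : ℂ) * inner ℂ (waveBasis hL N k) f} := by
    ext f
    simp only [SetLike.mem_coe, mem_fermi_iff_bodyCoeff hL, Set.mem_iInter, Set.mem_ofPred_eq,
      inner_waveBasis]
    refine forall_congr' fun σ => forall_congr' fun k => ?_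
    have : (waveNorm L N : ℂ) ≠ 0 := by exact_mod_cast (waveNorm_pos hL N).ne'
    rw [mul_left_comm, mul_right_inj' this]
  rw [this]
  refine isClosed_iInter fun σ => isClosed_iInter fun k => isClosed_eq ?_ ?_ <;> fun_prop

end Permutations

/-! ### Fourier multipliers and multiplication operators as graph relations -/

section Multipliers

variable {L : ℝ}

/-- `φ` is the image of `ψ` under the Fourier multiplier `m`. -/
def FMul (m : ∀ N : ℕ, (Fin N → Fin 3 → ℤ) → ℝ) (ψ φ : Fock L) : Prop :=
  ∀ N k, coeff φ N k = (m N k : ℂ) * coeff ψ N k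

/-- `φ` is the image of `ψ` under multiplication by `u`. -/
def MMul (u : ∀ N : ℕ, Conf N → ℝ) (ψ φ : Fock L) : Prop :=
  ∀ N, ∀ᵐ x ∂(confMeasure L N), wave φ N x = (u N x : ℂ) * wave ψ N x

lemma fock_ext_coeff (hL : 0 < L) {ψ φ : Fock L} (h : ∀ N k, coeff ψ N k = coeff φ N k) :
    ψ = φ := by
  ext N : 2
  exact Subtype.ext (ext_bodyCoeff hL (h N))

lemma fock_ext_wave {ψ φ : Fock L} (h : ∀ N, wave ψ N =ᵐ[confMeasure L N] wave φ N) :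
    ψ = φ := by
  ext N : 2
  exact Subtype.ext (Lp.ext (h N))

lemma FMul.unique (hL : 0 < L) {m : ∀ N : ℕ, (Fin N → Fin 3 → ℤ) → ℝ} {ψ φ φ' : Fock L}
    (h : FMul m ψ φ) (h' : FMul m ψ φ') : φ = φ' :=
  fock_ext_coeff hL fun N k => by rw [h, h']

lemma MMul.unique {u : ∀ N : ℕ, Conf N → ℝ} {ψ φ φ' : Fock L}
    (h : MMul u ψ φ) (h' : MMul u ψ φ') : φ = φ' :=
  fock_ext_wave fun N => by
    filter_upwards [h N, h' N] with x h1 h2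
    rw [h1, h2]

/-- `Submodule.toLinearPMap` has the intended values only for a single-valued submodule; here this
is the uniqueness of Fourier coefficients, which needs 0 < L. -/
lemma fourierMultiplier_apply (hL : 0 < L) {m : ∀ N : ℕ, (Fin N → Fin 3 → ℤ) → ℝ}
    (ψ : (fourierMultiplier L m).domain) : FMul m ψ (fourierMultiplier L m ψ) := by
  refine Submodule.mem_graph_toLinearPMap (g := _) ?_ ψ
  rintro ⟨x, y⟩ h1 (h2 : x = 0)
  refine fock_ext_coeff hL fun N k => ?_
  have := h1 N k
  rw [coeff_zero]
  rw [h2, coeff_zero, mul_zero] at this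
  exact this

lemma FMul.mem_domain {m : ∀ N : ℕ, (Fin N → Fin 3 → ℤ) → ℝ} {ψ φ : Fock L}
    (h : FMul m ψ φ) : ψ ∈ (fourierMultiplier L m).domain :=
  Submodule.mem_map.2 ⟨(ψ, φ), h, rfl⟩

lemma multiplication_apply {u : ∀ N : ℕ, Conf N → ℝ}
    (ψ : (multiplication L u).domain) : MMul u ψ (multiplication L u ψ) := by
  refine Submodule.mem_graph_toLinearPMap (g := _) ?_ ψ
  rintro ⟨x, y⟩ h1 (h2 : x = 0)
  refine fock_ext_wave fun N => ?_
  filter_upwards [h1 N, wave_zero L N] with x hx hx2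
  rw [hx2, hx, h2, hx2]
  simp

lemma MMul.mem_domain {u : ∀ N : ℕ, Conf N → ℝ} {ψ φ : Fock L}
    (h : MMul u ψ φ) : ψ ∈ (multiplication L u).domain :=
  Submodule.mem_map.2 ⟨(ψ, φ), h, rfl⟩

lemma FMul.add {m m' : ∀ N : ℕ, (Fin N → Fin 3 → ℤ) → ℝ} {ψ φ φ' : Fock L}
    (h : FMul m ψ φ) (h' : FMul m' ψ φ') : FMul (fun N k => m N k + m' N k) ψ (φ + φ') := by
  intro N k
  rw [coeff_add, h, h']
  push_cast; ring

lemma FMul.smul {m : ∀ N : ℕ, (Fin N → Fin 3 → ℤ) → ℝ} {ψ φ : Fock L}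
    (h : FMul m ψ φ) (c : ℝ) : FMul (fun N k => c * m N k) ψ ((c : ℂ) • φ) := by
  intro N k
  rw [coeff_smul, h]
  push_cast; ring

lemma MMul.add {u u' : ∀ N : ℕ, Conf N → ℝ} {ψ φ φ' : Fock L}
    (h : MMul u ψ φ) (h' : MMul u' ψ φ') : MMul (fun N x => u N x + u' N x) ψ (φ + φ') := by
  intro N
  filter_upwards [h N, h' N, wave_add φ φ' N] with x h1 h2 h3
  rw [h3, Pi.add_apply, h1, h2]
  push_cast; ring

lemma MMul.smul {u : ∀ N : ℕ, Conf N → ℝ} {ψ φ : Fock L}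
    (h : MMul u ψ φ) (c : ℝ) : MMul (fun N x => c * u N x) ψ ((c : ℂ) • φ) := by
  intro N
  filter_upwards [h N, wave_smul (c : ℂ) φ N] with x h1 h2
  rw [h2, Pi.smul_apply, h1, smul_eq_mul]
  push_cast; ring

/-- A function of N alone is diagonal both in position and in momentum. This is the bridge between
bounds on the interaction and bounds on the kinetic energy. -/
lemma mMul_number_iff (hL : 0 < L) (c : ℕ → ℝ) {ψ φ : Fock L} :
    MMul (fun N _ => c N) ψ φ ↔ FMul (fun N _ => c N) ψ φ := by
  have key : ∀ N, (∀ᵐ x ∂(confMeasure L N), wave φ N x = (c N : ℂ) * wave ψ N x) ↔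
      (φ N : NBody L N) = (c N : ℂ) • (ψ N : NBody L N) := by
    intro N
    constructor
    · intro h
      refine Lp.ext ?_
      filter_upwards [h, Lp.coeFn_smul (c N : ℂ) (ψ N : NBody L N)] with x hx hx2
      rw [hx2]; exact hx
    · intro h
      filter_upwards [Lp.coeFn_smul (c N : ℂ) (ψ N : NBody L N)] with x hx
      rw [wave, h, hx]; rfl
  have key2 : ∀ N, (∀ k, coeff φ N k = (c N : ℂ) * coeff ψ N k) ↔
      (φ N : NBody L N) = (c N : ℂ) • (ψ N : NBody L N) := by
    intro N
    constructor
    · intro h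
      refine ext_bodyCoeff hL fun k => ?_
      rw [bodyCoeff_smul]; exact h k
    · intro h k
      change bodyCoeff (φ N : NBody L N) k = _
      rw [h, bodyCoeff_smul]; rfl
  exact forall_congr' fun N => (key N).trans (key2 N).symm

/-- The normalised Fourier coefficients as linear functionals on Fock space. -/
def fockCoeff (L : ℝ) (p : Σ N : ℕ, Fin N → Fin 3 → ℤ) : Fock L →ₗ[ℂ] ℂ where
  toFun ψ := waveNorm L p.1 * coeff ψ p.1 p.2
  map_add' ψ φ := by rw [coeff_add, mul_add]
  map_smul' c ψ := by rw [coeff_smul, RingHom.id_apply, smul_eq_mul, mul_left_comm]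

lemma fockCoeff_eq_inner (hL : 0 < L) (p : Σ N : ℕ, Fin N → Fin 3 → ℤ) (ψ : Fock L) :
    fockCoeff L p ψ = inner ℂ (waveBasis hL p.1 p.2) (ψ p.1 : NBody L p.1) := by
  rw [inner_waveBasis]; rfl

lemma hasSum_norm_sq_body (ψ : Fock L) :
    HasSum (fun N => ‖(ψ N : NBody L N)‖ ^ 2) (‖ψ‖ ^ 2) := by
  have h := Complex.hasSum_re (lp.hasSum_inner (𝕜 := ℂ) ψ ψ)
  rw [inner_self_eq_norm_sq_to_K] at h
  norm_cast at h
  refine h.congr_fun fun N => ?_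
  rw [inner_self_eq_norm_sq_to_K]
  norm_cast

lemma hasSum_norm_sq_fockCoeff (hL : 0 < L) (ψ : Fock L) :
    HasSum (fun p => ‖fockCoeff L p ψ‖ ^ 2) (‖ψ‖ ^ 2) := by
  have h1 : ∀ N, HasSum (fun k => ‖fockCoeff L ⟨N, k⟩ ψ‖ ^ 2) (‖(ψ N : NBody L N)‖ ^ 2) := by
    intro N
    simp_rw [fockCoeff_eq_inner hL]
    exact hilbertBasis_hasSum_norm_sq _ _
  refine HasSum.sigma_of_hasSum (hasSum_norm_sq_body ψ) h1 ?_
  refine (summable_sigma_of_nonneg fun _ => by positivity).2 ⟨fun N => (h1 N).summable, ?_⟩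
  simp_rw [fun N => (h1 N).tsum_eq]
  exact (hasSum_norm_sq_body ψ).summable

lemma hasSum_inner_fockCoeff (hL : 0 < L) (ψ φ : Fock L) :
    HasSum (fun p => starRingEnd ℂ (fockCoeff L p ψ) * fockCoeff L p φ) (inner ℂ ψ φ) := by
  have hs : Summable fun p => starRingEnd ℂ (fockCoeff L p ψ) * fockCoeff L p φ := by
    refine Summable.of_norm_bounded
      (((hasSum_norm_sq_fockCoeff hL ψ).add (hasSum_norm_sq_fockCoeff hL φ)).summable) fun p => ?_
    rw [norm_mul, RCLike.norm_conj]
    nlinarith [sq_nonneg (‖fockCoeff L p ψ‖ - ‖fockCoeff L p φ‖), norm_nonneg (fockCoeff L p ψ),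
      norm_nonneg (fockCoeff L p φ)]
  refine HasSum.sigma_of_hasSum (lp.hasSum_inner (𝕜 := ℂ) ψ φ) (fun N => ?_) hs
  have h := (waveBasis hL N).hasSum_inner_mul_inner (ψ N : NBody L N) (φ N : NBody L N)
  refine h.congr_fun fun k => ?_
  rw [fockCoeff_eq_inner hL, fockCoeff_eq_inner hL, inner_conj_symm]

lemma FMul.fockCoeff_eq {m : ∀ N : ℕ, (Fin N → Fin 3 → ℤ) → ℝ} {ψ φ : Fock L}
    (h : FMul m ψ φ) (p : Σ N : ℕ, Fin N → Fin 3 → ℤ) :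
    fockCoeff L p φ = (m p.1 p.2 : ℂ) * fockCoeff L p ψ := by
  change (waveNorm L p.1 : ℂ) * coeff φ p.1 p.2 = _ * (_ * coeff ψ p.1 p.2)
  rw [h]; ring

lemma FMul.hasSum_inner (hL : 0 < L) {m : ∀ N : ℕ, (Fin N → Fin 3 → ℤ) → ℝ} {ψ φ : Fock L}
    (h : FMul m ψ φ) :
    HasSum (fun p : Σ N : ℕ, Fin N → Fin 3 → ℤ => ‖fockCoeff L p ψ‖ ^ 2 * m p.1 p.2)
      (inner ℂ ψ φ).re := by
  refine (Complex.hasSum_re (hasSum_inner_fockCoeff hL ψ φ)).congr_fun fun p => ?_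
  rw [h.fockCoeff_eq, mul_left_comm, mul_comm (starRingEnd ℂ _), Complex.mul_conj,
    Complex.normSq_eq_norm_sq, ← Complex.ofReal_mul, Complex.ofReal_re, mul_comm]

lemma FMul.re_inner_nonneg (hL : 0 < L) {m : ∀ N : ℕ, (Fin N → Fin 3 → ℤ) → ℝ} {ψ φ : Fock L}
    (h : FMul m ψ φ) (hm : ∀ N k, 0 ≤ m N k) : 0 ≤ (inner ℂ ψ φ).re :=
  (h.hasSum_inner hL).nonneg fun p => mul_nonneg (by positivity) (hm _ _)

lemma FMul.inner_symm (hL : 0 < L) {m : ∀ N : ℕ, (Fin N → Fin 3 → ℤ) → ℝ} {ψ φ ψ' φ' : Fock L}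
    (h : FMul m ψ φ) (h' : FMul m ψ' φ') : inner ℂ φ ψ' = inner ℂ ψ φ' := by
  refine (hasSum_inner_fockCoeff hL φ ψ').unique
    ((hasSum_inner_fockCoeff hL ψ φ').congr_fun fun p => ?_)
  rw [h.fockCoeff_eq, h'.fockCoeff_eq, map_mul, Complex.conj_ofReal]
  ring

lemma inner_body_eq (ψ φ : Fock L) (N : ℕ) : inner ℂ (ψ N) (φ N) =
    ∫ x, starRingEnd ℂ (wave ψ N x) * wave φ N x ∂(confMeasure L N) := by
  rw [Submodule.coe_inner, L2.inner_def]
  refine integral_congr_ae (Eventually.of_forall fun x => ?_)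
  simp only [RCLike.inner_apply, wave]
  ring

lemma MMul.inner_symm {u : ∀ N : ℕ, Conf N → ℝ} {ψ φ ψ' φ' : Fock L}
    (h : MMul u ψ φ) (h' : MMul u ψ' φ') : inner ℂ φ ψ' = inner ℂ ψ φ' := by
  rw [lp.inner_eq_tsum, lp.inner_eq_tsum]
  refine tsum_congr fun N => ?_
  rw [inner_body_eq, inner_body_eq]
  refine integral_congr_ae ?_
  filter_upwards [h N, h' N] with x h1 h2
  rw [h1, h2, map_mul, Complex.conj_ofReal]
  ring

lemma MMul.re_inner_nonneg {u : ∀ N : ℕ, Conf N → ℝ} {ψ φ : Fock L}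
    (h : MMul u ψ φ) (hu : ∀ N, ∀ᵐ x ∂(confMeasure L N), 0 ≤ u N x) :
    0 ≤ (inner ℂ ψ φ).re := by
  refine (Complex.hasSum_re (lp.hasSum_inner (𝕜 := ℂ) ψ φ)).nonneg fun N => ?_
  have h1 : (inner ℂ (ψ N) (φ N) : ℂ) =
      ((∫ x, u N x * ‖wave ψ N x‖ ^ 2 ∂(confMeasure L N) : ℝ) : ℂ) := by
    rw [inner_body_eq, ← integral_complex_ofReal]
    refine integral_congr_ae ?_
    filter_upwards [h N] with x hx
    rw [hx, mul_left_comm, mul_comm (starRingEnd ℂ _), Complex.mul_conj,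
      Complex.normSq_eq_norm_sq]
    push_cast; rfl
  rw [h1, Complex.ofReal_re]
  refine integral_nonneg_of_ae ?_
  filter_upwards [hu N] with x hx
  exact mul_nonneg hx (by positivity)

lemma exists_fock_of_body (ψ : Fock L) (g : ∀ N, fermi L N) {C : ℝ}
    (hg : ∀ N, ‖g N‖ ≤ C * ‖ψ N‖) : ∃ φ : Fock L, ∀ N, φ N = g N := by
  have hmem : Memℓp g 2 := by
    refine ((lp.memℓp ψ).const_smul (C : ℂ)).mono' fun N => ?_
    rw [Pi.smul_apply, norm_smul, Complex.norm_real, Real.norm_eq_abs]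
    exact (hg N).trans (mul_le_mul_of_nonneg_right (le_abs_self C) (norm_nonneg _))
  exact ⟨⟨g, hmem⟩, fun N => rfl⟩

/-- Domains are compared through pointwise domination of the multipliers; the invariance of u' under
permutations keeps the product antisymmetric. A single constant for all N makes the result
square-summable over the sectors. -/
lemma MMul.exists_of_le {u u' : ∀ N : ℕ, Conf N → ℝ} {ψ φ : Fock L} (h : MMul u ψ φ)
    (hmeas : ∀ N, AEStronglyMeasurable (u' N) (confMeasure L N))
    (hsymm : ∀ N (σ : Equiv.Perm (Fin N)) x, u' N (fun i => x (σ i)) = u' N x) {C : ℝ}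
    (hle : ∀ N, ∀ᵐ x ∂(confMeasure L N), |u' N x| ≤ C * |u N x|) :
    ∃ φ' : Fock L, MMul u' ψ φ' := by
  have hb : ∀ N, ∀ᵐ x ∂(confMeasure L N),
      ‖(u' N x : ℂ) * wave ψ N x‖ ≤ C * ‖wave φ N x‖ := by
    intro N
    filter_upwards [h N, hle N] with x h1 h2
    rw [h1, norm_mul, norm_mul, Complex.norm_real, Complex.norm_real, ← mul_assoc]
    exact mul_le_mul_of_nonneg_right h2 (norm_nonneg _)
  have hmem : ∀ N, MemLp (fun x => (u' N x : ℂ) * wave ψ N x) 2 (confMeasure L N) := fun N =>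
    MemLp.of_le_mul (Lp.memLp (φ N : NBody L N))
      ((Complex.continuous_ofReal.comp_aestronglyMeasurable (hmeas N)).mul
        (Lp.aestronglyMeasurable (ψ N : NBody L N))) (hb N)
  have hfermi : ∀ N, (hmem N).toLp ∈ fermi L N := by
    intro N σ
    have h1 := (hmem N).coeFn_toLp
    filter_upwards [h1, ae_comp_perm σ h1, (ψ N).2 σ] with x h2 h3 h4
    rw [h2, h3, hsymm]
    simp only [wave]
    rw [h4]; ring
  obtain ⟨φ', hφ'⟩ := exists_fock_of_body φ (fun N => ⟨_, hfermi N⟩) (C := C) fun N => by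
    change ‖(hmem N).toLp‖ ≤ C * ‖(φ N : NBody L N)‖
    refine Lp.norm_le_mul_norm_of_ae_le_mul ?_
    filter_upwards [(hmem N).coeFn_toLp, hb N] with x h1 h2
    rw [h1]; exact h2
  refine ⟨φ', fun N => ?_⟩
  filter_upwards [(hmem N).coeFn_toLp] with x h1
  rw [← h1]
  simp only [wave, hφ']

lemma FMul.exists_of_le (hL : 0 < L) {m m' : ∀ N : ℕ, (Fin N → Fin 3 → ℤ) → ℝ} {ψ φ : Fock L}
    (h : FMul m ψ φ)
    (hsymm : ∀ N (σ : Equiv.Perm (Fin N)) k, m' N (fun i => k (σ i)) = m' N k) {C : ℝ}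
    (hC : 0 ≤ C) (hle : ∀ N k, |m' N k| ≤ C * |m N k|) :
    ∃ φ' : Fock L, FMul m' ψ φ' := by
  have hb : ∀ N k, ‖(m' N k : ℂ) * (waveBasis hL N).repr (ψ N : NBody L N) k‖ ≤
      ‖((C : ℂ) • (waveBasis hL N).repr (φ N : NBody L N)) k‖ := by
    intro N k
    rw [lp.coeFn_smul, Pi.smul_apply, norm_smul, HilbertBasis.repr_apply_apply,
      HilbertBasis.repr_apply_apply, inner_waveBasis, inner_waveBasis]
    have h1 : bodyCoeff (φ N : NBody L N) k = m N k * bodyCoeff (ψ N : NBody L N) k := h N k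
    rw [h1]
    simp only [norm_mul, Complex.norm_real, Real.norm_eq_abs]
    rw [abs_of_nonneg hC]
    calc _ ≤ C * |m N k| * (|waveNorm L N| * ‖bodyCoeff (ψ N : NBody L N) k‖) :=
          mul_le_mul_of_nonneg_right (hle N k) (by positivity)
      _ = _ := by ring
  have hmem : ∀ N, Memℓp (fun k => (m' N k : ℂ) * (waveBasis hL N).repr (ψ N : NBody L N) k) 2 :=
    fun N => (lp.memℓp ((C : ℂ) • (waveBasis hL N).repr (φ N : NBody L N))).mono' (hb N)
  let g : ∀ N, NBody L N := fun N => (waveBasis hL N).repr.symm ⟨_, hmem N⟩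
  have hrepr : ∀ N k, inner ℂ (waveBasis hL N k) (g N) =
      (m' N k : ℂ) * (waveBasis hL N).repr (ψ N : NBody L N) k := by
    intro N k
    rw [← HilbertBasis.repr_apply_apply]
    simp [g]
  have hg : ∀ N k, bodyCoeff (g N) k = m' N k * bodyCoeff (ψ N : NBody L N) k := by
    intro N k
    have h1 := hrepr N k
    rw [HilbertBasis.repr_apply_apply, inner_waveBasis, inner_waveBasis, mul_left_comm] at h1
    exact mul_left_cancel₀ (by exact_mod_cast (waveNorm_pos hL N).ne') h1
  have hfermi : ∀ N, g N ∈ fermi L N := by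
    intro N
    rw [mem_fermi_iff_bodyCoeff hL]
    intro σ k
    rw [hg, hg, hsymm, (mem_fermi_iff_bodyCoeff hL _).1 (ψ N).2 σ k]
    ring
  obtain ⟨φ', hφ'⟩ := exists_fock_of_body φ (fun N => ⟨_, hfermi N⟩) (C := C) fun N => by
    change ‖g N‖ ≤ C * ‖(φ N : NBody L N)‖
    refine (pow_le_pow_iff_left₀ (norm_nonneg _) (by positivity) two_ne_zero).1 ?_
    rw [mul_pow]
    refine hasSum_le (fun k => ?_) (hilbertBasis_hasSum_norm_sq (waveBasis hL N) (g N))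
      ((hilbertBasis_hasSum_norm_sq (waveBasis hL N) (φ N : NBody L N)).mul_left (C ^ 2))
    rw [hrepr]
    have := hb N k
    rw [lp.coeFn_smul, Pi.smul_apply, norm_smul, HilbertBasis.repr_apply_apply _ (φ N : NBody L N),
      Complex.norm_real, Real.norm_eq_abs, abs_of_nonneg hC] at this
    rw [← mul_pow]
    exact pow_le_pow_left₀ (norm_nonneg _) this 2
  refine ⟨φ', fun N k => ?_⟩
  change bodyCoeff (φ' N : NBody L N) k = _
  rw [hφ']
  exact hg N k

end Multipliers

end

section

/-! ### The Hamiltonian and its multipliers -/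

section Hamiltonian

variable {L : ℝ}

/-- The Fourier multiplier of the kinetic energy. -/
def kineticMul (L : ℝ) (N : ℕ) (k : Fin N → Fin 3 → ℤ) : ℝ := ∑ j, ‖wavevec L k j‖ ^ 2 / 2

/-- The Fourier multiplier of the momentum in direction `α`. -/
def momentumMul (L : ℝ) (α : Space) (N : ℕ) (k : Fin N → Fin 3 → ℤ) : ℝ :=
  ∑ j, inner ℝ α (wavevec L k j)

/-- The pair interaction as a function on configurations. -/
def pairEnergy (L : ℝ) (U : Space → ℝ) (N : ℕ) (x : Conf N) : ℝ :=
  (1 / 2) * ∑ i, ∑ j ∈ Finset.univ.erase i, periodise L U (x i - x j)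

lemma number_mem_of_fMul (hL : 0 < L) {ψ φ : Fock L} (h : FMul (fun N _ => (N : ℝ)) ψ φ) :
    ψ ∈ (number L).domain :=
  MMul.mem_domain ((mMul_number_iff hL fun N => (N : ℝ)).2 h)

/-- The components of the action of the Hamiltonian on a vector. -/
structure HamiltonianParts (W : Space → ℝ) (α : Space) (ψ φK φV φP φN : Fock L) : Prop where
  kin : FMul (kineticMul L) ψ φK
  pot : MMul (pairEnergy L W) ψ φV
  mom : FMul (momentumMul L α) ψ φP
  num : FMul (fun N _ => (N : ℝ)) ψ φN

lemma exists_hamiltonianParts (hL : 0 < L) {W : Space → ℝ} {α : Space} {μ : ℝ}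
    (ψ : (hamiltonian W L α μ).domain) :
    ∃ φK φV φP φN, HamiltonianParts W α ψ φK φV φP φN ∧
      hamiltonian W L α μ ψ = φK + φV - φP - (μ : ℂ) • φN := by
  obtain ⟨ψ, h⟩ := ψ
  have h1 : ψ ∈ (kinetic L).domain := h.1.1.1
  have h2 : ψ ∈ (interaction L W).domain := h.1.1.2
  have h3 : ψ ∈ (momentum L α).domain := h.1.2
  have h4 : ψ ∈ (number L).domain := h.2
  exact ⟨kinetic L ⟨ψ, h1⟩, interaction L W ⟨ψ, h2⟩, momentum L α ⟨ψ, h3⟩, number L ⟨ψ, h4⟩,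
    ⟨fourierMultiplier_apply hL ⟨ψ, h1⟩, multiplication_apply ⟨ψ, h2⟩,
      fourierMultiplier_apply hL ⟨ψ, h3⟩,
      (mMul_number_iff hL fun N => (N : ℝ)).1 (multiplication_apply ⟨ψ, h4⟩)⟩, rfl⟩

lemma HamiltonianParts.mem_domain (hL : 0 < L) {W : Space → ℝ} {α : Space}
    {ψ φK φV φP φN : Fock L} (h : HamiltonianParts W α ψ φK φV φP φN) (μ : ℝ) :
    ψ ∈ (hamiltonian W L α μ).domain :=
  ⟨⟨⟨h.kin.mem_domain, h.pot.mem_domain⟩, h.mom.mem_domain⟩, number_mem_of_fMul hL h.num⟩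

lemma HamiltonianParts.unique (hL : 0 < L) {W : Space → ℝ} {α : Space}
    {ψ φK φV φP φN φK' φV' φP' φN' : Fock L} (h : HamiltonianParts W α ψ φK φV φP φN)
    (h' : HamiltonianParts W α ψ φK' φV' φP' φN') :
    φK = φK' ∧ φV = φV' ∧ φP = φP' ∧ φN = φN' :=
  ⟨h.kin.unique hL h'.kin, h.pot.unique h'.pot, h.mom.unique hL h'.mom, h.num.unique hL h'.num⟩

lemma HamiltonianParts.apply (hL : 0 < L) {W : Space → ℝ} {α : Space} {μ : ℝ}
    {ψ φK φV φP φN : Fock L} (h : HamiltonianParts W α ψ φK φV φP φN)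
    (hψ : ψ ∈ (hamiltonian W L α μ).domain) :
    hamiltonian W L α μ ⟨ψ, hψ⟩ = φK + φV - φP - (μ : ℂ) • φN := by
  obtain ⟨a, b, c, d, h1, h2⟩ := exists_hamiltonianParts hL ⟨ψ, hψ⟩
  obtain ⟨rfl, rfl, rfl, rfl⟩ := h.unique hL h1
  exact h2

lemma isSymm_hamiltonian (hL : 0 < L) (W : Space → ℝ) (α : Space) (μ : ℝ) :
    IsSymm (hamiltonian W L α μ) := by
  intro x y
  obtain ⟨a, b, c, d, h1, h2⟩ := exists_hamiltonianParts hL x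
  obtain ⟨a', b', c', d', h1', h2'⟩ := exists_hamiltonianParts hL y
  rw [h2, h2']
  simp only [inner_add_left, inner_add_right, inner_sub_left, inner_sub_right, inner_smul_left,
    inner_smul_right, Complex.conj_ofReal]
  rw [h1.kin.inner_symm hL h1'.kin, h1.pot.inner_symm h1'.pot, h1.mom.inner_symm hL h1'.mom,
    h1.num.inner_symm hL h1'.num]

lemma expval_fourierMultiplier (hL : 0 < L) {m : ∀ N : ℕ, (Fin N → Fin 3 → ℤ) → ℝ} {ψ φ : Fock L}
    (h : FMul m ψ φ) : expval (fourierMultiplier L m) ψ = ((inner ℂ ψ φ).re : ℂ) := by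
  rw [expval, dif_pos h.mem_domain, (fourierMultiplier_apply hL ⟨ψ, h.mem_domain⟩).unique hL h]
  refine (Complex.conj_eq_iff_re.1 ?_).symm
  rw [inner_conj_symm, h.inner_symm hL h]

lemma expval_multiplication {u : ∀ N : ℕ, Conf N → ℝ} {ψ φ : Fock L}
    (h : MMul u ψ φ) : expval (multiplication L u) ψ = ((inner ℂ ψ φ).re : ℂ) := by
  rw [expval, dif_pos h.mem_domain, (multiplication_apply ⟨ψ, h.mem_domain⟩).unique h]
  refine (Complex.conj_eq_iff_re.1 ?_).symm
  rw [inner_conj_symm, h.inner_symm h]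

lemma kineticMul_nonneg (L : ℝ) (N : ℕ) (k : Fin N → Fin 3 → ℤ) : 0 ≤ kineticMul L N k :=
  Finset.sum_nonneg fun _ _ => by positivity

/-- For each particle |α||p| ≤ s|p|²/2 + |α|²/(2s), by completing the square; the momentum is thus
bounded by an arbitrarily small part of the kinetic energy plus a multiple of N. -/
lemma abs_momentumMul_le (L : ℝ) (α : Space) (N : ℕ) (k : Fin N → Fin 3 → ℤ) {s : ℝ}
    (hs : 0 < s) : |momentumMul L α N k| ≤ s * kineticMul L N k + ‖α‖ ^ 2 / (2 * s) * N := by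
  calc |momentumMul L α N k| ≤ ∑ j, |inner ℝ α (wavevec L k j)| := Finset.abs_sum_le_sum_abs _ _
    _ ≤ ∑ j : Fin N, (s * (‖wavevec L k j‖ ^ 2 / 2) + ‖α‖ ^ 2 / (2 * s)) := by
        refine Finset.sum_le_sum fun j _ => (abs_real_inner_le_norm _ _).trans ?_
        set a := ‖α‖
        set b := ‖wavevec L k j‖
        have h : s * (b ^ 2 / 2) + a ^ 2 / (2 * s) - a * b = (s * b - a) ^ 2 / (2 * s) := by
          field_simp; ring
        have : 0 ≤ (s * b - a) ^ 2 / (2 * s) := by positivity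
        linarith
    _ = _ := by
        rw [Finset.sum_add_distrib, ← Finset.mul_sum, Finset.sum_const, Finset.card_univ,
          Fintype.card_fin, nsmul_eq_mul, kineticMul]
        ring

lemma kineticMul_perm (L : ℝ) (N : ℕ) (σ : Equiv.Perm (Fin N)) (k : Fin N → Fin 3 → ℤ) :
    kineticMul L N (fun i => k (σ i)) = kineticMul L N k :=
  Equiv.sum_comp σ fun j => ‖wavevec L k j‖ ^ 2 / 2

lemma momentumMul_perm (L : ℝ) (α : Space) (N : ℕ) (σ : Equiv.Perm (Fin N))
    (k : Fin N → Fin 3 → ℤ) : momentumMul L α N (fun i => k (σ i)) = momentumMul L α N k :=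
  Equiv.sum_comp σ fun j => inner ℝ α (wavevec L k j)

lemma pairEnergy_perm (L : ℝ) (U : Space → ℝ) (N : ℕ) (σ : Equiv.Perm (Fin N)) (x : Conf N) :
    pairEnergy L U N (fun i => x (σ i)) = pairEnergy L U N x := by
  unfold pairEnergy
  congr 1
  rw [← Equiv.sum_comp σ fun i => ∑ j ∈ Finset.univ.erase i, periodise L U (x i - x j)]
  refine Finset.sum_congr rfl fun i _ => ?_
  refine Finset.sum_bij (fun j _ => σ j) (fun j hj => ?_) (fun _ _ _ _ h => σ.injective h)
    (fun j hj => ⟨σ.symm j, ?_, by simp⟩) fun _ _ => rfl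
  · simpa using hj
  · simp only [Finset.mem_erase, Finset.mem_univ, and_true, ne_eq] at hj ⊢
    rintro rfl
    simp at hj

lemma measurable_periodise (L : ℝ) {U : Space → ℝ} (hU : Measurable U) :
    Measurable (periodise L U) := by
  unfold periodise
  exact Measurable.tsum fun n => hU.comp (measurable_id.add_const _)

lemma measurable_pairEnergy (L : ℝ) {U : Space → ℝ} (hU : Measurable U) (N : ℕ) :
    Measurable (pairEnergy L U N) := by
  unfold pairEnergy
  refine Measurable.const_mul ?_ _
  refine Finset.measurable_sum _ fun i _ => Finset.measurable_sum _ fun j _ => ?_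
  exact (measurable_periodise L hU).comp ((measurable_pi_apply i).sub (measurable_pi_apply j))

lemma finite_kineticMul_le (hL : 0 < L) (N : ℕ) (B : ℝ) :
    {k : Fin N → Fin 3 → ℤ | kineticMul L N k ≤ B}.Finite := by
  obtain ⟨M, hM⟩ := exists_nat_gt (2 * B * (L / (2 * Real.pi)) ^ 2)
  refine (Set.Finite.pi' fun _ : Fin N => Set.Finite.pi' fun _ : Fin 3 =>
    Set.finite_Icc (-(M : ℤ)) M).subset ?_
  intro k hk j a
  have h1 : ‖wavevec L k j‖ ^ 2 / 2 ≤ B :=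
    (Finset.single_le_sum (f := fun j => ‖wavevec L k j‖ ^ 2 / 2) (fun _ _ => by positivity)
      (Finset.mem_univ j)).trans hk
  have h2 : (2 * Real.pi / L * (k j a : ℝ)) ^ 2 ≤ ‖wavevec L k j‖ ^ 2 := by
    rw [EuclideanSpace.real_norm_sq_eq]
    exact Finset.single_le_sum (f := fun a => (wavevec L k j a) ^ 2) (fun _ _ => by positivity)
      (Finset.mem_univ a)
  have h3 : ((k j a : ℝ)) ^ 2 < M := by
    refine lt_of_le_of_lt ?_ hM
    have hπ := Real.pi_pos
    have h4 : (k j a : ℝ) ^ 2 = (2 * Real.pi / L * (k j a : ℝ)) ^ 2 * (L / (2 * Real.pi)) ^ 2 := by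
      field_simp
    rw [h4]
    refine mul_le_mul_of_nonneg_right (by linarith) (by positivity)
  have h5 : (k j a) ^ 2 < (M : ℤ) := by exact_mod_cast h3
  rw [Set.mem_Icc]
  constructor <;> nlinarith

end Hamiltonian

/-! ### Spectral theory in a fixed particle sector -/

section Sector

variable {L : ℝ} {N : ℕ}

lemma exists_fermi_mul {u : Conf N → ℝ} (hu : Measurable u)
    (hsymm : ∀ (σ : Equiv.Perm (Fin N)) x, u (fun i => x (σ i)) = u x) {M : ℝ} (hM : 0 ≤ M)
    (hb : ∀ x, |u x| ≤ M) :
    ∃ V : fermi L N →L[ℂ] fermi L N, ‖V‖ ≤ M ∧ (V : fermi L N →ₗ[ℂ] fermi L N).IsSymmetric ∧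
      ∀ f : fermi L N, ∀ᵐ x ∂(confMeasure L N),
        (V f : NBody L N) x = (u x : ℂ) * (f : NBody L N) x := by
  have hbd : ∀ (f : NBody L N) x, ‖(u x : ℂ) * f x‖ ≤ M * ‖f x‖ := fun f x => by
    rw [norm_mul, Complex.norm_real]
    exact mul_le_mul_of_nonneg_right (hb x) (norm_nonneg _)
  have hmem : ∀ f : NBody L N, MemLp (fun x => (u x : ℂ) * f x) 2 (confMeasure L N) := fun f =>
    MemLp.of_le_mul (Lp.memLp f)
      ((Complex.measurable_ofReal.comp hu).aestronglyMeasurable.mul (Lp.aestronglyMeasurable f))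
      (Eventually.of_forall (hbd f))
  have hfermi : ∀ f : fermi L N, (hmem f).toLp ∈ fermi L N := by
    intro f σ
    have h1 := (hmem f).coeFn_toLp
    filter_upwards [h1, ae_comp_perm σ h1, f.2 σ] with x h2 h3 h4
    rw [h2, h3, hsymm, h4]; ring
  let V0 : fermi L N →ₗ[ℂ] fermi L N :=
    { toFun := fun f => ⟨(hmem f).toLp, hfermi f⟩
      map_add' := by
        intro f g
        refine Subtype.ext (Lp.ext ?_)
        change _ =ᵐ[_] ((hmem f).toLp + (hmem g).toLp : NBody L N)
        filter_upwards [(hmem (f + g : fermi L N)).coeFn_toLp, (hmem f).coeFn_toLp,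
          (hmem g).coeFn_toLp, Lp.coeFn_add (hmem f).toLp (hmem g).toLp,
          Lp.coeFn_add (f : NBody L N) (g : NBody L N)] with x h1 h2 h3 h4 h5
        rw [h1, h4, Pi.add_apply, h2, h3, Submodule.coe_add, h5, Pi.add_apply]
        ring
      map_smul' := by
        intro c f
        refine Subtype.ext (Lp.ext ?_)
        change _ =ᵐ[_] (c • (hmem f).toLp : NBody L N)
        filter_upwards [(hmem (c • f : fermi L N)).coeFn_toLp, (hmem f).coeFn_toLp,
          Lp.coeFn_smul c (hmem f).toLp, Lp.coeFn_smul c (f : NBody L N)] with x h1 h2 h3 h4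
        rw [h1, h3, Pi.smul_apply, h2, Submodule.coe_smul, h4, Pi.smul_apply, smul_eq_mul,
          smul_eq_mul]
        ring }
  have hV0 : ∀ f : fermi L N, ∀ᵐ x ∂(confMeasure L N),
      (V0 f : NBody L N) x = (u x : ℂ) * (f : NBody L N) x := fun f => (hmem f).coeFn_toLp
  have hnorm : ∀ f, ‖V0 f‖ ≤ M * ‖f‖ := by
    intro f
    change ‖(V0 f : NBody L N)‖ ≤ M * ‖(f : NBody L N)‖
    refine Lp.norm_le_mul_norm_of_ae_le_mul ?_
    filter_upwards [hV0 f] with x hx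
    rw [hx]; exact hbd f x
  refine ⟨V0.mkContinuous M hnorm, V0.mkContinuous_norm_le hM hnorm, ?_, hV0⟩
  intro f g
  change inner ℂ (V0 f : NBody L N) (g : NBody L N) = inner ℂ (f : NBody L N) (V0 g : NBody L N)
  rw [L2.inner_def, L2.inner_def]
  refine integral_congr_ae ?_
  filter_upwards [hV0 f, hV0 g] with x h1 h2
  rw [h1, h2, RCLike.inner_apply, RCLike.inner_apply, map_mul, Complex.conj_ofReal]
  ring

lemma exists_fermi_diagonal (hL : 0 < L) {r : (Fin N → Fin 3 → ℤ) → ℝ}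
    (hsymm : ∀ (σ : Equiv.Perm (Fin N)) k, r (fun i => k (σ i)) = r k) {C : ℝ} (hC : 0 ≤ C)
    (hr : ∀ k, |r k| ≤ C) (hlim : Tendsto r cofinite (𝓝 0)) :
    ∃ R : fermi L N →L[ℂ] fermi L N, ‖R‖ ≤ C ∧ (R : fermi L N →ₗ[ℂ] fermi L N).IsSymmetric ∧
      IsCompactOperator R ∧ ∀ (f : fermi L N) k,
        bodyCoeff (R f : NBody L N) k = (r k : ℂ) * bodyCoeff (f : NBody L N) k := by
  obtain ⟨T, hT1, hT2⟩ := exists_diagonal (waveBasis hL N) hC hr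
  have hcoef : ∀ (f : NBody L N) k, bodyCoeff (T f) k = (r k : ℂ) * bodyCoeff f k := by
    intro f k
    have h := hT2 f k
    rw [inner_waveBasis, inner_waveBasis, mul_left_comm] at h
    exact mul_left_cancel₀ (by exact_mod_cast (waveNorm_pos hL N).ne') h
  have hinv : ∀ f ∈ fermi L N, T f ∈ fermi L N := by
    intro f hf
    rw [mem_fermi_iff_bodyCoeff hL] at hf ⊢
    intro σ k
    rw [hcoef, hcoef, hsymm, hf]; ring
  refine ⟨T.restrict hinv, ?_, ?_, ?_, fun f k => hcoef f k⟩
  · refine ContinuousLinearMap.opNorm_le_bound _ hC fun f => ?_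
    change ‖T (f : NBody L N)‖ ≤ C * ‖(f : NBody L N)‖
    exact (T.le_opNorm _).trans (mul_le_mul_of_nonneg_right hT1 (norm_nonneg _))
  · intro f g
    exact isSymmetric_of_diagonal (waveBasis hL N) hT2 (f : NBody L N) (g : NBody L N)
  · exact (isCompactOperator_of_diagonal (waveBasis hL N) hlim hT2).restrict hinv
      (isClosed_fermi hL N)

/-- Eigenvectors of `m + u` on the `N`-fermion space for a multiplier `m` tending to infinity and
a bounded function `u`. -/
lemma exists_fermi_eigenbasis (hL : 0 < L) {m : (Fin N → Fin 3 → ℤ) → ℝ} {u : Conf N → ℝ} {M : ℝ}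
    (hM : 0 ≤ M) (hu : Measurable u) (hb : ∀ x, |u x| ≤ M)
    (husymm : ∀ (σ : Equiv.Perm (Fin N)) x, u (fun i => x (σ i)) = u x)
    (hmsymm : ∀ (σ : Equiv.Perm (Fin N)) k, m (fun i => k (σ i)) = m k)
    (hm : ∀ k, 1 + M ≤ m k) (hfin : ∀ B, {k | m k ≤ B}.Finite) :
    ∃ (ι : Type) (b : HilbertBasis ι ℂ (fermi L N)) (l : ι → ℝ) (χ v : ι → fermi L N),
      ∀ i, (∀ k, bodyCoeff (χ i : NBody L N) k = (m k : ℂ) * bodyCoeff (b i : NBody L N) k) ∧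
        (∀ᵐ x ∂(confMeasure L N), (v i : NBody L N) x = (u x : ℂ) * (b i : NBody L N) x) ∧
        χ i + v i = (l i : ℂ) • b i := by
  have : CompleteSpace (fermi L N) := (isClosed_fermi hL N).completeSpace_coe
  have hpos : ∀ k, 0 < m k := fun k => by linarith [hm k]
  have hlim : Tendsto (fun k => (m k)⁻¹) cofinite (𝓝 0) := by
    refine tendsto_inv_atTop_zero.comp (tendsto_atTop.2 fun B => ?_)
    rw [eventually_cofinite]
    refine (hfin B).subset fun k hk => ?_
    simp only [Set.mem_ofPred_eq, not_le] at hk ⊢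
    exact hk.le
  obtain ⟨V, hV1, hV2, hV3⟩ := exists_fermi_mul (L := L) hu husymm hM hb
  obtain ⟨R, hR1, hR2, hR3, hR4⟩ := exists_fermi_diagonal hL (r := fun k => (m k)⁻¹)
    (fun σ k => by rw [hmsymm]) (C := (1 + M)⁻¹) (by positivity) (fun k => by
      rw [abs_of_pos (inv_pos.2 (hpos k))]
      exact inv_anti₀ (by positivity) (hm k)) hlim
  have hinj : ∀ f, R f = 0 → f = 0 := by
    intro f hf
    refine Subtype.ext (eq_zero_of_bodyCoeff hL _ fun k => ?_)
    have h := hR4 f k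
    rw [hf] at h
    have h0 : bodyCoeff ((0 : fermi L N) : NBody L N) k = 0 := by
      have := bodyCoeff_smul (0 : ℂ) (0 : NBody L N) k
      simpa using this
    rw [h0] at h
    exact (mul_eq_zero.1 h.symm).resolve_left (by exact_mod_cast (inv_pos.2 (hpos k)).ne')
  -- The bound 1 + M ≤ m is tailored to this: R has norm at most 1/(1+M), while V has norm at most
  -- M.
  have hn : ‖V‖ * ‖R‖ < 1 := by
    calc ‖V‖ * ‖R‖ ≤ M * (1 + M)⁻¹ := mul_le_mul hV1 hR1 R.opNorm_nonneg hM
      _ < 1 := by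
        rw [← div_eq_mul_inv, div_lt_one (by positivity)]; linarith
  obtain ⟨ι, b, l, χ, h⟩ := exists_hilbertBasis_of_resolvent hR3 hR2 hinj hV2 hn
  refine ⟨ι, b, l, χ, fun i => V (b i), fun i => ⟨fun k => ?_, hV3 _, (h i).2⟩⟩
  rw [← (h i).1, hR4, ← mul_assoc]
  have : (m k : ℂ) ≠ 0 := by exact_mod_cast (hpos k).ne'
  push_cast
  rw [mul_inv_cancel₀ this, one_mul]

end Sector

/-! ### Existence of an eigenbasis on Fock space -/

section Existence

variable {L : ℝ}

lemma bodyCoeff_zero {N : ℕ} (k : Fin N → Fin 3 → ℤ) : bodyCoeff (0 : NBody L N) k = 0 := by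
  have := bodyCoeff_smul (0 : ℂ) (0 : NBody L N) k
  simpa using this

lemma fMul_single {m : ∀ N : ℕ, (Fin N → Fin 3 → ℤ) → ℝ} {N : ℕ} {f g : fermi L N}
    (h : ∀ k, bodyCoeff (g : NBody L N) k = (m N k : ℂ) * bodyCoeff (f : NBody L N) k) :
    FMul m (lp.single 2 N f : Fock L) (lp.single 2 N g) := by
  intro M k
  change bodyCoeff ((lp.single 2 N g : Fock L) M : NBody L M) k =
    _ * bodyCoeff ((lp.single 2 N f : Fock L) M : NBody L M) k
  by_cases hM : M = N
  · subst hM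
    rw [lp.single_apply_self, lp.single_apply_self, h]
  · rw [lp.single_apply_ne _ _ _ hM, lp.single_apply_ne _ _ _ hM]
    change bodyCoeff (0 : NBody L M) k = _ * bodyCoeff (0 : NBody L M) k
    rw [bodyCoeff_zero, mul_zero]

lemma mMul_single {u : ∀ N : ℕ, Conf N → ℝ} {N : ℕ} {f g : fermi L N}
    (h : ∀ᵐ x ∂(confMeasure L N), (g : NBody L N) x = (u N x : ℂ) * (f : NBody L N) x) :
    MMul u (lp.single 2 N f : Fock L) (lp.single 2 N g) := by
  intro M
  simp only [wave]
  by_cases hM : M = N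
  · subst hM
    rw [lp.single_apply_self, lp.single_apply_self]
    exact h
  · rw [lp.single_apply_ne _ _ _ hM, lp.single_apply_ne _ _ _ hM]
    filter_upwards [Lp.coeFn_zero ℂ 2 (confMeasure L M)] with x hx
    change ((0 : NBody L M) : Conf M → ℂ) x = _ * ((0 : NBody L M) : Conf M → ℂ) x
    rw [hx]; simp

/-- Sector eigenvectors placed in one component of Fock space remain orthonormal across sectors, and
a vector orthogonal to all of them has every component zero. -/
lemma nonempty_eigenbasis_of_sectors (hL : 0 < L) {A : Fock L →ₗ.[ℂ] Fock L}
    (h : ∀ N, ∃ (ι : Type) (b : HilbertBasis ι ℂ (fermi L N)) (l : ι → ℝ), ∀ i,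
      ∃ hd : (lp.single 2 N (b i) : Fock L) ∈ A.domain,
        A ⟨_, hd⟩ = (l i : ℂ) • (lp.single 2 N (b i) : Fock L)) : Nonempty (Eigenbasis A) := by
  have : ∀ N, CompleteSpace (fermi L N) := fun N => (isClosed_fermi hL N).completeSpace_coe
  choose ι b l hd he using h
  let v : (Σ N, ι N) → Fock L := fun p => lp.single 2 p.1 (b p.1 p.2)
  have horth : Orthonormal ℂ v := by
    classical
    rw [orthonormal_iff_ite]
    rintro ⟨N, i⟩ ⟨M, j⟩
    simp only [v]
    rw [lp.inner_single_left]
    by_cases hNM : N = M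
    · subst hNM
      rw [lp.single_apply_self, orthonormal_iff_ite.1 (b N).orthonormal i j]
      simp
    · rw [lp.single_apply_ne _ _ _ hNM, inner_zero_right, if_neg]
      intro hh
      exact hNM (congrArg Sigma.fst hh)
  have hspan : (Submodule.span ℂ (Set.range v))ᗮ = ⊥ := by
    rw [eq_bot_iff]
    intro ψ hψ
    rw [Submodule.mem_bot]
    refine lp.ext (funext fun N => ?_)
    change ψ N = 0
    refine hilbertBasis_ext_inner (b N) fun i => ?_
    have h1 := (Submodule.mem_orthogonal _ _).1 hψ (v ⟨N, i⟩) (Submodule.subset_span ⟨_, rfl⟩)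
    simp only [v] at h1
    rw [lp.inner_single_left] at h1
    rw [h1, inner_zero_right]
  have hcoe : ∀ p, HilbertBasis.mkOfOrthogonalEqBot horth hspan p = v p := fun p => by
    rw [HilbertBasis.coe_mkOfOrthogonalEqBot]
  refine ⟨⟨_, HilbertBasis.mkOfOrthogonalEqBot horth hspan, fun p => l p.1 p.2,
    fun p => by rw [hcoe]; exact hd p.1 p.2, fun p => ?_⟩⟩
  simp only [hcoe]
  exact he p.1 p.2

/-- Within a sector the interaction is bounded and the momentum is absorbed by the kinetic energy,
so after a constant shift the compact resolvent argument applies. The shift may depend on N since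
the operator respects sectors; no uniformity in N, hence no stability, is needed. -/
lemma nonempty_eigenbasis_hamiltonian (hL : 0 < L) {W : Space → ℝ} (hW : Measurable W)
    (hb : ∀ N, ∃ M, ∀ x, |pairEnergy L W N x| ≤ M) (α : Space) (μ : ℝ) :
    Nonempty (Eigenbasis (hamiltonian W L α μ)) := by
  choose M hM using hb
  have hM0 : ∀ N, 0 ≤ M N := fun N => (abs_nonneg _).trans (hM N fun _ => 0)
  -- Here ‖α‖² N pays for the momentum (which costs half of the kinetic energy), |μ| N for the
  -- chemical potential, 1 + M N for the interaction; the extra N makes the number operator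
  -- dominated by m.
  let c : ℕ → ℝ := fun N => 1 + M N + (‖α‖ ^ 2 + |μ| + 1) * N
  let m : ∀ N : ℕ, (Fin N → Fin 3 → ℤ) → ℝ := fun N k =>
    kineticMul L N k + (-1) * momentumMul L α N k + (-μ) * N + c N
  have hlow : ∀ N k, kineticMul L N k / 2 + N + 1 + M N ≤ m N k := by
    intro N k
    have h1 := abs_momentumMul_le L α N k (s := 1 / 2) (by norm_num)
    have h2 := le_abs_self (momentumMul L α N k)
    have h3 : μ * N ≤ |μ| * N := mul_le_mul_of_nonneg_right (le_abs_self μ) (Nat.cast_nonneg N)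
    simp only [m, c]
    norm_num at h1
    linarith
  have hm1 : ∀ N k, 1 + M N ≤ m N k := fun N k => by
    linarith [hlow N k, kineticMul_nonneg L N k, (Nat.cast_nonneg N : (0 : ℝ) ≤ N)]
  have hfin : ∀ N B, {k | m N k ≤ B}.Finite := by
    intro N B
    refine (finite_kineticMul_le hL N (2 * B)).subset fun k hk => ?_
    simp only [Set.mem_ofPred_eq] at hk ⊢
    linarith [hlow N k, (Nat.cast_nonneg N : (0 : ℝ) ≤ N), hM0 N]
  refine nonempty_eigenbasis_of_sectors hL fun N => ?_
  obtain ⟨ι, b, l, χ, v, h⟩ := exists_fermi_eigenbasis hL (m := m N) (u := pairEnergy L W N)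
    (hM0 N) (measurable_pairEnergy L hW N) (hM N) (pairEnergy_perm L W N)
    (fun σ k => by simp only [m, kineticMul_perm, momentumMul_perm]) (hm1 N) (hfin N)
  refine ⟨ι, b, fun i => l i - c N, fun i => ?_⟩
  obtain ⟨h1, h2, h3⟩ := h i
  have hF := fMul_single (m := m) h1
  have habs : ∀ N k, |m N k| = m N k := fun N k => abs_of_nonneg (by linarith [hm1 N k, hM0 N])
  obtain ⟨φK, hK⟩ := hF.exists_of_le hL (m' := kineticMul L) (kineticMul_perm L) (C := 2)
    (by norm_num) fun N k => by
      rw [habs, abs_of_nonneg (kineticMul_nonneg L N k)]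
      linarith [hlow N k, (Nat.cast_nonneg N : (0 : ℝ) ≤ N), hM0 N]
  obtain ⟨φN, hN⟩ := hF.exists_of_le hL (m' := fun N _ => (N : ℝ)) (fun _ _ _ => rfl) (C := 1)
    (by norm_num) fun N k => by
      rw [habs, Nat.abs_cast]
      linarith [hlow N k, hM0 N, kineticMul_nonneg L N k]
  obtain ⟨φP, hP⟩ := hF.exists_of_le hL (m' := momentumMul L α) (momentumMul_perm L α)
    (C := 2 + ‖α‖ ^ 2) (by positivity) fun N k => by
      rw [habs]
      have h4 := abs_momentumMul_le L α N k (s := 1) (by norm_num)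
      have h5 := hlow N k
      have h6 := kineticMul_nonneg L N k
      have h7 : (0 : ℝ) ≤ N := Nat.cast_nonneg N
      have h8 := hM0 N
      have h9 : ‖α‖ ^ 2 * N ≤ ‖α‖ ^ 2 * m N k :=
        mul_le_mul_of_nonneg_left (by linarith) (by positivity)
      have h10 : 0 ≤ ‖α‖ ^ 2 * N := by positivity
      norm_num at h4
      nlinarith
  have hparts : HamiltonianParts W α _ φK _ φP φN := ⟨hK, mMul_single h2, hP, hN⟩
  refine ⟨hparts.mem_domain hL μ, ?_⟩
  rw [hparts.apply hL]
  have hc : FMul (fun N _ => c N) (lp.single 2 N (b i) : Fock L)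
      (lp.single 2 N ((c N : ℂ) • b i)) := fMul_single fun k => by
    rw [Submodule.coe_smul, bodyCoeff_smul]
  have hsum : FMul m (lp.single 2 N (b i) : Fock L)
      (φK + ((-1 : ℝ) : ℂ) • φP + ((-μ : ℝ) : ℂ) • φN + lp.single 2 N ((c N : ℂ) • b i)) :=
    ((hK.add (hP.smul (-1))).add (hN.smul (-μ))).add hc
  have heq := hsum.unique hL hF
  have h4 : (lp.single 2 N (v i) : Fock L) = (l i : ℂ) • lp.single 2 N (b i) -
      lp.single 2 N (χ i) := by
    rw [← lp.single_smul, ← lp.single_sub, ← h3]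
    simp
  rw [h4, ← heq, lp.single_smul]
  push_cast
  module

end Existence

end

section

/-! ### Periodised potentials and close pairs -/

section Lattice

/-- A lattice vector of the torus of side `L`. -/
def latticeVec (L : ℝ) (n : Fin 3 → ℤ) : Space := WithLp.toLp 2 fun a => L * (n a : ℝ)

lemma latticeVec_sub (L : ℝ) (n m : Fin 3 → ℤ) :
    latticeVec L (n - m) = latticeVec L n - latticeVec L m := by
  ext a
  simp [latticeVec, mul_sub]

lemma abs_apply_le_norm (z : Space) (a : Fin 3) : |z a| ≤ ‖z‖ := by
  rw [← Real.norm_eq_abs]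
  exact PiLp.norm_apply_le z a

lemma le_norm_latticeVec {L : ℝ} (hL : 0 < L) {n : Fin 3 → ℤ} (hn : n ≠ 0) :
    L ≤ ‖latticeVec L n‖ := by
  obtain ⟨a, ha⟩ := Function.ne_iff.1 hn
  refine le_trans ?_ (abs_apply_le_norm _ a)
  have h1 : (1 : ℝ) ≤ |(n a : ℝ)| := by
    exact_mod_cast Int.one_le_abs ha
  simp only [latticeVec, abs_mul, abs_of_pos hL]
  nlinarith

/-- Two points at separation `z` have periodic distance at most `R`. -/
def Near (L R : ℝ) (z : Space) : Prop := ∃ n, ‖z + latticeVec L n‖ ≤ R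

/-- Two images of one separation differ by a lattice vector, of length at least L if non-zero.
Consequently the periodisation of a function of range R < L/2 has at most one non-zero term at each
point. -/
lemma near_unique {L R : ℝ} (hL : 0 < L) (hR : 2 * R < L) {z : Space} {n m : Fin 3 → ℤ}
    (hn : ‖z + latticeVec L n‖ ≤ R) (hm : ‖z + latticeVec L m‖ ≤ R) : n = m := by
  by_contra hne
  have h1 := le_norm_latticeVec hL (sub_ne_zero.2 hne)
  rw [latticeVec_sub] at h1
  have h2 : latticeVec L n - latticeVec L m = (z + latticeVec L n) - (z + latticeVec L m) := by abel
  rw [h2] at h1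
  linarith [norm_sub_le (z + latticeVec L n) (z + latticeVec L m)]

lemma periodise_eq {L R : ℝ} (hL : 0 < L) (hR : 2 * R < L) {U : Space → ℝ}
    (hU : ∀ z, R < ‖z‖ → U z = 0) {z : Space} {n : Fin 3 → ℤ} (hn : ‖z + latticeVec L n‖ ≤ R) :
    periodise L U z = U (z + latticeVec L n) := by
  refine tsum_eq_single n fun m hm => hU _ ?_
  by_contra h
  exact hm (near_unique hL hR (not_lt.1 h) hn)

lemma periodise_eq_zero {L R : ℝ} {U : Space → ℝ} (hU : ∀ z, R < ‖z‖ → U z = 0) {z : Space}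
    (hn : ¬ Near L R z) : periodise L U z = 0 := by
  have : ∀ m, U (z + latticeVec L m) = 0 := fun m =>
    hU _ (not_le.1 fun h => hn ⟨m, h⟩)
  simp only [periodise]
  simp_rw [latticeVec] at this
  simp [this]

lemma periodise_zero {L R : ℝ} (hL : 0 < L) (hR0 : 0 ≤ R) (hR : 2 * R < L) {U : Space → ℝ}
    (hU : ∀ z, R < ‖z‖ → U z = 0) : periodise L U 0 = U 0 := by
  have h0 : (0 : Space) + latticeVec L 0 = 0 := by
    ext a; simp [latticeVec]
  rw [periodise_eq hL hR hU (n := 0) (by rw [h0, norm_zero]; exact hR0), h0]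

lemma finite_support_periodise {L R : ℝ} (hL : 0 < L) (hR : 2 * R < L) {U : Space → ℝ}
    (hU : ∀ z, R < ‖z‖ → U z = 0) (z : Space) :
    (Function.support fun n => U (z + latticeVec L n)).Finite := by
  refine Set.Subsingleton.finite fun n hn m hm => near_unique hL hR (z := z) ?_ ?_
  · exact not_lt.1 fun h => hn (hU _ h)
  · exact not_lt.1 fun h => hm (hU _ h)

open Classical in
/-- The number of (ordered, possibly equal) pairs at periodic distance at most `R`. -/
def pairCount (L R : ℝ) (N : ℕ) (x : Conf N) : ℝ :=
  ∑ i, ∑ j, if Near L R (x i - x j) then (1 : ℝ) else 0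

lemma pairCount_le (L R : ℝ) (N : ℕ) (x : Conf N) : pairCount L R N x ≤ (N : ℝ) ^ 2 := by
  calc pairCount L R N x ≤ ∑ _i : Fin N, ∑ _j : Fin N, (1 : ℝ) :=
        Finset.sum_le_sum fun _ _ => Finset.sum_le_sum fun _ _ => by split_ifs <;> norm_num
    _ = _ := by simp [sq]

lemma abs_pairEnergy_le {L R B : ℝ} (hL : 0 < L) (hR : 2 * R < L) {U : Space → ℝ}
    (hU : ∀ z, R < ‖z‖ → U z = 0) (hB : ∀ z, |U z| ≤ B) (N : ℕ) (x : Conf N) :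
    |pairEnergy L U N x| ≤ B / 2 * pairCount L R N x := by
  classical
  have hB0 : 0 ≤ B := (abs_nonneg _).trans (hB 0)
  have h1 : ∀ z, |periodise L U z| ≤ B * if Near L R z then (1 : ℝ) else 0 := by
    intro z
    split_ifs with h
    · obtain ⟨n, hn⟩ := h
      rw [periodise_eq hL hR hU hn, mul_one]
      exact hB _
    · rw [periodise_eq_zero hU h]; simp
  rw [pairEnergy, abs_mul, abs_of_pos (by norm_num : (0 : ℝ) < 1 / 2)]
  have h2 : |∑ i, ∑ j ∈ Finset.univ.erase i, periodise L U (x i - x j)| ≤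
      B * pairCount L R N x := by
    calc _ ≤ ∑ i, ∑ j ∈ Finset.univ.erase i, |periodise L U (x i - x j)| :=
          (Finset.abs_sum_le_sum_abs _ _).trans
            (Finset.sum_le_sum fun i _ => Finset.abs_sum_le_sum_abs _ _)
      _ ≤ ∑ i, ∑ j, |periodise L U (x i - x j)| :=
          Finset.sum_le_sum fun i _ => Finset.sum_le_sum_of_subset_of_nonneg
            (Finset.erase_subset _ _) fun _ _ _ => abs_nonneg _
      _ ≤ ∑ i, ∑ j, B * (if Near L R (x i - x j) then (1 : ℝ) else 0) :=
          Finset.sum_le_sum fun i _ => Finset.sum_le_sum fun j _ => h1 _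
      _ = _ := by simp only [pairCount, Finset.mul_sum]
  linarith

/-- The diagonal i = j contributes U(0) per particle. The complete double sum, rather than the pair
energy, is what positivity of the potential controls. -/
lemma sum_periodise_eq {L R : ℝ} (hL : 0 < L) (hR0 : 0 ≤ R) (hR : 2 * R < L) {U : Space → ℝ}
    (hU : ∀ z, R < ‖z‖ → U z = 0) (N : ℕ) (x : Conf N) :
    ∑ i, ∑ j, periodise L U (x i - x j) = 2 * pairEnergy L U N x + U 0 * N := by
  have : ∀ i : Fin N, ∑ j, periodise L U (x i - x j) =
      ∑ j ∈ Finset.univ.erase i, periodise L U (x i - x j) + U 0 := by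
    intro i
    rw [← Finset.sum_erase_add _ _ (Finset.mem_univ i), sub_self, periodise_zero hL hR0 hR hU]
  simp_rw [this]
  rw [Finset.sum_add_distrib, pairEnergy]
  simp
  ring

end Lattice

/-! ### Stability survives periodisation -/

section Averaging

/-- A box of lattice points. -/
def latticeBox (a b : ℤ) : Finset (Fin 3 → ℤ) := Fintype.piFinset fun _ => Finset.Ico a b

lemma mem_latticeBox {a b : ℤ} {n : Fin 3 → ℤ} : n ∈ latticeBox a b ↔ ∀ i, a ≤ n i ∧ n i < b := by
  simp [latticeBox]

lemma card_latticeBox {a b : ℤ} (h : a ≤ b) : ((latticeBox a b).card : ℝ) = ((b : ℝ) - a) ^ 3 := by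
  rw [latticeBox, Fintype.card_piFinset_const]
  push_cast
  rw [Int.card_Ico]
  congr 1
  have : (((b - a).toNat : ℤ) : ℝ) = ((b - a : ℤ) : ℝ) := by
    rw [Int.toNat_of_nonneg (by omega)]
  push_cast at this
  exact this

/-- Averages of a translation-invariant form over large boxes tend to the total sum. -/
lemma tsum_nonneg_of_box {f : (Fin 3 → ℤ) → ℝ} (hf : (Function.support f).Finite)
    (h : ∀ M : ℕ, 0 ≤ ∑ n ∈ latticeBox 0 M, ∑ m ∈ latticeBox 0 M, f (n - m)) : 0 ≤ ∑' n, f n := by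
  classical
  set S := hf.toFinset
  have hS : ∀ n, n ∉ S → f n = 0 := fun n hn => by
    by_contra h0; exact hn (hf.mem_toFinset.2 h0)
  obtain ⟨K, hK⟩ : ∃ K : ℕ, ∀ n ∈ S, ∀ i, |n i| ≤ K := by
    refine ⟨∑ n ∈ S, ∑ i, (n i).natAbs, fun n hn i => ?_⟩
    rw [Int.abs_eq_natAbs]
    have h1 : (n i).natAbs ≤ ∑ i, (n i).natAbs :=
      Finset.single_le_sum (f := fun i => (n i).natAbs) (fun _ _ => Nat.zero_le _)
        (Finset.mem_univ i)
    have h2 : ∑ i, (n i).natAbs ≤ ∑ n ∈ S, ∑ i, (n i).natAbs :=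
      Finset.single_le_sum (f := fun n : Fin 3 → ℤ => ∑ i, (n i).natAbs)
        (fun _ _ => Nat.zero_le _) hn
    exact_mod_cast h1.trans h2
  have htsum : ∑' n, f n = ∑ n ∈ S, f n := tsum_eq_sum fun n hn => hS n hn
  set s := ∑' n, f n
  set F := ∑ n ∈ S, |f n|
  have hinj : ∀ m : Fin 3 → ℤ, Function.Injective fun n : Fin 3 → ℤ => n - m := fun m a b hab =>
    sub_left_injective hab
  have hrow : ∀ (B : Finset (Fin 3 → ℤ)) m, ∑ n ∈ B, f (n - m) ≤ F := by
    intro B m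
    rw [← Finset.sum_image (g := fun n => n - m) (f := f) (fun a _ b _ hab => hinj m hab)]
    calc ∑ n ∈ B.image (fun n => n - m), f n
        = ∑ n ∈ (B.image fun n => n - m) ∩ S, f n := by
          refine (Finset.sum_subset Finset.inter_subset_left fun n hn hn' => hS n fun h0 =>
            hn' (Finset.mem_inter.2 ⟨hn, h0⟩)).symm
      _ ≤ ∑ n ∈ (B.image fun n => n - m) ∩ S, |f n| := Finset.sum_le_sum fun _ _ => le_abs_self _
      _ ≤ F := Finset.sum_le_sum_of_subset_of_nonneg Finset.inter_subset_right
          fun _ _ _ => abs_nonneg _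
  -- For m at distance K from the boundary of the box, every point of m + S lies in the box, so the
  -- row carries the complete sum.
  have hint : ∀ (M : ℕ), ∀ m ∈ latticeBox K (M - K), ∑ n ∈ latticeBox 0 M, f (n - m) = s := by
    intro M m hm
    rw [mem_latticeBox] at hm
    rw [← Finset.sum_image (g := fun n => n - m) (f := f) (fun a _ b _ hab => hinj m hab), htsum]
    refine (Finset.sum_subset (fun n hn => ?_) fun n _ hn => hS n hn).symm
    refine Finset.mem_image.2 ⟨n + m, mem_latticeBox.2 fun i => ?_, by simp⟩
    have h1 := abs_le.1 (hK n hn i)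
    have h2 := hm i
    simp only [Pi.add_apply]
    constructor <;> linarith
  -- The remaining rows number M³ - (M-2K)³ and each is at most F; this is a surface term,
  -- negligible after division by M³.
  have hmain : ∀ M : ℕ, 2 * K ≤ M →
      0 ≤ ((M : ℝ) - 2 * K) ^ 3 * s + ((M : ℝ) ^ 3 - ((M : ℝ) - 2 * K) ^ 3) * F := by
    intro M hM
    have hsub : latticeBox K (M - K) ⊆ latticeBox 0 M := fun m hm => by
      rw [mem_latticeBox] at hm ⊢
      intro i
      have := hm i
      constructor <;> omega
    have hM' : (2 * K : ℤ) ≤ M := by exact_mod_cast hM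
    have hc1 := card_latticeBox (a := 0) (b := M) (by omega)
    have hc2 := card_latticeBox (a := K) (b := M - K) (by omega)
    have h1 := h M
    rw [Finset.sum_comm, ← Finset.sum_sdiff hsub] at h1
    have h2 : ∑ m ∈ latticeBox K (M - K), ∑ n ∈ latticeBox 0 M, f (n - m) =
        ((latticeBox K (M - K)).card : ℝ) * s := by
      rw [Finset.sum_congr rfl (hint M), Finset.sum_const, nsmul_eq_mul]
    have h3 : ∑ m ∈ latticeBox 0 M \ latticeBox K (M - K), ∑ n ∈ latticeBox 0 M, f (n - m) ≤
        ((latticeBox 0 M \ latticeBox K (M - K)).card : ℝ) * F := by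
      rw [← nsmul_eq_mul]
      exact Finset.sum_le_card_nsmul _ _ _ fun m _ => hrow _ m
    have h4 : ((latticeBox 0 M \ latticeBox K (M - K)).card : ℝ) =
        (latticeBox 0 M).card - (latticeBox K (M - K)).card := by
      rw [Finset.card_sdiff_of_subset hsub, Nat.cast_sub (Finset.card_le_card hsub)]
    rw [h4, hc1, hc2] at h3
    rw [h2, hc2] at h1
    push_cast at h1 h3
    have e1 : ((M : ℝ) - K - K) = (M : ℝ) - 2 * K := by ring
    rw [e1] at h1 h3
    simp only [sub_zero] at h3
    linarith
  have hlim : Tendsto (fun M : ℕ => (1 - 2 * K / (M : ℝ)) ^ 3 * s +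
      (1 - (1 - 2 * K / (M : ℝ)) ^ 3) * F) atTop (𝓝 ((1 - 0) ^ 3 * s + (1 - (1 - 0) ^ 3) * F)) := by
    have h0 : Tendsto (fun M : ℕ => 2 * (K : ℝ) / (M : ℝ)) atTop (𝓝 0) :=
      tendsto_const_div_atTop_nhds_zero_nat _
    have h1 := (h0.const_sub 1).pow 3
    exact (h1.mul_const s).add ((h1.const_sub 1).mul_const F)
  have h5 : (1 - 0) ^ 3 * s + (1 - (1 - 0) ^ 3) * F = s := by ring
  rw [h5] at hlim
  refine ge_of_tendsto hlim ?_
  filter_upwards [eventually_ge_atTop (2 * K), eventually_gt_atTop 0] with M hM hM0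
  have hM1 : (0 : ℝ) < M := by exact_mod_cast hM0
  have h6 : (1 - 2 * K / (M : ℝ)) ^ 3 * s + (1 - (1 - 2 * K / (M : ℝ)) ^ 3) * F =
      (((M : ℝ) - 2 * K) ^ 3 * s + ((M : ℝ) ^ 3 - ((M : ℝ) - 2 * K) ^ 3) * F) / (M : ℝ) ^ 3 := by
    field_simp
  rw [h6]
  exact div_nonneg (hmain M hM) (by positivity)

lemma PositiveType.sum_nonneg {f : Space → ℝ} (hf : PositiveType f) {ι : Type*} [Fintype ι]
    (y : ι → Space) : 0 ≤ ∑ i, ∑ j, f (y i - y j) := by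
  let e := Fintype.equivFin ι
  have h := (hf (Fintype.card ι) (y ∘ e.symm)).dotProduct_mulVec_nonneg (fun _ => 1)
  have h2 : 0 ≤ ∑ i, ∑ j, (f ((y ∘ e.symm) i - (y ∘ e.symm) j) : ℂ) := by
    simpa [dotProduct, Matrix.mulVec] using h
  have h3 : (0 : ℝ) ≤ ∑ i, ∑ j, f ((y ∘ e.symm) i - (y ∘ e.symm) j) := by
    exact_mod_cast h2
  rw [← Equiv.sum_comp e.symm]
  refine h3.trans (le_of_eq (Finset.sum_congr rfl fun i _ => ?_))
  rw [← Equiv.sum_comp e.symm]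
  rfl

/-- A stable pair potential of finite range remains stable after periodisation. -/
lemma sum_periodise_nonneg {L R : ℝ} (hL : 0 < L) (hR : 2 * R < L) {h : Space → ℝ}
    (hsupp : ∀ z, R < ‖z‖ → h z = 0)
    (hpos : ∀ (ι : Type) [Fintype ι] (y : ι → Space), 0 ≤ ∑ i, ∑ j, h (y i - y j))
    (N : ℕ) (x : Conf N) : 0 ≤ ∑ i, ∑ j, periodise L h (x i - x j) := by
  have hfin := fun i j => finite_support_periodise hL hR hsupp (x i - x j)
  have hsum : ∀ i j, Summable fun n => h (x i - x j + latticeVec L n) := fun i j =>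
    summable_of_hasFiniteSupport (hfin i j)
  have heq : ∑ i, ∑ j, periodise L h (x i - x j) =
      ∑' n, ∑ i, ∑ j, h (x i - x j + latticeVec L n) := by
    rw [Summable.tsum_finsetSum fun i _ => summable_sum fun j _ => hsum i j]
    refine Finset.sum_congr rfl fun i _ => ?_
    rw [Summable.tsum_finsetSum fun j _ => hsum i j]
    rfl
  rw [heq]
  refine tsum_nonneg_of_box ?_ fun M => ?_
  · refine (Set.finite_iUnion fun i => Set.finite_iUnion fun j => hfin i j).subset fun n hn => ?_
    obtain ⟨i, -, hi⟩ := Finset.exists_ne_zero_of_sum_ne_zero hn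
    obtain ⟨j, -, hj⟩ := Finset.exists_ne_zero_of_sum_ne_zero hi
    exact Set.mem_iUnion.2 ⟨i, Set.mem_iUnion.2 ⟨j, hj⟩⟩
  -- Each particle is replicated at all lattice translates in a box and stability in free space is
  -- applied to the enlarged configuration; the separations involve only the difference n - m.
  · have h1 := hpos (Fin N × latticeBox 0 M) fun p => x p.1 + latticeVec L p.2
    refine h1.trans (le_of_eq ?_)
    simp_rw [Fintype.sum_prod_type]
    rw [Finset.sum_comm]
    rw [Finset.sum_coe_sort (latticeBox 0 M) fun n => ∑ i : Fin N, ∑ j : Fin N,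
      ∑ m : latticeBox 0 M, h (x i + latticeVec L n - (x j + latticeVec L (m : Fin 3 → ℤ)))]
    refine Finset.sum_congr rfl fun n _ => ?_
    have : ∀ i j : Fin N, ∑ m : latticeBox 0 M,
        h (x i + latticeVec L n - (x j + latticeVec L (m : Fin 3 → ℤ))) =
        ∑ m ∈ latticeBox 0 M, h (x i - x j + latticeVec L (n - m)) := by
      intro i j
      rw [Finset.sum_coe_sort (latticeBox 0 M) fun m =>
        h (x i + latticeVec L n - (x j + latticeVec L m))]
      refine Finset.sum_congr rfl fun m _ => ?_
      rw [latticeVec_sub]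
      congr 1
      abel
    simp_rw [this]
    have hswap : ∀ g : (Fin 3 → ℤ) → Fin N → Fin N → ℝ, ∑ m ∈ latticeBox 0 M, ∑ i, ∑ j, g m i j =
        ∑ i, ∑ j, ∑ m ∈ latticeBox 0 M, g m i j := fun g =>
      Finset.sum_comm.trans (Finset.sum_congr rfl fun i _ => Finset.sum_comm)
    exact (hswap fun m i j => h (x i - x j + latticeVec L (n - m))).symm

end Averaging

/-! ### Counting close pairs on a periodic grid -/

section Cells

/-- With n g the occupation number of cell g, the pairs of difference d number ∑ n (g+d) n g, which
is at most ∑ (n g)² by ab ≤ (a²+b²)/2 and translation invariance. Taking the cells in a finite group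
builds in the periodicity. -/
lemma sum_sub_mem_le {G : Type*} [AddCommGroup G] [Fintype G] [DecidableEq G] {N : ℕ} (c : Fin N → G)
    (D : Finset G) :
    ∑ i, ∑ j, (if c i - c j ∈ D then (1 : ℝ) else 0) ≤
      D.card * ∑ i, ∑ j, if c i = c j then (1 : ℝ) else 0 := by
  let n : G → ℝ := fun g => ∑ i, if c i = g then (1 : ℝ) else 0
  have h1 : ∀ d, ∑ i, ∑ j, (if c i - c j = d then (1 : ℝ) else 0) = ∑ g, n (g + d) * n g := by
    intro d
    have : ∀ g, n (g + d) * n g =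
        ∑ i, ∑ j, (if c i = g + d then (1 : ℝ) else 0) * (if c j = g then (1 : ℝ) else 0) :=
      fun g => Fintype.sum_mul_sum _ _
    simp_rw [this]
    refine Eq.trans (Finset.sum_congr rfl fun i _ => Finset.sum_congr rfl fun j _ => ?_)
      (Finset.sum_comm.trans (Finset.sum_congr rfl fun i _ => Finset.sum_comm)).symm
    simp only [mul_ite, mul_one, mul_zero]
    rw [Finset.sum_ite_eq]
    simp only [Finset.mem_univ, if_true, sub_eq_iff_eq_add, add_comm]
  have h2 : ∀ d, ∑ g, n (g + d) * n g ≤ ∑ g, n g * n g := by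
    intro d
    have h3 : ∑ g, n (g + d) * n (g + d) = ∑ g, n g * n g :=
      Equiv.sum_comp (Equiv.addRight d) fun g => n g * n g
    have h4 : ∑ g, n (g + d) * n g ≤ ∑ g, (n (g + d) * n (g + d) + n g * n g) / 2 :=
      Finset.sum_le_sum fun g _ => by nlinarith [sq_nonneg (n (g + d) - n g)]
    rw [← Finset.sum_div, Finset.sum_add_distrib, h3] at h4
    linarith
  have h0 : ∑ g, n g * n g = ∑ i, ∑ j, if c i = c j then (1 : ℝ) else 0 := by
    have := h1 0
    simp only [add_zero, sub_eq_zero] at this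
    exact this.symm
  calc ∑ i, ∑ j, (if c i - c j ∈ D then (1 : ℝ) else 0)
      = ∑ d ∈ D, ∑ i, ∑ j, (if c i - c j = d then (1 : ℝ) else 0) := by
        refine Eq.trans (Finset.sum_congr rfl fun i _ => Finset.sum_congr rfl fun j _ => ?_)
          (Finset.sum_comm.trans (Finset.sum_congr rfl fun i _ => Finset.sum_comm)).symm
        rw [Finset.sum_ite_eq]
    _ ≤ ∑ d ∈ D, ∑ g, n g * n g := Finset.sum_le_sum fun d _ => by rw [h1]; exact h2 d
    _ = _ := by rw [Finset.sum_const, nsmul_eq_mul, h0]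

/-- The Cauchy-Schwarz inequality for occupation numbers, as the case where every difference is
allowed. -/
lemma sq_le_card_mul {G : Type*} [AddCommGroup G] [Fintype G] [DecidableEq G] {N : ℕ} (c : Fin N → G) :
    (N : ℝ) ^ 2 ≤ Fintype.card G * ∑ i, ∑ j, if c i = c j then (1 : ℝ) else 0 := by
  have h := sum_sub_mem_le c Finset.univ
  simpa [sq] using h

/-- The cell of a point in a grid of mesh `L / m`. -/
def gridCell (L : ℝ) (m : ℕ) (z : Space) : Fin 3 → ZMod m := fun a => (⌊z a / (L / m)⌋ : ℤ)

/-- The hypothesis says that the mesh s is at most δ/2. Points of one cell differ, after a lattice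
translation, by at most s in each coordinate, and √3 s ≤ 2s ≤ δ. -/
lemma near_of_gridCell_eq {L δ : ℝ} (hL : 0 < L) {m : ℕ} (hm : 2 * L ≤ δ * m) (hm0 : 0 < m)
    {y z : Space} (h : gridCell L m y = gridCell L m z) : Near L δ (y - z) := by
  have hm1 : (0 : ℝ) < m := by exact_mod_cast hm0
  set s := L / m with hs
  have hs0 : 0 < s := by positivity
  have hsδ : 2 * s ≤ δ := by
    rw [hs, ← mul_div_assoc, div_le_iff₀ hm1]; exact hm
  have hq : ∀ a, ∃ q : ℤ, ⌊y a / s⌋ = ⌊z a / s⌋ + m * q := by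
    intro a
    have h1 : ((⌊z a / s⌋ : ℤ) : ZMod m) = (⌊y a / s⌋ : ℤ) := (congrFun h a).symm
    obtain ⟨q, hq⟩ := (ZMod.intCast_eq_intCast_iff_dvd_sub _ _ _).1 h1
    exact ⟨q, by rw [← hq]; ring⟩
  choose q hq using hq
  refine ⟨-q, ?_⟩
  have hL' : L = s * m := by rw [hs]; field_simp
  have hcomp : ∀ a, ((y - z + latticeVec L (-q)) a) ^ 2 ≤ s ^ 2 := by
    intro a
    have e : (y - z + latticeVec L (-q)) a = s * (Int.fract (y a / s) - Int.fract (z a / s)) := by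
      have h1 := Int.floor_add_fract (y a / s)
      have h2 := Int.floor_add_fract (z a / s)
      have h3 : ((⌊y a / s⌋ : ℤ) : ℝ) = (⌊z a / s⌋ : ℤ) + m * q a := by exact_mod_cast hq a
      have h4 : y a = s * (⌊y a / s⌋ + Int.fract (y a / s)) := by rw [h1]; field_simp
      have h5 : z a = s * (⌊z a / s⌋ + Int.fract (z a / s)) := by rw [h2]; field_simp
      simp only [PiLp.add_apply, PiLp.sub_apply, latticeVec, Pi.neg_apply, Int.cast_neg]
      linear_combination h4 - h5 + s * h3 - q a * hL'
    have h1 := Int.fract_nonneg (y a / s)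
    have h2 := Int.fract_lt_one (y a / s)
    have h3 := Int.fract_nonneg (z a / s)
    have h4 := Int.fract_lt_one (z a / s)
    rw [e, mul_pow]
    have h5 : (Int.fract (y a / s) - Int.fract (z a / s)) ^ 2 ≤ 1 := by nlinarith
    nlinarith [sq_nonneg s]
  refine (pow_le_pow_iff_left₀ (norm_nonneg _) (by linarith) two_ne_zero).1 ?_
  rw [EuclideanSpace.real_norm_sq_eq]
  calc ∑ a, ((y - z + latticeVec L (-q)) a) ^ 2 ≤ ∑ _a : Fin 3, s ^ 2 :=
        Finset.sum_le_sum fun a _ => hcomp a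
    _ ≤ δ ^ 2 := by simp; nlinarith

/-- In units of the mesh s the coordinates differ by at most R/s, and integer parts cost less than
one more; the hypothesis on K reads R/s + 1 ≤ K. -/
lemma gridCell_sub_mem_of_near {L R : ℝ} (hL : 0 < L) {m : ℕ} (hm0 : 0 < m) {K : ℕ}
    (hK : R * m + L ≤ K * L) {y z : Space} (h : Near L R (y - z)) :
    ∃ d ∈ latticeBox (-K) (K + 1), gridCell L m y - gridCell L m z =
      fun a => ((d a : ℤ) : ZMod m) := by
  have hm1 : (0 : ℝ) < m := by exact_mod_cast hm0
  set s := L / m with hs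
  have hs0 : 0 < s := by positivity
  obtain ⟨n, hn⟩ := h
  have hL' : L = s * m := by rw [hs]; field_simp
  have hRs : R / s + 1 ≤ K := by
    rw [hs, div_div_eq_mul_div]
    have : R * m / L + 1 = (R * m + L) / L := by field_simp
    rw [this, div_le_iff₀ hL]; exact hK
  refine ⟨fun a => ⌊y a / s⌋ - ⌊z a / s⌋ + m * n a, mem_latticeBox.2 fun a => ?_, ?_⟩
  · have h1 := (abs_apply_le_norm (y - z + latticeVec L n) a).trans hn
    simp only [PiLp.add_apply, PiLp.sub_apply, latticeVec] at h1
    have h2 := Int.fract_nonneg (y a / s)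
    have h3 := Int.fract_lt_one (y a / s)
    have h4 := Int.fract_nonneg (z a / s)
    have h5 := Int.fract_lt_one (z a / s)
    have h6 := Int.floor_add_fract (y a / s)
    have h7 := Int.floor_add_fract (z a / s)
    have h8 : |y a / s - z a / s + m * n a| ≤ R / s := by
      have : y a / s - z a / s + m * n a = (y a - z a + L * n a) / s := by
        rw [hL']; field_simp
      rw [this, abs_div, abs_of_pos hs0]
      exact div_le_div_of_nonneg_right h1 hs0.le
    rw [abs_le] at h8
    have h9 : ((⌊y a / s⌋ - ⌊z a / s⌋ + m * n a : ℤ) : ℝ) < K + 1 := by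
      push_cast; linarith
    have h10 : (-(K : ℝ)) ≤ ((⌊y a / s⌋ - ⌊z a / s⌋ + m * n a : ℤ) : ℝ) := by
      push_cast; linarith
    constructor
    · exact_mod_cast h10
    · exact_mod_cast h9
  · funext a
    simp only [gridCell, Pi.sub_apply, ← hs]
    push_cast
    simp

/-- Comparison of pair counts at different distances, uniformly in the torus. -/
lemma exists_pairCount_le {δ : ℝ} (hδ : 0 < δ) (R : ℝ) :
    ∃ C, 0 ≤ C ∧ ∀ L, δ ≤ L → ∀ (N : ℕ) x, pairCount L R N x ≤ C * pairCount L δ N x := by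
  -- For m = ⌈2L/δ⌉ and L ≥ δ the mesh L/m lies between δ/3 and δ/2. Hence a distance R spans at
  -- most 3|R|/δ cells and K does not depend on L.
  obtain ⟨K, hK⟩ := exists_nat_ge (3 * |R| / δ + 1)
  refine ⟨((latticeBox (-K) (K + 1)).card : ℝ), by positivity, fun L hL N x => ?_⟩
  have hL0 : 0 < L := hδ.trans_le hL
  set m := ⌈2 * L / δ⌉₊ with hm
  have hm1 : 2 * L / δ ≤ m := Nat.le_ceil _
  have hm2 : (m : ℝ) < 2 * L / δ + 1 := Nat.ceil_lt_add_one (by positivity)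
  have hm0 : 0 < m := Nat.ceil_pos.2 (by positivity)
  have : NeZero m := ⟨hm0.ne'⟩
  have hmδ : 2 * L ≤ δ * m := by
    rw [div_le_iff₀ hδ] at hm1; linarith
  have hKL : R * m + L ≤ K * L := by
    have h1 : (m : ℝ) ≤ 3 * L / δ := by
      have : 1 ≤ L / δ := by rw [le_div_iff₀ hδ]; linarith
      have e1 : 2 * L / δ = 2 * (L / δ) := by ring
      have e2 : 3 * L / δ = 3 * (L / δ) := by ring
      rw [e1] at hm2; rw [e2]; linarith
    have h2 : R * m ≤ |R| * (3 * L / δ) :=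
      (mul_le_mul_of_nonneg_right (le_abs_self R) (Nat.cast_nonneg m)).trans
        (mul_le_mul_of_nonneg_left h1 (abs_nonneg R))
    have h3 : |R| * (3 * L / δ) + L = (3 * |R| / δ + 1) * L := by ring
    have h4 : (3 * |R| / δ + 1) * L ≤ K * L := mul_le_mul_of_nonneg_right hK hL0.le
    linarith
  let D : Finset (Fin 3 → ZMod m) :=
    (latticeBox (-K) (K + 1)).image fun d a => ((d a : ℤ) : ZMod m)
  let c : Fin N → Fin 3 → ZMod m := fun i => gridCell L m (x i)
  calc pairCount L R N x ≤ ∑ i, ∑ j, (if c i - c j ∈ D then (1 : ℝ) else 0) := by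
        refine Finset.sum_le_sum fun i _ => Finset.sum_le_sum fun j _ => ?_
        by_cases h : Near L R (x i - x j)
        · obtain ⟨d, hd, hd2⟩ := gridCell_sub_mem_of_near hL0 hm0 hKL h
          have : c i - c j ∈ D := Finset.mem_image.2 ⟨d, hd, hd2.symm⟩
          rw [if_pos h, if_pos this]
        · rw [if_neg h]; split_ifs <;> norm_num
    _ ≤ D.card * ∑ i, ∑ j, if c i = c j then (1 : ℝ) else 0 := sum_sub_mem_le c D
    _ ≤ (latticeBox (-K) (K + 1)).card * pairCount L δ N x := by
        refine mul_le_mul (by exact_mod_cast Finset.card_image_le) ?_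
          (Finset.sum_nonneg fun _ _ => Finset.sum_nonneg fun _ _ => by split_ifs <;> norm_num)
          (by positivity)
        refine Finset.sum_le_sum fun i _ => Finset.sum_le_sum fun j _ => ?_
        by_cases h : c i = c j
        · rw [if_pos h, if_pos (near_of_gridCell_eq hL0 hmδ hm0 h)]
        · rw [if_neg h]; split_ifs <;> norm_num

/-- The constant is the number of cells and grows with L. This suffices where only one fixed torus
is concerned, namely for the finiteness of traces. -/
lemma exists_sq_le_pairCount {δ : ℝ} (hδ : 0 < δ) {L : ℝ} (hL : 0 < L) :
    ∃ C, 0 ≤ C ∧ ∀ (N : ℕ) x, (N : ℝ) ^ 2 ≤ C * pairCount L δ N x := by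
  set m := ⌈2 * L / δ⌉₊ with hm
  have hm1 : 2 * L / δ ≤ m := Nat.le_ceil _
  have hm0 : 0 < m := Nat.ceil_pos.2 (by positivity)
  have : NeZero m := ⟨hm0.ne'⟩
  have hmδ : 2 * L ≤ δ * m := by
    rw [div_le_iff₀ hδ] at hm1; linarith
  refine ⟨Fintype.card (Fin 3 → ZMod m), by positivity, fun N x => ?_⟩
  refine (sq_le_card_mul fun i => gridCell L m (x i)).trans
    (mul_le_mul_of_nonneg_left ?_ (by positivity))
  refine Finset.sum_le_sum fun i _ => Finset.sum_le_sum fun j _ => ?_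
  by_cases h : gridCell L m (x i) = gridCell L m (x j)
  · rw [if_pos h, if_pos (near_of_gridCell_eq hL hmδ hm0 h)]
  · rw [if_neg h]; split_ifs <;> norm_num

end Cells

/-! ### Superstability of admissible potentials -/

section Superstability

/-- The interaction energy shifted so as to be non-negative. -/
def shiftedEnergy (L : ℝ) (W : Space → ℝ) (N : ℕ) (x : Conf N) : ℝ :=
  2 * pairEnergy L W N x + W 0 * N

lemma exists_range {U : Space → ℝ} (hU : HasCompactSupport U) :
    ∃ R, 0 < R ∧ ∀ z, R < ‖z‖ → U z = 0 := by
  obtain ⟨R, hR⟩ := hU.isCompact.isBounded.exists_norm_le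
  refine ⟨max R 1, by positivity, fun z hz => ?_⟩
  by_contra h
  have := hR z (subset_tsupport U h)
  exact absurd ((le_max_left R 1).trans_lt hz) (not_lt.2 this)

/-- By continuity W₀ is at least w = W₀(0)/2 on a small ball, so W minus w times the indicator of
the ball still has non-negative double sums. Periodising this inequality bounds w times the number
of δ-close pairs by the shifted energy, and the cell counts replace δ by any R. The constant of the
first part is uniform in L, as required for densities; that of the second is not. -/
lemma AdmissiblePotential.superstability {W : Space → ℝ} (hW : AdmissiblePotential W) :
    ∃ L₀, 0 < L₀ ∧ (∀ R, ∃ C, 0 ≤ C ∧ ∀ L, L₀ ≤ L → ∀ (N : ℕ) x,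
        pairCount L R N x ≤ C * shiftedEnergy L W N x) ∧
      ∀ L, L₀ ≤ L → ∃ C, 0 ≤ C ∧ ∀ (N : ℕ) x, (N : ℝ) ^ 2 ≤ C * shiftedEnergy L W N x := by
  classical
  obtain ⟨W₀, W₁, hc0, -, hsum, hnn, hpos, hpt⟩ := hW.superstable
  obtain ⟨R₀, hR0, hR⟩ := exists_range hW.compactSupport
  obtain ⟨δ', hδ', hball⟩ := Metric.continuousAt_iff.1 hc0.continuousAt (W₀ 0 / 2) (half_pos hpos)
  -- The cap at R₀ keeps the indicator of the δ-ball within the range of W, so that one range serves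
  -- for the difference.
  set δ := min (δ' / 2) R₀
  have hδ : 0 < δ := lt_min (half_pos hδ') hR0
  have hw : ∀ z, ‖z‖ ≤ δ → W₀ 0 / 2 ≤ W₀ z := by
    intro z hz
    have h1 : dist z 0 < δ' := by
      rw [dist_zero_right]
      exact (hz.trans (min_le_left _ _)).trans_lt (half_lt_self hδ')
    have h2 := hball h1
    rw [Real.dist_eq, abs_lt] at h2
    linarith
  set w := W₀ 0 / 2
  have hw0 : 0 < w := half_pos hpos
  let g : Space → ℝ := fun z => if ‖z‖ ≤ δ then 1 else 0
  -- The subtraction is made from W itself: W₀ and W₁ need not have compact support separately, so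
  -- only the combined potential can safely be periodised.
  let h : Space → ℝ := fun z => W z - w * g z
  have hgsupp : ∀ z, R₀ < ‖z‖ → g z = 0 := fun z hz =>
    if_neg (not_le.2 ((min_le_right _ _).trans_lt hz))
  have hsupp : ∀ z, R₀ < ‖z‖ → h z = 0 := fun z hz => by
    simp only [h, hR z hz, hgsupp z hz]; simp
  have hhpos : ∀ (ι : Type) [Fintype ι] (y : ι → Space), 0 ≤ ∑ i, ∑ j, h (y i - y j) := by
    intro ι _ y
    have h1 := hpt.sum_nonneg y
    refine h1.trans (Finset.sum_le_sum fun i _ => Finset.sum_le_sum fun j _ => ?_)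
    simp only [h, g, hsum]
    split_ifs with h2
    · linarith [hw _ h2]
    · linarith [hnn (y i - y j)]
  have hkey : ∀ L, 2 * R₀ + 1 ≤ L → ∀ (N : ℕ) x, w * pairCount L δ N x ≤ shiftedEnergy L W N x := by
    intro L hL N x
    have hL0 : 0 < L := by linarith
    have hLR : 2 * R₀ < L := by linarith
    have h1 := sum_periodise_nonneg hL0 hLR hsupp hhpos N x
    have h2 : ∀ z, periodise L h z = periodise L W z - w * if Near L δ z then (1 : ℝ) else 0 := by
      intro z
      by_cases hz : Near L R₀ z
      · obtain ⟨n, hn⟩ := hz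
        rw [periodise_eq hL0 hLR hsupp hn, periodise_eq hL0 hLR hR hn]
        simp only [h, g]
        congr 2
        have : Near L δ z ↔ ‖z + latticeVec L n‖ ≤ δ := by
          refine ⟨fun ⟨m, hm⟩ => ?_, fun h => ⟨n, h⟩⟩
          rwa [near_unique hL0 hLR (hm.trans (min_le_right _ _)) hn] at hm
        simp only [this]
      · rw [periodise_eq_zero hsupp hz, periodise_eq_zero hR hz, if_neg]
        · simp
        · rintro ⟨m, hm⟩
          exact hz ⟨m, hm.trans (min_le_right _ _)⟩
    simp_rw [h2, Finset.sum_sub_distrib, ← Finset.mul_sum] at h1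
    rw [sum_periodise_eq hL0 hR0.le hLR hR] at h1
    simp only [shiftedEnergy]
    have h3 : pairCount L δ N x = ∑ i, ∑ j, if Near L δ (x i - x j) then (1 : ℝ) else 0 := by
      unfold pairCount
      congr!
    rw [h3]
    linarith
  refine ⟨2 * R₀ + 1, by positivity, fun R => ?_, fun L hL => ?_⟩
  · obtain ⟨C, hC, h1⟩ := exists_pairCount_le hδ R
    refine ⟨C / w, by positivity, fun L hL N x => ?_⟩
    have hδL : δ ≤ L := (min_le_right _ _).trans (by linarith)
    refine (h1 L hδL N x).trans ?_
    rw [div_mul_eq_mul_div, le_div_iff₀ hw0]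
    have := mul_le_mul_of_nonneg_left (hkey L hL N x) hC
    linarith
  · obtain ⟨C, hC, h1⟩ := exists_sq_le_pairCount hδ (L := L) (by linarith)
    refine ⟨C / w, by positivity, fun N x => ?_⟩
    refine (h1 N x).trans ?_
    rw [div_mul_eq_mul_div, le_div_iff₀ hw0]
    have := mul_le_mul_of_nonneg_left (hkey L hL N x) hC
    linarith

end Superstability

end

section

/-! ### Dilations and boosts between tori -/

section Dilation

variable {L r : ℝ}

lemma map_inv_smul_confMeasure (hr : 0 < r) (L : ℝ) (N : ℕ) :
    Measure.map (fun y : Conf N => r⁻¹ • y) (confMeasure (r * L) N) =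
      ENNReal.ofReal (r ^ (3 * N)) • confMeasure L N := by
  rw [map_smul_confMeasure (inv_pos.2 hr), inv_mul_cancel_left₀ hr.ne', inv_pow, inv_inv]

lemma ae_inv_smul (hr : 0 < r) {N : ℕ} {p : Conf N → Prop} (h : ∀ᵐ x ∂(confMeasure L N), p x) :
    ∀ᵐ y ∂(confMeasure (r * L) N), p (r⁻¹ • y) := by
  have hm : Measurable fun y : Conf N => r⁻¹ • y := measurable_const_smul _
  refine ae_of_ae_map hm.aemeasurable ?_
  rw [map_inv_smul_confMeasure hr]
  exact Measure.ae_smul_measure h _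

lemma integral_inv_smul (hr : 0 < r) {N : ℕ} {F : Conf N → ℂ}
    (hF : AEStronglyMeasurable F (confMeasure L N)) :
    ∫ y, F (r⁻¹ • y) ∂(confMeasure (r * L) N) =
      ((r ^ (3 * N) : ℝ) : ℂ) * ∫ x, F x ∂(confMeasure L N) := by
  have hm : Measurable fun y : Conf N => r⁻¹ • y := measurable_const_smul _
  have h := integral_map (μ := confMeasure (r * L) N) hm.aemeasurable (f := F) (by
    rw [map_inv_smul_confMeasure hr]; exact hF.smul_measure _)
  rw [map_inv_smul_confMeasure hr, integral_smul_measure,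
    ENNReal.toReal_ofReal (by positivity)] at h
  rw [← h]
  rfl

/-- The momenta of the torus of side rL are those of side L divided by r. A boost by the integer
index n respects periodicity and shifts every index by n. -/
lemma planeWave_dilate (hr : 0 < r) {N : ℕ} (n : Fin 3 → ℤ)
    (k : Fin N → Fin 3 → ℤ) (y : Conf N) :
    starRingEnd ℂ (planeWave (r * L) (fun j => k j + n) y) *
      planeWave (r * L) (fun _ => n) y = starRingEnd ℂ (planeWave L k (r⁻¹ • y)) := by
  unfold planeWave
  rw [← Complex.exp_conj, ← Complex.exp_conj, ← Complex.exp_add]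
  congr 1
  simp only [map_mul, Complex.conj_I, Complex.conj_ofReal]
  rw [neg_mul, neg_mul, ← sub_eq_neg_add, ← mul_sub, ← mul_neg]
  congr 1
  rw [← Complex.ofReal_sub, ← Complex.ofReal_neg]
  congr 1
  rw [← Finset.sum_sub_distrib, ← Finset.sum_neg_distrib]
  refine Finset.sum_congr rfl fun j _ => ?_
  rw [← inner_sub_left, PiLp.inner_apply, PiLp.inner_apply, ← Finset.sum_neg_distrib]
  refine Finset.sum_congr rfl fun a _ => ?_
  simp [wavevec]
  field_simp
  ring

/-- The normalised dilation by `r` composed with a boost, on the `N`-body space. -/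
lemma exists_body_dilation (hr : 0 < r) (n : Fin 3 → ℤ) {N : ℕ} (f : NBody L N) :
    ∃ g : NBody (r * L) N, ∀ᵐ y ∂(confMeasure (r * L) N), g y =
      (waveNorm r N : ℂ) * planeWave (r * L) (fun _ => n) y * f (r⁻¹ • y) := by
  have hm : Measurable fun y : Conf N => r⁻¹ • y := measurable_const_smul _
  have hmp : MeasurePreserving (fun y : Conf N => r⁻¹ • y) (confMeasure (r * L) N)
      (ENNReal.ofReal (r ^ (3 * N)) • confMeasure L N) := ⟨hm, map_inv_smul_confMeasure hr L N⟩
  have h1 : MemLp (fun y => f (r⁻¹ • y)) 2 (confMeasure (r * L) N) :=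
    ((Lp.memLp f).smul_measure ENNReal.ofReal_ne_top).comp_measurePreserving hmp
  have h2 : MemLp (fun y => (waveNorm r N : ℂ) * planeWave (r * L) (fun _ => n) y *
      f (r⁻¹ • y)) 2 (confMeasure (r * L) N) := by
    refine MemLp.of_le_mul (c := waveNorm r N) h1 ?_ (Eventually.of_forall fun y => ?_)
    · exact ((continuous_planeWave _ _).aestronglyMeasurable.const_mul _).mul
        h1.aestronglyMeasurable
    · rw [norm_mul, norm_mul, norm_planeWave, mul_one, Complex.norm_real, Real.norm_eq_abs,
        abs_of_pos (waveNorm_pos hr N)]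
  exact ⟨h2.toLp, h2.coeFn_toLp⟩

/-- Here `waveNorm r N` serves as the constant r^(-3N/2): its square cancels the Jacobian r^(3N),
and the boost is a phase. -/
lemma inner_body_dilation (hr : 0 < r) (n : Fin 3 → ℤ) {N : ℕ} {f f' : NBody L N}
    {g g' : NBody (r * L) N}
    (hg : ∀ᵐ y ∂(confMeasure (r * L) N), g y =
      (waveNorm r N : ℂ) * planeWave (r * L) (fun _ => n) y * f (r⁻¹ • y))
    (hg' : ∀ᵐ y ∂(confMeasure (r * L) N), g' y =
      (waveNorm r N : ℂ) * planeWave (r * L) (fun _ => n) y * f' (r⁻¹ • y)) :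
    (inner ℂ g g' : ℂ) = inner ℂ f f' := by
  rw [L2.inner_def, L2.inner_def]
  have h1 : ∫ y, inner ℂ (g y) (g' y) ∂(confMeasure (r * L) N) =
      ∫ y, (fun x => ((waveNorm r N ^ 2 : ℝ) : ℂ) * inner ℂ (f x) (f' x)) (r⁻¹ • y)
        ∂(confMeasure (r * L) N) := by
    refine integral_congr_ae ?_
    filter_upwards [hg, hg'] with y h1 h2
    rw [h1, h2, RCLike.inner_apply, RCLike.inner_apply]
    have h3 : planeWave (r * L) (fun _ : Fin N => n) y *
        starRingEnd ℂ (planeWave (r * L) (fun _ : Fin N => n) y) = 1 := by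
      rw [Complex.mul_conj, Complex.normSq_eq_norm_sq, norm_planeWave]
      norm_num
    rw [map_mul, map_mul, Complex.conj_ofReal]
    push_cast
    linear_combination (waveNorm r N : ℂ) ^ 2 * f' (r⁻¹ • y) * starRingEnd ℂ (f (r⁻¹ • y)) * h3
  rw [h1, integral_inv_smul hr (F := fun x => ((waveNorm r N ^ 2 : ℝ) : ℂ) * inner ℂ (f x) (f' x)),
    integral_const_mul, ← mul_assoc, ← Complex.ofReal_mul, waveNorm_sq hr,
    mul_inv_cancel₀ (by positivity), Complex.ofReal_one, one_mul]
  exact ((Lp.aestronglyMeasurable f).inner (Lp.aestronglyMeasurable f')).const_mul _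

lemma bodyCoeff_dilation (hr : 0 < r) (n : Fin 3 → ℤ) {N : ℕ} {f : NBody L N}
    {g : NBody (r * L) N}
    (hg : ∀ᵐ y ∂(confMeasure (r * L) N), g y =
      (waveNorm r N : ℂ) * planeWave (r * L) (fun _ => n) y * f (r⁻¹ • y))
    (k : Fin N → Fin 3 → ℤ) :
    bodyCoeff g (fun j => k j + n) =
      (waveNorm r N : ℂ) * ((r ^ (3 * N) : ℝ) : ℂ) * bodyCoeff f k := by
  rw [bodyCoeff, bodyCoeff]
  have h1 : ∫ y, starRingEnd ℂ (planeWave (r * L) (fun j => k j + n) y) * g y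
      ∂(confMeasure (r * L) N) =
      ∫ y, (fun x => (waveNorm r N : ℂ) * (starRingEnd ℂ (planeWave L k x) * f x)) (r⁻¹ • y)
        ∂(confMeasure (r * L) N) := by
    refine integral_congr_ae ?_
    filter_upwards [hg] with y h1
    rw [h1, ← planeWave_dilate hr n]
    ring
  rw [h1, integral_inv_smul hr
    (F := fun x => (waveNorm r N : ℂ) * (starRingEnd ℂ (planeWave L k x) * f x)),
    integral_const_mul]
  · ring
  · exact ((Complex.continuous_conj.comp (continuous_planeWave L _)).aestronglyMeasurable.mul
        (Lp.aestronglyMeasurable f)).const_mul _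

/-- All particles receive the same boost, so the phase is invariant under permutations. -/
lemma mem_fermi_dilation (hr : 0 < r) (n : Fin 3 → ℤ) {N : ℕ} {f : NBody L N}
    (hf : f ∈ fermi L N) {g : NBody (r * L) N}
    (hg : ∀ᵐ y ∂(confMeasure (r * L) N), g y =
      (waveNorm r N : ℂ) * planeWave (r * L) (fun _ => n) y * f (r⁻¹ • y)) :
    g ∈ fermi (r * L) N := by
  intro σ
  filter_upwards [hg, ae_comp_perm σ hg, ae_inv_smul hr (hf σ)] with y h1 h2 h3
  have h4 : planeWave (r * L) (fun _ : Fin N => n) (fun i => y (σ i)) =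
      planeWave (r * L) (fun _ : Fin N => n) y := planeWave_perm (r * L) σ (fun _ => n) y
  have h5 : (r⁻¹ • fun i => y (σ i)) = fun i => (r⁻¹ • y) (σ i) := rfl
  rw [h2, h1, h4, h5, h3]
  ring

/-- Dilations and boosts act isometrically between Fock spaces of tori and intertwine the
multipliers. -/
lemma exists_dilation (hr : 0 < r) (n : Fin 3 → ℤ) :
    ∃ U : Fock L → Fock (r * L), (∀ ψ φ, (inner ℂ (U ψ) (U φ) : ℂ) = inner ℂ ψ φ) ∧
      (∀ m' ψ φ, FMul (fun N k => m' N fun j => k j + n) ψ φ → FMul m' (U ψ) (U φ)) ∧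
      ∀ u' ψ φ, MMul (fun N x => u' N (r • x)) ψ φ → MMul u' (U ψ) (U φ) := by
  -- U is kept as a bare map without linearity: preservation of inner products and the intertwining
  -- relations are all that the trace inequality uses.
  choose G hG using fun (N : ℕ) (f : NBody L N) => exists_body_dilation (L := L) hr n f
  have hnorm : ∀ N f, ‖G N f‖ = ‖f‖ := by
    intro N f
    have h := inner_body_dilation hr n (hG N f) (hG N f)
    rw [inner_self_eq_norm_sq_to_K, inner_self_eq_norm_sq_to_K] at h
    have h2 : ‖G N f‖ ^ 2 = ‖f‖ ^ 2 := by exact_mod_cast h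
    exact (pow_left_inj₀ (norm_nonneg _) (norm_nonneg _) two_ne_zero).1 h2
  have hmem : ∀ ψ : Fock L, Memℓp (fun N => (⟨G N (ψ N : NBody L N),
      mem_fermi_dilation hr n (ψ N).2 (hG N _)⟩ : fermi (r * L) N)) 2 := by
    intro ψ
    refine (lp.memℓp ψ).mono' fun N => ?_
    exact (hnorm N _).le
  refine ⟨fun ψ => ⟨_, hmem ψ⟩, fun ψ φ => ?_, fun m' ψ φ h N k => ?_, fun u' ψ φ h N => ?_⟩
  · rw [lp.inner_eq_tsum, lp.inner_eq_tsum]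
    exact tsum_congr fun N => inner_body_dilation hr n (hG N _) (hG N _)
  · have h1 := bodyCoeff_dilation hr n (hG N (φ N : NBody L N)) fun j => k j - n
    have h2 := bodyCoeff_dilation hr n (hG N (ψ N : NBody L N)) fun j => k j - n
    simp only [sub_add_cancel] at h1 h2
    change bodyCoeff (G N (φ N : NBody L N)) k = _ * bodyCoeff (G N (ψ N : NBody L N)) k
    have h3 : bodyCoeff (φ N : NBody L N) (fun j => k j - n) = _ := h N fun j => k j - n
    simp only [sub_add_cancel] at h3
    rw [h1, h2, h3]
    change _ = _ * (_ * coeff ψ N _)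
    ring
  · change ∀ᵐ y ∂(confMeasure (r * L) N), G N (φ N : NBody L N) y =
      (u' N y : ℂ) * G N (ψ N : NBody L N) y
    filter_upwards [hG N (φ N : NBody L N), hG N (ψ N : NBody L N), ae_inv_smul hr (h N)]
      with y h1 h2 h3
    rw [smul_inv_smul₀ hr.ne'] at h3
    simp only [wave] at h3
    rw [h1, h2, h3]
    ring

end Dilation

end

section

/-! ### Thermal means and the Peierls-Bogoliubov inequality -/

section Thermal

variable {F : Type} [NormedAddCommGroup F] [InnerProductSpace ℂ F] {A : F →ₗ.[ℂ] F}

/-- The weighted sum of a function over the eigenbasis used for traces. -/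
def weightedSum (β : ℝ) (h : Nonempty (Eigenbasis A)) (f : F → ℝ) : ℝ :=
  ∑' i, Real.exp (-β * (Classical.choice h).energy i) * f ((Classical.choice h).basis i)

/-- Absolute convergence of `weightedSum`. -/
def WeightedSummable (β : ℝ) (h : Nonempty (Eigenbasis A)) (f : F → ℝ) : Prop :=
  Summable fun i =>
    Real.exp (-β * (Classical.choice h).energy i) * f ((Classical.choice h).basis i)

/-- The thermal mean of a function of state vectors. -/
def thermalMean (β : ℝ) (h : Nonempty (Eigenbasis A)) (f : F → ℝ) : ℝ :=
  weightedSum β h f / heatTrace β A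

/-- Convergence of the partition function at all positive temperatures. -/
def HasFiniteTrace (h : Nonempty (Eigenbasis A)) : Prop :=
  ∀ β : ℝ, 0 < β → Summable fun i => Real.exp (-β * (Classical.choice h).energy i)

lemma heatTrace_eq (β : ℝ) (h : Nonempty (Eigenbasis A)) :
    heatTrace β A = ∑' i, Real.exp (-β * (Classical.choice h).energy i) := by
  rw [heatTrace, dif_pos h]

lemma heatTrace_pos [Nontrivial F] {β : ℝ} (hβ : 0 < β) (h : Nonempty (Eigenbasis A))
    (hs : HasFiniteTrace h) : 0 < heatTrace β A := by
  rw [heatTrace_eq β h]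
  have hne : Nonempty (Classical.choice h).ι := by
    by_contra hempty
    rw [not_nonempty_iff] at hempty
    obtain ⟨x, hx⟩ := exists_ne (0 : F)
    refine hx (norm_eq_zero.1 ?_)
    have := (hilbertBasis_hasSum_norm_sq (Classical.choice h).basis x).unique
      (hasSum_empty (f := fun j => ‖(inner ℂ ((Classical.choice h).basis j) x : ℂ)‖ ^ 2))
    simpa using this
  obtain ⟨i⟩ := hne
  exact (hs β hβ).tsum_pos (fun _ => (Real.exp_pos _).le) i (Real.exp_pos _)

lemma heatTraceMul_eq (β : ℝ) (h : Nonempty (Eigenbasis A)) {X : F →ₗ.[ℂ] F} {f : F → ℝ}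
    (hX : ∀ i, expval X ((Classical.choice h).basis i) = (f ((Classical.choice h).basis i) : ℂ)) :
    heatTraceMul β A X = (weightedSum β h f : ℂ) := by
  rw [heatTraceMul, dif_pos h, weightedSum, Complex.ofReal_tsum]
  refine tsum_congr fun i => ?_
  rw [hX]
  push_cast
  rfl

lemma thermalMean_add {β : ℝ} {h : Nonempty (Eigenbasis A)} {f g : F → ℝ}
    (hf : WeightedSummable β h f) (hg : WeightedSummable β h g) :
    thermalMean β h (fun ψ => f ψ + g ψ) = thermalMean β h f + thermalMean β h g := by
  rw [thermalMean, thermalMean, thermalMean, ← add_div, weightedSum, weightedSum, weightedSum,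
    ← hf.tsum_add hg]
  simp only [mul_add]

lemma thermalMean_mul_left (β : ℝ) (h : Nonempty (Eigenbasis A)) (c : ℝ) (f : F → ℝ) :
    thermalMean β h (fun ψ => c * f ψ) = c * thermalMean β h f := by
  rw [thermalMean, thermalMean, ← mul_div_assoc, weightedSum, weightedSum, ← tsum_mul_left]
  simp only [mul_left_comm]

lemma WeightedSummable.add {β : ℝ} {h : Nonempty (Eigenbasis A)} {f g : F → ℝ}
    (hf : WeightedSummable β h f) (hg : WeightedSummable β h g) :
    WeightedSummable β h fun ψ => f ψ + g ψ := by
  refine (Summable.add hf hg).congr fun i => ?_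
  ring

lemma WeightedSummable.mul_left {β : ℝ} {h : Nonempty (Eigenbasis A)} {f : F → ℝ}
    (hf : WeightedSummable β h f) (c : ℝ) : WeightedSummable β h fun ψ => c * f ψ := by
  refine (Summable.mul_left c hf).congr fun i => ?_
  ring

lemma Eigenbasis.re_expval {e : Eigenbasis A} (i : e.ι) :
    (expval A (e.basis i)).re = e.energy i := by
  rw [expval, dif_pos (e.mem_domain i), e.apply_eq, inner_smul_right,
    inner_self_eq_norm_sq_to_K, e.basis.orthonormal.1 i]
  simp

lemma thermalMean_mono [Nontrivial F] {β : ℝ} (hβ : 0 < β) {h : Nonempty (Eigenbasis A)}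
    (hs : HasFiniteTrace h) {f g : F → ℝ}
    (hf : WeightedSummable β h f) (hg : WeightedSummable β h g)
    (hfg : ∀ ψ ∈ A.domain, ‖ψ‖ = 1 → f ψ ≤ g ψ) : thermalMean β h f ≤ thermalMean β h g := by
  refine div_le_div_of_nonneg_right ?_ (heatTrace_pos hβ h hs).le
  refine hf.tsum_le_tsum (fun i => ?_) hg
  exact mul_le_mul_of_nonneg_left (hfg _ ((Classical.choice h).mem_domain i)
    ((Classical.choice h).basis.orthonormal.1 i)) (Real.exp_pos _).le

/-- From |E| ≤ (2/β)(exp (βE/2) + exp (-βE/2)) the weighted energy is dominated by the partition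
sums at β/2 and 3β/2; this is why `HasFiniteTrace` asks for all positive temperatures. -/
lemma weightedSummable_energy {β : ℝ} (hβ : 0 < β) {h : Nonempty (Eigenbasis A)}
    (hs : HasFiniteTrace h) : WeightedSummable β h fun ψ => (expval A ψ).re := by
  have h1 := hs (β / 2) (by positivity)
  have h2 := hs (3 * β / 2) (by positivity)
  refine Summable.of_norm_bounded ((h1.add h2).mul_left (2 / β)) fun i => ?_
  beta_reduce
  rw [Eigenbasis.re_expval]
  set E := (Classical.choice h).energy i
  rw [norm_mul, Real.norm_eq_abs, Real.norm_eq_abs, abs_of_pos (Real.exp_pos _)]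
  have e1 : Real.exp (-(β / 2) * E) = Real.exp (-β * E) * Real.exp (β / 2 * E) := by
    rw [← Real.exp_add]; ring_nf
  have e2 : Real.exp (-(3 * β / 2) * E) = Real.exp (-β * E) * Real.exp (-(β / 2 * E)) := by
    rw [← Real.exp_add]; ring_nf
  rw [e1, e2, ← mul_add, mul_left_comm]
  refine mul_le_mul_of_nonneg_left ?_ (Real.exp_pos _).le
  have h3 := Real.add_one_le_exp (β / 2 * E)
  have h4 := Real.add_one_le_exp (-(β / 2 * E))
  have h5 := Real.exp_pos (β / 2 * E)
  have h6 := Real.exp_pos (-(β / 2 * E))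
  rw [div_mul_eq_mul_div, le_div_iff₀ hβ]
  rcases abs_cases E with ⟨h7, _⟩ | ⟨h7, _⟩ <;> rw [h7] <;> linarith

lemma weightedSummable_of_le {β : ℝ} (hβ : 0 < β) {h : Nonempty (Eigenbasis A)}
    (hs : HasFiniteTrace h) {f : F → ℝ} {C C' : ℝ}
    (hf : ∀ ψ ∈ A.domain, ‖ψ‖ = 1 → |f ψ| ≤ C * (expval A ψ).re + C') :
    WeightedSummable β h f := by
  refine Summable.of_norm_bounded
    (Summable.add ((weightedSummable_energy hβ hs).mul_left C) ((hs β hβ).mul_right C'))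
    fun i => ?_
  beta_reduce
  rw [norm_mul, Real.norm_eq_abs, abs_of_pos (Real.exp_pos _), ← mul_add]
  exact mul_le_mul_of_nonneg_left (hf _ ((Classical.choice h).mem_domain i)
    ((Classical.choice h).basis.orthonormal.1 i)) (Real.exp_pos _).le

/-- The Peierls-Bogoliubov inequality for two operators compared through an isometry. -/
lemma log_heatTrace_ge [Nontrivial F] {F' : Type} [NormedAddCommGroup F']
    [InnerProductSpace ℂ F'] {A' : F' →ₗ.[ℂ] F'} {β β' : ℝ} (hβ : 0 < β) (hβ' : 0 < β')
    {h : Nonempty (Eigenbasis A)} (h' : Nonempty (Eigenbasis A')) (hs : HasFiniteTrace h)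
    (hs' : HasFiniteTrace h') (hA' : IsSymm A') {U : F → F'}
    (hU : ∀ ψ φ, (inner ℂ (U ψ) (U φ) : ℂ) = inner ℂ ψ φ) {g : F → ℝ}
    (hdom : ∀ ψ ∈ A.domain, ∃ hd : U ψ ∈ A'.domain, (inner ℂ (U ψ) (A' ⟨U ψ, hd⟩)).re = g ψ)
    (hg : WeightedSummable β h g) :
    Real.log (heatTrace β A) -
        (β' * thermalMean β h g - β * thermalMean β h fun ψ => (expval A ψ).re) ≤
      Real.log (heatTrace β' A') := by
  set e := Classical.choice h with he
  set e' := Classical.choice h' with he'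
  choose hd hval using fun i => hdom (e.basis i) (e.mem_domain i)
  have horth : Orthonormal ℂ fun i => U (e.basis i) := by
    classical
    rw [orthonormal_iff_ite]
    intro i j
    rw [hU, orthonormal_iff_ite.1 e.basis.orthonormal i j]
  -- Peierls' inequality for A', tested on the transported eigenvectors of A. Bounded partial sums
  -- also give summability of the tested exponentials.
  have hP : ∀ s : Finset e.ι, ∑ i ∈ s, Real.exp (-(β' * g (e.basis i))) ≤ heatTrace β' A' := by
    intro s
    have h1 := e'.sum_exp_neg_le hA' (hs' β' hβ') (v := fun i => ⟨U (e.basis i), hd i⟩) horth s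
    rw [heatTrace_eq β' h']
    refine le_trans (le_of_eq (Finset.sum_congr rfl fun i _ => ?_)) h1
    rw [hval]
  have hsumm : Summable fun i => Real.exp (-(β' * g (e.basis i))) :=
    summable_of_sum_le (fun _ => (Real.exp_pos _).le) hP
  have hZ := heatTrace_pos hβ h hs
  have hle : ∑' i, Real.exp (-(β' * g (e.basis i))) ≤ heatTrace β' A' :=
    hsumm.tsum_le_of_sum_le hP
  have hE : Summable fun i => Real.exp (-(β * e.energy i)) := by
    refine (hs β hβ).congr fun i => ?_
    rw [neg_mul]
  have hZeq : heatTrace β A = ∑' i, Real.exp (-(β * e.energy i)) := by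
    rw [heatTrace_eq β h]
    exact tsum_congr fun i => by rw [neg_mul]
  have hen := weightedSummable_energy hβ hs
  have hx : HasSum (fun i => Real.exp (-(β * e.energy i)) *
      (β' * g (e.basis i) - β * e.energy i))
      (β' * weightedSum β h g - β * weightedSum β h fun ψ => (expval A ψ).re) := by
    refine ((Summable.hasSum hg).mul_left β' |>.sub ((Summable.hasSum hen).mul_left β)).congr_fun
      fun i => ?_
    beta_reduce
    rw [Eigenbasis.re_expval, neg_mul]
    ring
  -- The Gibbs variational inequality at the energies βE, with perturbation β' g - βE, turns the
  -- tested sum into Z times the exponential of minus a mean.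
  have hmain := mul_exp_neg_mean_le_tsum hE (by rw [← hZeq]; exact hZ) hx.summable (by
    refine hsumm.congr fun i => ?_
    congr 1; ring)
  have hexp : (fun i => Real.exp (-(β * e.energy i + (β' * g (e.basis i) - β * e.energy i)))) =
      fun i => Real.exp (-(β' * g (e.basis i))) := by
    funext i
    congr 1; ring
  rw [hexp, ← hZeq, hx.tsum_eq] at hmain
  have hlog := Real.log_le_log (by positivity) (hmain.trans hle)
  rw [Real.log_mul hZ.ne' (Real.exp_pos _).ne', Real.log_exp] at hlog
  refine le_trans (le_of_eq ?_) hlog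
  simp only [thermalMean]
  ring

end Thermal

/-! ### Convergence of the grand-canonical lattice sums -/

section LatticeSums

lemma hasSum_mul_prod {κ κ' : Type*} {f : κ → ℝ} {g : κ' → ℝ} {z w : ℝ} (hf0 : ∀ k, 0 ≤ f k)
    (hg0 : ∀ k, 0 ≤ g k) (hf : HasSum f z) (hg : HasSum g w) :
    HasSum (fun p : κ × κ' => f p.1 * g p.2) (z * w) :=
  hf.mul hg (hf.summable.mul_of_nonneg hg.summable hf0 hg0)

lemma hasSum_prod_fin {κ : Type*} {f : κ → ℝ} {z : ℝ} (hf0 : ∀ k, 0 ≤ f k) (hf : HasSum f z) :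
    ∀ N : ℕ, HasSum (fun k : Fin N → κ => ∏ j, f (k j)) (z ^ N) := by
  intro N
  induction N with
  | zero =>
    simp
  | succ N ih =>
    have hmul : HasSum (fun p : κ × (Fin N → κ) => f p.1 * ∏ j, f (p.2 j)) (z * z ^ N) :=
      hasSum_mul_prod (g := fun k : Fin N → κ => ∏ j, f (k j)) hf0
        (fun k => Finset.prod_nonneg fun _ _ => hf0 _) hf ih
    rw [pow_succ', ← (Fin.consEquiv fun _ : Fin (N + 1) => κ).hasSum_iff]
    convert hmul using 2 with p
    exact Fin.prod_univ_succ _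

lemma summable_int_exp_neg_sq {c : ℝ} (hc : 0 < c) :
    Summable fun q : ℤ => Real.exp (-(c * (q : ℝ) ^ 2)) := by
  have hnat : Summable fun n : ℕ => Real.exp (-(c * (n : ℝ) ^ 2)) := by
    have h1 : Summable fun n : ℕ => Real.exp (n * (-c)) :=
      Real.summable_exp_nat_mul_iff.2 (by linarith)
    refine h1.of_nonneg_of_le (fun _ => (Real.exp_pos _).le) fun n => Real.exp_le_exp.2 ?_
    have : (n : ℝ) ≤ (n : ℝ) ^ 2 := by
      rcases Nat.eq_zero_or_pos n with rfl | hn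
      · simp
      · have : (1 : ℝ) ≤ n := by exact_mod_cast hn
        nlinarith
    nlinarith
  refine Summable.of_nat_of_neg ?_ ?_
  · simpa using hnat
  · simpa using hnat

/-- Convergence of the grand-canonical sum for a lower bound with a quadratic term in the
particle number. -/
lemma summable_exp_neg_lowerBound {L : ℝ} (hL : 0 < L) {a b c : ℝ} (ha : 0 < a) (hb : 0 < b) :
    Summable fun p : Σ N : ℕ, Fin N → Fin 3 → ℤ =>
      Real.exp (-(a * kineticMul L p.1 p.2 + b * (p.1 : ℝ) ^ 2 - c * p.1)) := by
  set d := a * (2 * Real.pi / L) ^ 2 / 2 with hd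
  have hd0 : 0 < d := by positivity
  obtain ⟨z, hz⟩ := summable_int_exp_neg_sq hd0
  have hz3 := hasSum_prod_fin (fun _ => (Real.exp_pos _).le) hz 3
  have hterm : ∀ N (k : Fin N → Fin 3 → ℤ),
      ∏ j, ∏ i, Real.exp (-(d * (k j i : ℝ) ^ 2)) = Real.exp (-(a * kineticMul L N k)) := by
    intro N k
    simp_rw [← Real.exp_sum]
    congr 1
    rw [kineticMul, Finset.mul_sum, ← Finset.sum_neg_distrib]
    refine Finset.sum_congr rfl fun j _ => ?_
    rw [EuclideanSpace.real_norm_sq_eq, Finset.sum_div, Finset.mul_sum, ← Finset.sum_neg_distrib]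
    refine Finset.sum_congr rfl fun i _ => ?_
    simp only [wavevec, hd]
    ring
  have hN : ∀ N : ℕ, HasSum (fun k : Fin N → Fin 3 → ℤ =>
      Real.exp (-(a * kineticMul L N k + b * (N : ℝ) ^ 2 - c * N)))
      (Real.exp (-(b * (N : ℝ) ^ 2 - c * N)) * (z ^ 3) ^ N) := by
    intro N
    have h1 := (hasSum_prod_fin (fun _ => Finset.prod_nonneg fun _ _ => (Real.exp_pos _).le)
      hz3 N).mul_left (Real.exp (-(b * (N : ℝ) ^ 2 - c * N)))
    refine h1.congr_fun fun k => ?_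
    rw [hterm, ← Real.exp_add]
    congr 1; ring
  refine (summable_sigma_of_nonneg fun _ => (Real.exp_pos _).le).2 ⟨fun N => (hN N).summable, ?_⟩
  simp_rw [fun N => (hN N).tsum_eq]
  have hz0 : 0 ≤ z ^ 3 := hz3.nonneg fun _ => Finset.prod_nonneg fun _ _ => (Real.exp_pos _).le
  -- The one-particle sum z³ enters to the power N, hence grows at most like exp (sN). Completing
  -- the square absorbs (c+s)N into half of the quadratic term bN².
  obtain ⟨s, hs⟩ : ∃ s : ℝ, z ^ 3 ≤ Real.exp s :=
    ⟨z ^ 3, (le_add_of_nonneg_right zero_le_one).trans (Real.add_one_le_exp _)⟩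
  have hsum := (summable_int_exp_neg_sq (c := b / 2) (by positivity)).comp_injective
    Nat.cast_injective
  refine Summable.of_nonneg_of_le (fun N => mul_nonneg (Real.exp_pos _).le (pow_nonneg hz0 N))
    (fun N => ?_) (hsum.mul_left (Real.exp ((c + s) ^ 2 / (2 * b))))
  calc Real.exp (-(b * (N : ℝ) ^ 2 - c * N)) * (z ^ 3) ^ N
      ≤ Real.exp (-(b * (N : ℝ) ^ 2 - c * N)) * Real.exp s ^ N :=
        mul_le_mul_of_nonneg_left (pow_le_pow_left₀ hz0 hs N) (Real.exp_pos _).le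
    _ = Real.exp (-(b * (N : ℝ) ^ 2 - c * N) + N * s) := by
        rw [← Real.exp_nat_mul, ← Real.exp_add]
    _ ≤ Real.exp ((c + s) ^ 2 / (2 * b) + -(b / 2 * (N : ℝ) ^ 2)) := by
        refine Real.exp_le_exp.2 ?_
        have : (c + s) ^ 2 / (2 * b) + -(b / 2 * (N : ℝ) ^ 2) -
            (-(b * (N : ℝ) ^ 2 - c * N) + N * s) = ((c + s) - b * N) ^ 2 / (2 * b) := by
          field_simp; ring
        have h2 : 0 ≤ ((c + s) - b * N) ^ 2 / (2 * b) := by positivity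
        linarith
    _ = _ := by
        rw [Real.exp_add]
        simp

end LatticeSums

end

/-! ### Forms on the common domain and finiteness of the partition function -/

section

variable {L : ℝ}

lemma nontrivial_fock (hL : 0 < L) : Nontrivial (Fock L) := by
  have hmem : waveBasis hL 0 Fin.elim0 ∈ fermi L 0 := by
    rw [mem_fermi_iff_bodyCoeff hL]
    intro σ k
    rw [Subsingleton.elim σ 1]
    simp
  refine ⟨lp.single 2 0 ⟨waveBasis hL 0 Fin.elim0, hmem⟩, 0, fun h => ?_⟩
  have h1 := congrArg (fun ψ : Fock L => ((ψ 0 : fermi L 0) : NBody L 0)) h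
  simp only [lp.single_apply_self] at h1
  have h2 := (waveBasis hL 0).orthonormal.1 Fin.elim0
  rw [h1] at h2
  simp at h2

/-! ### Quadratic forms -/

/-- The quadratic form of a Fourier multiplier. -/
def fForm (L : ℝ) (m : ∀ N : ℕ, (Fin N → Fin 3 → ℤ) → ℝ) (ψ : Fock L) : ℝ :=
  (expval (fourierMultiplier L m) ψ).re

/-- The quadratic form of a multiplication operator. -/
def mForm (L : ℝ) (u : ∀ N : ℕ, Conf N → ℝ) (ψ : Fock L) : ℝ :=
  (expval (multiplication L u) ψ).re

lemma FMul.fForm_eq (hL : 0 < L) {m : ∀ N : ℕ, (Fin N → Fin 3 → ℤ) → ℝ} {ψ φ : Fock L}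
    (h : FMul m ψ φ) : fForm L m ψ = (inner ℂ ψ φ).re := by
  rw [fForm, expval_fourierMultiplier hL h, Complex.ofReal_re]

lemma MMul.mForm_eq {u : ∀ N : ℕ, Conf N → ℝ} {ψ φ : Fock L}
    (h : MMul u ψ φ) : mForm L u ψ = (inner ℂ ψ φ).re := by
  rw [mForm, expval_multiplication h, Complex.ofReal_re]

/-- The quadratic form of the kinetic energy. -/
def kinForm (L : ℝ) (ψ : Fock L) : ℝ := fForm L (kineticMul L) ψ

/-- The quadratic form of the momentum. -/
def momForm (L : ℝ) (α : Space) (ψ : Fock L) : ℝ := fForm L (momentumMul L α) ψ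

/-- The quadratic form of the particle number. -/
def numForm (L : ℝ) (ψ : Fock L) : ℝ := fForm L (fun N _ => (N : ℝ)) ψ

/-- The quadratic form of a pair interaction. -/
def pairForm (L : ℝ) (U : Space → ℝ) (ψ : Fock L) : ℝ := mForm L (pairEnergy L U) ψ

/-- The quadratic form of the shifted interaction. -/
def shiftForm (L : ℝ) (W : Space → ℝ) (ψ : Fock L) : ℝ := mForm L (shiftedEnergy L W) ψ

/-- Vectors in the common domain of kinetic energy, interaction and particle number. -/
structure Regular (W : Space → ℝ) (ψ : Fock L) : Prop where
  kin : ∃ φ, FMul (kineticMul L) ψ φ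
  pot : ∃ φ, MMul (pairEnergy L W) ψ φ
  num : ∃ φ, FMul (fun N _ => (N : ℝ)) ψ φ

variable {W : Space → ℝ} {ψ : Fock L}

lemma mMul_one (ψ : Fock L) : MMul (fun _ _ => (1 : ℝ)) ψ ψ := fun _ => by simp

lemma Regular.of_mem_domain (hL : 0 < L) {α : Space} {μ : ℝ}
    (h : ψ ∈ (hamiltonian W L α μ).domain) : Regular W ψ := by
  obtain ⟨a, b, c, d, hp, -⟩ := exists_hamiltonianParts hL ⟨ψ, h⟩
  exact ⟨⟨a, hp.kin⟩, ⟨b, hp.pot⟩, ⟨d, hp.num⟩⟩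

lemma Regular.mom (hL : 0 < L) (h : Regular W ψ) (α : Space) :
    ∃ φ, FMul (momentumMul L α) ψ φ := by
  obtain ⟨a, ha⟩ := h.kin
  obtain ⟨b, hb⟩ := h.num
  refine (ha.add (hb.smul (‖α‖ ^ 2 / 2))).exists_of_le hL
    (fun N σ k => momentumMul_perm L α N σ k) zero_le_one fun N k => ?_
  have h1 := abs_momentumMul_le L α N k one_pos
  have h2 : 0 ≤ kineticMul L N k + ‖α‖ ^ 2 / 2 * N :=
    add_nonneg (kineticMul_nonneg L N k) (by positivity)
  rw [abs_of_nonneg h2]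
  simpa using h1

lemma Regular.shift (hL : 0 < L) (h : Regular W ψ) : ∃ φ, MMul (shiftedEnergy L W) ψ φ := by
  obtain ⟨a, ha⟩ := h.pot
  obtain ⟨b, hb⟩ := h.num
  exact ⟨_, (ha.smul 2).add (((mMul_number_iff hL fun N => (N : ℝ)).2 hb).smul (W 0))⟩

lemma Regular.exists_parts (hL : 0 < L) (h : Regular W ψ) (α : Space) :
    ∃ a b c d, HamiltonianParts W α ψ a b c d := by
  obtain ⟨a, ha⟩ := h.kin
  obtain ⟨b, hb⟩ := h.pot
  obtain ⟨c, hc⟩ := h.mom hL α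
  obtain ⟨d, hd⟩ := h.num
  exact ⟨a, b, c, d, ha, hb, hc, hd⟩

lemma Regular.energy (hL : 0 < L) (h : Regular W ψ) (α : Space) (μ : ℝ) :
    ∃ hd : ψ ∈ (hamiltonian W L α μ).domain,
      (inner ℂ ψ (hamiltonian W L α μ ⟨ψ, hd⟩)).re =
        kinForm L ψ + pairForm L W ψ - momForm L α ψ - μ * numForm L ψ := by
  obtain ⟨a, b, c, d, hp⟩ := h.exists_parts hL α
  refine ⟨hp.mem_domain hL μ, ?_⟩
  rw [hp.apply hL, kinForm, pairForm, momForm, numForm, hp.kin.fForm_eq hL, hp.pot.mForm_eq,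
    hp.mom.fForm_eq hL, hp.num.fForm_eq hL, inner_sub_right, inner_sub_right, inner_add_right,
    inner_smul_right]
  simp

lemma Regular.re_expval (hL : 0 < L) (h : Regular W ψ) (α : Space) (μ : ℝ) :
    (expval (hamiltonian W L α μ) ψ).re =
      kinForm L ψ + pairForm L W ψ - momForm L α ψ - μ * numForm L ψ := by
  obtain ⟨hd, he⟩ := h.energy hL α μ
  rw [expval, dif_pos hd, he]

lemma Regular.shiftForm_eq (hL : 0 < L) (h : Regular W ψ) :
    shiftForm L W ψ = 2 * pairForm L W ψ + W 0 * numForm L ψ := by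
  obtain ⟨a, ha⟩ := h.pot
  obtain ⟨b, hb⟩ := h.num
  have h1 : MMul (shiftedEnergy L W) ψ _ :=
    (ha.smul 2).add (((mMul_number_iff hL fun N => (N : ℝ)).2 hb).smul (W 0))
  rw [shiftForm, h1.mForm_eq, pairForm, ha.mForm_eq, numForm, hb.fForm_eq hL, inner_add_right,
    inner_smul_right, inner_smul_right]
  simp

lemma Regular.kinForm_nonneg (hL : 0 < L) (h : Regular W ψ) : 0 ≤ kinForm L ψ := by
  obtain ⟨a, ha⟩ := h.kin
  rw [kinForm, ha.fForm_eq hL]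
  exact ha.re_inner_nonneg hL fun N k => kineticMul_nonneg L N k

lemma Regular.numForm_nonneg (hL : 0 < L) (h : Regular W ψ) : 0 ≤ numForm L ψ := by
  obtain ⟨a, ha⟩ := h.num
  rw [numForm, ha.fForm_eq hL]
  exact ha.re_inner_nonneg hL fun N k => Nat.cast_nonneg N

lemma Regular.abs_momForm_le (hL : 0 < L) (h : Regular W ψ) (α : Space) {s : ℝ} (hs : 0 < s) :
    |momForm L α ψ| ≤ s * kinForm L ψ + ‖α‖ ^ 2 / (2 * s) * numForm L ψ := by
  obtain ⟨a, b, c, d, hp⟩ := h.exists_parts hL α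
  rw [momForm, kinForm, numForm, hp.kin.fForm_eq hL, hp.mom.fForm_eq hL, hp.num.fForm_eq hL]
  have key := fun t : ℝ => fun ht : |t| ≤ 1 =>
    (((hp.kin.smul s).add (hp.num.smul (‖α‖ ^ 2 / (2 * s)))).add (hp.mom.smul t)).re_inner_nonneg
      hL fun N k => by
        have h1 := abs_momentumMul_le L α N k hs
        have h2 : |t * momentumMul L α N k| ≤ |momentumMul L α N k| := by
          rw [abs_mul]
          exact mul_le_of_le_one_left (abs_nonneg _) ht
        have h3 := neg_abs_le (t * momentumMul L α N k)
        linarith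
  have h1 := key 1 (by simp)
  have h2 := key (-1) (by simp)
  simp only [inner_add_right, inner_smul_right, Complex.add_re, Complex.re_ofReal_mul] at h1 h2
  rw [abs_le]
  constructor <;> linarith

lemma Regular.momForm_add (hL : 0 < L) (h : Regular W ψ) (α α' : Space) :
    momForm L (α + α') ψ = momForm L α ψ + momForm L α' ψ := by
  obtain ⟨a, ha⟩ := h.mom hL α
  obtain ⟨b, hb⟩ := h.mom hL α'
  have h1 : FMul (momentumMul L (α + α')) ψ (a + b) := by
    intro N k
    rw [ha.add hb N k]
    simp only [momentumMul, inner_add_left, Finset.sum_add_distrib]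
  rw [momForm, momForm, momForm, h1.fForm_eq hL, ha.fForm_eq hL, hb.fForm_eq hL, inner_add_right,
    Complex.add_re]

lemma Regular.momForm_smul (hL : 0 < L) (h : Regular W ψ) (c : ℝ) (α : Space) :
    momForm L (c • α) ψ = c * momForm L α ψ := by
  obtain ⟨a, ha⟩ := h.mom hL α
  have h1 : FMul (momentumMul L (c • α)) ψ ((c : ℂ) • a) := by
    intro N k
    rw [ha.smul c N k]
    simp only [momentumMul, real_inner_smul_left, Finset.mul_sum]
  rw [momForm, momForm, h1.fForm_eq hL, ha.fForm_eq hL, inner_smul_right, Complex.re_ofReal_mul]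

/-! ### Stable tori -/

/-- The particle number is controlled by the interaction on the torus of side `L`. -/
structure TorusStable (W : Space → ℝ) (L : ℝ) : Prop where
  pos : 0 < L
  meas : Measurable W
  bounded : ∀ N, ∃ M, ∀ x, |pairEnergy L W N x| ≤ M
  sq_le : ∃ C, 0 < C ∧ ∀ (N : ℕ) x, (N : ℝ) ^ 2 ≤ C * shiftedEnergy L W N x

/-- The interaction `U` is dominated by the shifted interaction `W`. -/
structure Dominated (W : Space → ℝ) (L : ℝ) (U : Space → ℝ) (C : ℝ) : Prop where
  meas : Measurable U
  le : ∀ N x, |pairEnergy L U N x| ≤ C * shiftedEnergy L W N x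

lemma TorusStable.shiftedEnergy_nonneg (h : TorusStable W L) (N : ℕ) (x : Conf N) :
    0 ≤ shiftedEnergy L W N x := by
  obtain ⟨C, hC, hle⟩ := h.sq_le
  exact nonneg_of_mul_nonneg_right ((sq_nonneg _).trans (hle N x)) hC

lemma TorusStable.shiftForm_nonneg (h : TorusStable W L) (hψ : Regular W ψ) :
    0 ≤ shiftForm L W ψ := by
  obtain ⟨a, ha⟩ := hψ.shift h.pos
  rw [shiftForm, ha.mForm_eq]
  exact ha.re_inner_nonneg fun N => Eventually.of_forall (h.shiftedEnergy_nonneg N)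

lemma Dominated.exists_mMul {U : Space → ℝ} {C : ℝ} (hU : Dominated W L U C)
    (h : TorusStable W L) (hψ : Regular W ψ) : ∃ φ, MMul (pairEnergy L U) ψ φ := by
  obtain ⟨a, ha⟩ := hψ.shift h.pos
  refine ha.exists_of_le (fun N => (measurable_pairEnergy L hU.meas N).aestronglyMeasurable)
    (fun N σ x => pairEnergy_perm L U N σ x) (C := C)
    fun N => Eventually.of_forall fun x => ?_
  rw [abs_of_nonneg (h.shiftedEnergy_nonneg N x)]
  exact hU.le N x

lemma Dominated.abs_pairForm_le {U : Space → ℝ} {C : ℝ} (hU : Dominated W L U C)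
    (h : TorusStable W L) (hψ : Regular W ψ) : |pairForm L U ψ| ≤ C * shiftForm L W ψ := by
  obtain ⟨a, ha⟩ := hψ.shift h.pos
  obtain ⟨b, hb⟩ := hU.exists_mMul h hψ
  rw [pairForm, shiftForm, ha.mForm_eq, hb.mForm_eq]
  have h1 := ((ha.smul C).add hb).re_inner_nonneg fun N => Eventually.of_forall fun x => by
    linarith [(abs_le.1 (hU.le N x)).1]
  have h2 := ((ha.smul C).add (hb.smul (-1))).re_inner_nonneg
    fun N => Eventually.of_forall fun x => by linarith [(abs_le.1 (hU.le N x)).2]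
  simp only [inner_add_right, inner_smul_right, Complex.add_re, Complex.re_ofReal_mul] at h1 h2
  rw [abs_le]
  constructor <;> linarith

/-- The linear correction between the pair energy and half the shifted energy is harmless because N
≤ N² for integers. -/
lemma TorusStable.dominated_self (h : TorusStable W L) : ∃ C, Dominated W L W C := by
  obtain ⟨C, hC, hle⟩ := h.sq_le
  refine ⟨1 / 2 + |W 0| / 2 * C, h.meas, fun N x => ?_⟩
  have h1 : pairEnergy L W N x = 1 / 2 * shiftedEnergy L W N x - W 0 / 2 * N := by
    rw [shiftedEnergy]; ring
  have h2 : (N : ℝ) ≤ (N : ℝ) ^ 2 := by exact_mod_cast Nat.le_self_pow two_ne_zero N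
  have h3 : |W 0 / 2 * (N : ℝ)| ≤ |W 0| / 2 * (C * shiftedEnergy L W N x) := by
    rw [abs_mul, abs_div, abs_two, Nat.abs_cast]
    exact mul_le_mul_of_nonneg_left (h2.trans (hle N x)) (by positivity)
  have h4 := h.shiftedEnergy_nonneg N x
  rw [h1]
  refine (abs_sub _ _).trans ?_
  rw [abs_of_nonneg (by positivity : 0 ≤ 1 / 2 * shiftedEnergy L W N x)]
  linarith

/-- The energy controls the kinetic energy, the interaction and the particle number. -/
lemma TorusStable.energy_ge (h : TorusStable W L) (α : Space) (μ : ℝ) :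
    ∃ c, ∀ ψ : Fock L, Regular W ψ → ‖ψ‖ = 1 →
      kinForm L ψ / 2 + shiftForm L W ψ / 4 + numForm L ψ ≤
        (expval (hamiltonian W L α μ) ψ).re + c := by
  obtain ⟨C, hC, hle⟩ := h.sq_le
  -- The total coefficient of N to be absorbed: W(0)/2 from undoing the shift, μ, ‖α‖² from the
  -- momentum bound with s = 1/2, and 1 for the number form on the left. A quarter of the shifted
  -- interaction is at least N²/(4C), and N²/(4C) - aN + C a² is a square.
  set a := W 0 / 2 + μ + ‖α‖ ^ 2 + 1 with ha
  refine ⟨C * a ^ 2, fun ψ hψ h1 => ?_⟩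
  rw [hψ.re_expval h.pos]
  have hmom := (abs_le.1 (hψ.abs_momForm_le h.pos α one_half_pos)).2
  have hy := hψ.shiftForm_eq h.pos
  obtain ⟨b, hb⟩ := hψ.shift h.pos
  obtain ⟨d, hd⟩ := hψ.num
  have hd' := (mMul_number_iff h.pos fun N => (N : ℝ)).2 hd
  have key := ((hb.smul (1 / 4)).add ((hd'.smul (-a)).add
    ((mMul_one ψ).smul (C * a ^ 2)))).re_inner_nonneg
    fun N => Eventually.of_forall fun x => by
      have h2 := hle N x
      have h3 : (N : ℝ) ^ 2 / (4 * C) ≤ 1 / 4 * shiftedEnergy L W N x := by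
        rw [div_le_iff₀ (by positivity)]
        linarith
      have h4 : (N : ℝ) ^ 2 / (4 * C) - a * N + C * a ^ 2 = (N - 2 * C * a) ^ 2 / (4 * C) := by
        field_simp; ring
      have h5 : 0 ≤ ((N : ℝ) - 2 * C * a) ^ 2 / (4 * C) := by positivity
      linarith
  simp only [inner_add_right, inner_smul_right, Complex.add_re, Complex.re_ofReal_mul,
    ← hb.mForm_eq, ← hd.fForm_eq h.pos] at key
  rw [inner_self_eq_norm_sq_to_K, h1] at key
  have e1 : mForm L (shiftedEnergy L W) ψ = shiftForm L W ψ := rfl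
  have e2 : fForm L (fun N _ => (N : ℝ)) ψ = numForm L ψ := rfl
  rw [e1, e2] at key
  norm_num at key
  norm_num at hmom
  have e3 : a * numForm L ψ = (W 0 / 2 + μ + ‖α‖ ^ 2 + 1) * numForm L ψ := by rw [ha]
  linarith

lemma TorusStable.eigen (h : TorusStable W L) (α : Space) (μ : ℝ) :
    Nonempty (Eigenbasis (hamiltonian W L α μ)) :=
  nonempty_eigenbasis_hamiltonian h.pos h.meas h.bounded α μ

/-- The partition function is finite. -/
lemma TorusStable.hasFiniteTrace (h : TorusStable W L) (α : Space) (μ : ℝ) :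
    HasFiniteTrace (h.eigen α μ) := by
  obtain ⟨C, hC, hle⟩ := h.sq_le
  intro β hβ
  set e := Classical.choice (h.eigen α μ)
  set a := W 0 / 2 + μ + ‖α‖ ^ 2 with ha
  -- Comparison operator: half of the kinetic energy remains after the momentum bound, half of the
  -- shifted interaction is at least N²/(2C), and a collects the linear terms in N.
  have hsum := summable_exp_neg_lowerBound h.pos (a := β / 2) (b := β / (2 * C)) (c := β * a)
    (by positivity) (by positivity)
  have hreg : ∀ i, Regular W (e.basis i) := fun i => .of_mem_domain h.pos (e.mem_domain i)
  have hex : ∀ i, ∃ x ≤ β * e.energy i, HasSum (fun p : Σ N : ℕ, Fin N → Fin 3 → ℤ =>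
      ‖fockCoeff L p (e.basis i)‖ ^ 2 *
        (β / 2 * kineticMul L p.1 p.2 + β / (2 * C) * (p.1 : ℝ) ^ 2 - β * a * p.1)) x := by
    intro i
    have hψ := hreg i
    rw [← Eigenbasis.re_expval i, hψ.re_expval h.pos]
    have hmom := (abs_le.1 (hψ.abs_momForm_le h.pos α one_half_pos)).2
    have hy := hψ.shiftForm_eq h.pos
    obtain ⟨k, hk⟩ := hψ.kin
    obtain ⟨b, hb⟩ := hψ.shift h.pos
    obtain ⟨d, hd⟩ := hψ.num
    -- The vector N²ψ exists because N² is dominated by the shifted interaction, on whose domain ψ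
    -- lies.
    obtain ⟨q, hq⟩ := hb.exists_of_le (u' := fun N _ => (N : ℝ) ^ 2)
      (fun N => aestronglyMeasurable_const) (fun N σ x => rfl) (C := C)
      fun N => Eventually.of_forall fun x => by
        rw [abs_of_nonneg (h.shiftedEnergy_nonneg N x), abs_of_nonneg (by positivity)]
        exact hle N x
    have hq' := (mMul_number_iff h.pos fun N => (N : ℝ) ^ 2).1 hq
    have hnn := ((hb.smul (1 / 2)).add (hq.smul (-(1 / (2 * C))))).re_inner_nonneg
      fun N => Eventually.of_forall fun x => by
        have h2 : 1 / (2 * C) * (N : ℝ) ^ 2 ≤ 1 / (2 * C) * (C * shiftedEnergy L W N x) :=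
          mul_le_mul_of_nonneg_left (hle N x) (by positivity)
        have h3 : 1 / (2 * C) * (C * shiftedEnergy L W N x) = 1 / 2 * shiftedEnergy L W N x := by
          field_simp
        linarith
    have hs := (((hk.smul (β / 2)).add (hq'.smul (β / (2 * C)))).add
      (hd.smul (-(β * a)))).hasSum_inner h.pos
    refine ⟨_, ?_, (hs.congr_fun fun p => by ring)⟩
    simp only [inner_add_right, inner_smul_right, Complex.add_re, Complex.re_ofReal_mul,
      ← hb.mForm_eq, ← hd.fForm_eq h.pos, ← hk.fForm_eq h.pos] at hnn ⊢
    have e1 : mForm L (shiftedEnergy L W) (e.basis i) = shiftForm L W (e.basis i) := rfl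
    have e2 : fForm L (fun N _ => (N : ℝ)) (e.basis i) = numForm L (e.basis i) := rfl
    have e3 : fForm L (kineticMul L) (e.basis i) = kinForm L (e.basis i) := rfl
    rw [e1] at hnn
    rw [e2, e3]
    norm_num at hmom
    have e4 : a * numForm L (e.basis i) =
      (W 0 / 2 + μ + ‖α‖ ^ 2) * numForm L (e.basis i) := by rw [ha]
    have h5 : kinForm L (e.basis i) / 2 + 1 / (2 * C) * (inner ℂ (e.basis i) q).re -
        a * numForm L (e.basis i) ≤ kinForm L (e.basis i) + pairForm L W (e.basis i) -
          momForm L α (e.basis i) - μ * numForm L (e.basis i) := by linarith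
    have h6 := mul_le_mul_of_nonneg_left h5 hβ.le
    refine le_trans (le_of_eq ?_) h6
    field_simp
    ring
  choose x hx hxs using hex
  -- The comparison operator is diagonal in plane waves of the whole N-body space, which need not be
  -- antisymmetric. The Bessel form of Peierls' inequality permits this; it only enlarges the upper
  -- bound.
  have hbound := sum_exp_neg_le_of_diag e.basis.orthonormal (fockCoeff L)
    (hasSum_norm_sq_fockCoeff h.pos) hsum hxs
  refine summable_of_sum_le (fun _ => (Real.exp_pos _).le) fun s =>
    le_trans (Finset.sum_le_sum fun i _ => Real.exp_le_exp.2 ?_) (hbound s)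
  linarith [hx i]

end

section

variable {L r : ℝ} {W : Space → ℝ}

/-! ### Scaling of the multipliers -/

/-- The boost momentum with index `n`. -/
def boostVec (L : ℝ) (n : Fin 3 → ℤ) : Space := WithLp.toLp 2 fun a => 2 * Real.pi / L * (n a : ℝ)

lemma boostVec_zero (L : ℝ) : boostVec L 0 = 0 := by
  ext a
  simp [boostVec]

lemma wavevec_dilate (r L : ℝ) {N : ℕ} (k : Fin N → Fin 3 → ℤ) (n : Fin 3 → ℤ)
    (j : Fin N) : wavevec (r * L) (fun j => k j + n) j = r⁻¹ • (wavevec L k j + boostVec L n) := by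
  ext a
  simp only [wavevec, boostVec, PiLp.smul_apply, PiLp.add_apply, smul_eq_mul, Pi.add_apply,
    Int.cast_add]
  rw [mul_comm r L, ← div_div]
  ring

lemma kineticMul_dilate (r L : ℝ) (N : ℕ) (k : Fin N → Fin 3 → ℤ) (n : Fin 3 → ℤ) :
    kineticMul (r * L) N (fun j => k j + n) =
      (r⁻¹) ^ 2 * kineticMul L N k + ((r⁻¹) ^ 2 * momentumMul L (boostVec L n) N k +
        (r⁻¹) ^ 2 * (‖boostVec L n‖ ^ 2 / 2) * N) := by
  have h1 : (N : ℝ) = ∑ _j : Fin N, (1 : ℝ) := by simp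
  rw [kineticMul, kineticMul, momentumMul, h1, Finset.mul_sum, Finset.mul_sum, Finset.mul_sum,
    ← Finset.sum_add_distrib, ← Finset.sum_add_distrib]
  refine Finset.sum_congr rfl fun j _ => ?_
  rw [wavevec_dilate, norm_smul, mul_pow, norm_add_sq_real, Real.norm_eq_abs, sq_abs,
    real_inner_comm]
  ring

lemma momentumMul_dilate (r L : ℝ) (α : Space) (N : ℕ) (k : Fin N → Fin 3 → ℤ)
    (n : Fin 3 → ℤ) : momentumMul (r * L) α N (fun j => k j + n) =
      r⁻¹ * momentumMul L α N k + r⁻¹ * inner ℝ α (boostVec L n) * N := by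
  have h1 : (N : ℝ) = ∑ _j : Fin N, (1 : ℝ) := by simp
  rw [momentumMul, momentumMul, h1, Finset.mul_sum, Finset.mul_sum, ← Finset.sum_add_distrib]
  refine Finset.sum_congr rfl fun j _ => ?_
  rw [wavevec_dilate, inner_smul_right, inner_add_right]
  ring

lemma pairEnergy_dilate (r L : ℝ) (U : Space → ℝ) (N : ℕ) (x : Conf N) :
    pairEnergy (r * L) U N (r • x) = pairEnergy L (fun z => U (r • z)) N x := by
  have h1 : ∀ z, periodise (r * L) U (r • z) = periodise L (fun z => U (r • z)) z := by
    intro z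
    refine tsum_congr fun n => congrArg U ?_
    ext a
    simp [mul_assoc]
  simp only [pairEnergy, Pi.smul_apply, ← smul_sub, h1]

lemma FMul.congr {m m' : ∀ N : ℕ, (Fin N → Fin 3 → ℤ) → ℝ} {ψ φ : Fock L} (h : FMul m ψ φ)
    (hm : ∀ N k, m N k = m' N k) : FMul m' ψ φ := fun N k => by rw [h N k, hm]

/-! ### Gibbs states on stable tori -/

lemma thermalMean_congr {F : Type} [NormedAddCommGroup F] [InnerProductSpace ℂ F]
    {A : F →ₗ.[ℂ] F} (β : ℝ) (h : Nonempty (Eigenbasis A)) {f g : F → ℝ}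
    (hfg : ∀ ψ ∈ A.domain, f ψ = g ψ) : thermalMean β h f = thermalMean β h g := by
  rw [thermalMean, thermalMean, weightedSum, weightedSum]
  congr 1
  exact tsum_congr fun i => by rw [hfg _ ((Classical.choice h).mem_domain i)]

namespace TorusStable

variable {β : ℝ} {α : Space} {μ : ℝ} (h : TorusStable W L)

/-- The Gibbs mean of a function of state vectors. -/
def mean (h : TorusStable W L) (β : ℝ) (α : Space) (μ : ℝ) (f : Fock L → ℝ) : ℝ :=
  thermalMean β (h.eigen α μ) f

include h

/-- Eigenvectors of the Hamiltonian are regular, so X matters only on regular vectors. In the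
applications these lie in its domain, and the default value of `expval` never enters. -/
lemma gibbs_eq {X : Fock L →ₗ.[ℂ] Fock L} {f : Fock L → ℝ}
    (hX : ∀ ψ : Fock L, Regular W ψ → expval X ψ = (f ψ : ℂ)) :
    gibbs W L β α μ X = (h.mean β α μ f : ℂ) := by
  rw [gibbs, heatTraceMul_eq β (h.eigen α μ) (f := f)
    (fun i => hX _ (.of_mem_domain h.pos ((Classical.choice (h.eigen α μ)).mem_domain i))),
    mean, thermalMean, partition]
  push_cast
  rfl

lemma gibbs_kinetic : gibbs W L β α μ (kinetic L) = (h.mean β α μ (kinForm L) : ℂ) := by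
  refine h.gibbs_eq fun ψ hψ => ?_
  obtain ⟨a, ha⟩ := hψ.kin
  rw [kinForm, ha.fForm_eq h.pos]
  exact expval_fourierMultiplier h.pos ha

lemma gibbs_number : gibbs W L β α μ (number L) = (h.mean β α μ (numForm L) : ℂ) := by
  refine h.gibbs_eq fun ψ hψ => ?_
  obtain ⟨a, ha⟩ := hψ.num
  rw [numForm, ha.fForm_eq h.pos]
  exact expval_multiplication ((mMul_number_iff h.pos fun N => (N : ℝ)).2 ha)

lemma gibbs_interaction {U : Space → ℝ} {C : ℝ} (hU : Dominated W L U C) :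
    gibbs W L β α μ (interaction L U) = (h.mean β α μ (pairForm L U) : ℂ) := by
  refine h.gibbs_eq fun ψ hψ => ?_
  obtain ⟨a, ha⟩ := hU.exists_mMul h hψ
  rw [pairForm, ha.mForm_eq]
  exact expval_multiplication ha

/-- The three forms on the right are controlled by the energy through `TorusStable.energy_ge`; the
factor 4 undoes its smallest coefficient, 1/4. -/
lemma summable_of_abs_le (hβ : 0 < β) {f : Fock L → ℝ} {C : ℝ}
    (hf : ∀ ψ : Fock L, Regular W ψ → |f ψ| ≤ C * (kinForm L ψ + shiftForm L W ψ + numForm L ψ)) :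
    WeightedSummable β (h.eigen α μ) f := by
  obtain ⟨c, hc⟩ := h.energy_ge α μ
  refine weightedSummable_of_le hβ (h.hasFiniteTrace α μ) (C := 4 * |C|) (C' := 4 * |C| * c)
    fun ψ hd h1 => ?_
  have hψ : Regular W ψ := .of_mem_domain h.pos hd
  have h2 := hc ψ hψ h1
  have h3 := hψ.kinForm_nonneg h.pos
  have h4 := h.shiftForm_nonneg hψ
  have h5 := hψ.numForm_nonneg h.pos
  refine (hf ψ hψ).trans ((mul_le_mul_of_nonneg_right (le_abs_self C) (by positivity)).trans ?_)
  have h6 : kinForm L ψ + shiftForm L W ψ + numForm L ψ ≤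
      4 * ((expval (hamiltonian W L α μ) ψ).re + c) := by linarith
  have := mul_le_mul_of_nonneg_left h6 (abs_nonneg C)
  linarith

lemma summable_kin (hβ : 0 < β) : WeightedSummable β (h.eigen α μ) (kinForm L) :=
  h.summable_of_abs_le hβ (C := 1) fun ψ hψ => by
    rw [abs_of_nonneg (hψ.kinForm_nonneg h.pos)]
    linarith [h.shiftForm_nonneg hψ, hψ.numForm_nonneg h.pos]

lemma summable_num (hβ : 0 < β) : WeightedSummable β (h.eigen α μ) (numForm L) :=
  h.summable_of_abs_le hβ (C := 1) fun ψ hψ => by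
    rw [abs_of_nonneg (hψ.numForm_nonneg h.pos)]
    linarith [h.shiftForm_nonneg hψ, hψ.kinForm_nonneg h.pos]

lemma summable_shift (hβ : 0 < β) : WeightedSummable β (h.eigen α μ) (shiftForm L W) :=
  h.summable_of_abs_le hβ (C := 1) fun ψ hψ => by
    rw [abs_of_nonneg (h.shiftForm_nonneg hψ)]
    linarith [hψ.numForm_nonneg h.pos, hψ.kinForm_nonneg h.pos]

lemma summable_mom (hβ : 0 < β) (a : Space) :
    WeightedSummable β (h.eigen α μ) (momForm L a) :=
  h.summable_of_abs_le hβ (C := 1 + ‖a‖ ^ 2 / 2) fun ψ hψ => by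
    have h1 := hψ.abs_momForm_le h.pos a one_pos
    have h3 := hψ.kinForm_nonneg h.pos
    have h4 := h.shiftForm_nonneg hψ
    have h5 := hψ.numForm_nonneg h.pos
    have h6 : 0 ≤ ‖a‖ ^ 2 / 2 * (kinForm L ψ + shiftForm L W ψ) := by positivity
    rw [mul_one] at h1
    linarith

lemma summable_pair (hβ : 0 < β) {U : Space → ℝ} {C : ℝ} (hU : Dominated W L U C) :
    WeightedSummable β (h.eigen α μ) (pairForm L U) :=
  h.summable_of_abs_le hβ (C := |C|) fun ψ hψ => by
    have h3 := hψ.kinForm_nonneg h.pos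
    have h4 := h.shiftForm_nonneg hψ
    have h5 := hψ.numForm_nonneg h.pos
    refine (hU.abs_pairForm_le h hψ).trans
      ((mul_le_mul_of_nonneg_right (le_abs_self C) h4).trans ?_)
    exact mul_le_mul_of_nonneg_left (by linarith) (abs_nonneg C)

lemma mean_mono (hβ : 0 < β) {f g : Fock L → ℝ} (hf : WeightedSummable β (h.eigen α μ) f)
    (hg : WeightedSummable β (h.eigen α μ) g) (hfg : ∀ ψ : Fock L, Regular W ψ → f ψ ≤ g ψ) :
    h.mean β α μ f ≤ h.mean β α μ g := by
  have := nontrivial_fock h.pos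
  exact thermalMean_mono hβ (h.hasFiniteTrace α μ) hf hg
    fun ψ hd _ => hfg ψ (.of_mem_domain h.pos hd)

lemma mean_nonneg {f : Fock L → ℝ} (hf : ∀ ψ : Fock L, Regular W ψ → 0 ≤ f ψ) :
    0 ≤ h.mean β α μ f := by
  refine div_nonneg (tsum_nonneg fun i => mul_nonneg (Real.exp_pos _).le
    (hf _ (.of_mem_domain h.pos ((Classical.choice (h.eigen α μ)).mem_domain i)))) ?_
  rw [heatTrace_eq β (h.eigen α μ)]
  exact tsum_nonneg fun _ => (Real.exp_pos _).le

lemma mean_kin_nonneg : 0 ≤ h.mean β α μ (kinForm L) :=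
  h.mean_nonneg fun _ hψ => hψ.kinForm_nonneg h.pos

lemma mean_num_nonneg : 0 ≤ h.mean β α μ (numForm L) :=
  h.mean_nonneg fun _ hψ => hψ.numForm_nonneg h.pos

lemma mean_shift_nonneg : 0 ≤ h.mean β α μ (shiftForm L W) :=
  h.mean_nonneg fun _ hψ => h.shiftForm_nonneg hψ

lemma mean_add {f g : Fock L → ℝ} (hf : WeightedSummable β (h.eigen α μ) f)
    (hg : WeightedSummable β (h.eigen α μ) g) :
    h.mean β α μ (fun ψ => f ψ + g ψ) = h.mean β α μ f + h.mean β α μ g :=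
  thermalMean_add hf hg

lemma mean_mul_left (c : ℝ) (f : Fock L → ℝ) :
    h.mean β α μ (fun ψ => c * f ψ) = c * h.mean β α μ f :=
  thermalMean_mul_left β _ c f

lemma mean_congr {f g : Fock L → ℝ} (hfg : ∀ ψ : Fock L, Regular W ψ → f ψ = g ψ) :
    h.mean β α μ f = h.mean β α μ g :=
  thermalMean_congr β _ fun ψ hd => hfg ψ (.of_mem_domain h.pos hd)

lemma mean_mom_add (hβ : 0 < β) (a b : Space) :
    h.mean β α μ (momForm L (a + b)) = h.mean β α μ (momForm L a) + h.mean β α μ (momForm L b) := by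
  rw [← h.mean_add (h.summable_mom hβ a) (h.summable_mom hβ b)]
  exact h.mean_congr fun ψ hψ => hψ.momForm_add h.pos a b

lemma mean_mom_smul (c : ℝ) (a : Space) :
    h.mean β α μ (momForm L (c • a)) = c * h.mean β α μ (momForm L a) := by
  rw [← h.mean_mul_left]
  exact h.mean_congr fun ψ hψ => hψ.momForm_smul h.pos c a

lemma mean_pair_eq (hβ : 0 < β) : h.mean β α μ (pairForm L W) =
    1 / 2 * h.mean β α μ (shiftForm L W) + -(W 0 / 2) * h.mean β α μ (numForm L) := by
  rw [← h.mean_mul_left, ← h.mean_mul_left,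
    ← h.mean_add ((h.summable_shift hβ).mul_left _) ((h.summable_num hβ).mul_left _)]
  refine h.mean_congr fun ψ hψ => ?_
  rw [hψ.shiftForm_eq h.pos]
  ring

lemma abs_mean_mom_le (hβ : 0 < β) (a : Space) : |h.mean β α μ (momForm L a)| ≤
    h.mean β α μ (kinForm L) + ‖a‖ ^ 2 / 2 * h.mean β α μ (numForm L) := by
  have hs := (h.summable_kin (α := α) (μ := μ) hβ).add ((h.summable_num hβ).mul_left (‖a‖ ^ 2 / 2))
  have hm := h.summable_mom (α := α) (μ := μ) hβ a
  have key : ∀ ψ : Fock L, Regular W ψ →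
      |momForm L a ψ| ≤ kinForm L ψ + ‖a‖ ^ 2 / 2 * numForm L ψ := fun ψ hψ => by
    simpa using hψ.abs_momForm_le h.pos a one_pos
  rw [← h.mean_mul_left, ← h.mean_add (h.summable_kin hβ) ((h.summable_num hβ).mul_left _), abs_le]
  constructor
  · have := h.mean_mono hβ (hs.mul_left (-1)) hm fun ψ hψ => by
      linarith [(abs_le.1 (key ψ hψ)).1]
    rw [h.mean_mul_left] at this
    linarith
  · exact h.mean_mono hβ hm hs fun ψ hψ => (abs_le.1 (key ψ hψ)).2

lemma mean_energy (hβ : 0 < β) :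
    h.mean β α μ (fun ψ => (expval (hamiltonian W L α μ) ψ).re) =
      h.mean β α μ (kinForm L) + h.mean β α μ (pairForm L W) - h.mean β α μ (momForm L α) -
        μ * h.mean β α μ (numForm L) := by
  obtain ⟨C, hC⟩ := h.dominated_self
  have h1 := h.summable_kin (α := α) (μ := μ) hβ
  have h2 := h.summable_pair (α := α) (μ := μ) hβ hC
  have h3 := (h.summable_mom (α := α) (μ := μ) hβ α).mul_left (-1)
  have h4 := (h.summable_num (α := α) (μ := μ) hβ).mul_left (-μ)
  rw [h.mean_congr (g := fun ψ => kinForm L ψ + (pairForm L W ψ + (-1 * momForm L α ψ +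
      -μ * numForm L ψ))) fun ψ hψ => by rw [hψ.re_expval h.pos]; ring,
    h.mean_add h1 (h2.add (h3.add h4)), h.mean_add h2 (h3.add h4), h.mean_add h3 h4,
    h.mean_mul_left, h.mean_mul_left]
  ring

/-- The Peierls-Bogoliubov inequality between tori related by a dilation and a boost. -/
lemma log_partition_ge (hr : 0 < r) (h' : TorusStable W (r * L)) (hβ : 0 < β) {β' : ℝ}
    (hβ' : 0 < β') (μ' : ℝ) (n : Fin 3 → ℤ) {C : ℝ}
    (hd : Dominated W L (fun z => W (r • z)) C) :
    Real.log (partition W L β α μ) -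
        (β' * ((r⁻¹) ^ 2 * (h.mean β α μ (kinForm L) + h.mean β α μ (momForm L (boostVec L n)) +
            ‖boostVec L n‖ ^ 2 / 2 * h.mean β α μ (numForm L)) +
          h.mean β α μ (pairForm L fun z => W (r • z)) -
          r⁻¹ * (h.mean β α μ (momForm L α) +
            inner ℝ α (boostVec L n) * h.mean β α μ (numForm L)) -
          μ' * h.mean β α μ (numForm L)) -
        β * (h.mean β α μ (kinForm L) + h.mean β α μ (pairForm L W) - h.mean β α μ (momForm L α) -
          μ * h.mean β α μ (numForm L))) ≤
      Real.log (partition W (r * L) β' α μ') := by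
  obtain ⟨U, hU, hUF, hUM⟩ := exists_dilation (L := L) hr n
  set q := boostVec L n with hq
  -- The number form collects the kinetic energy of the boost, its contribution to α·P, and the
  -- chemical potential.
  set c := (r⁻¹) ^ 2 * (‖q‖ ^ 2 / 2) - r⁻¹ * inner ℝ α q - μ' with hc
  have h1 := (h.summable_kin (α := α) (μ := μ) hβ).mul_left ((r⁻¹) ^ 2)
  have h2 := (h.summable_mom (α := α) (μ := μ) hβ q).mul_left ((r⁻¹) ^ 2)
  have h3 := h.summable_pair (α := α) (μ := μ) hβ hd
  have h4 := (h.summable_mom (α := α) (μ := μ) hβ α).mul_left (-r⁻¹)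
  have h5 := (h.summable_num (α := α) (μ := μ) hβ).mul_left c
  have hg := h1.add (h2.add (h3.add (h4.add h5)))
  have := nontrivial_fock h.pos
  have key := log_heatTrace_ge hβ hβ' (h'.eigen α μ') (h.hasFiniteTrace α μ)
    (h'.hasFiniteTrace α μ') (isSymm_hamiltonian h'.pos W α μ') hU (fun ψ hψd => by
      have hψ : Regular W ψ := .of_mem_domain h.pos hψd
      obtain ⟨a, ha⟩ := hψ.kin
      obtain ⟨b, hb⟩ := hd.exists_mMul h hψ
      obtain ⟨m, hm⟩ := hψ.mom h.pos q
      obtain ⟨m', hm'⟩ := hψ.mom h.pos α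
      obtain ⟨d, hd⟩ := hψ.num
      have g1 := ((ha.smul ((r⁻¹) ^ 2)).add ((hm.smul ((r⁻¹) ^ 2)).add
        (hd.smul ((r⁻¹) ^ 2 * (‖q‖ ^ 2 / 2))))).congr
          (m' := fun N k => kineticMul (r * L) N fun j => k j + n)
          fun N k => (kineticMul_dilate r L N k n).symm
      have g2 := ((hm'.smul r⁻¹).add (hd.smul (r⁻¹ * inner ℝ α q))).congr
          (m' := fun N k => momentumMul (r * L) α N fun j => k j + n)
          fun N k => (momentumMul_dilate r L α N k n).symm
      have g3 : MMul (fun N x => pairEnergy (r * L) W N (r • x)) ψ b := by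
        simp only [pairEnergy_dilate]
        exact hb
      have f1 := hUF _ _ _ g1
      have f2 := hUF _ _ _ g2
      have f3 := hUM _ _ _ g3
      have f4 := hUF (fun N _ => (N : ℝ)) _ _ hd
      have hreg : Regular W (U ψ) := ⟨⟨_, f1⟩, ⟨_, f3⟩, ⟨_, f4⟩⟩
      obtain ⟨hd', he⟩ := hreg.energy h'.pos α μ'
      refine ⟨hd', he.trans ?_⟩
      rw [kinForm, pairForm, momForm, numForm, f1.fForm_eq h'.pos, f2.fForm_eq h'.pos,
        f3.mForm_eq, f4.fForm_eq h'.pos, hU, hU, hU, hU, kinForm, momForm, pairForm, momForm,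
        numForm, ha.fForm_eq h.pos, hm.fForm_eq h.pos, hm'.fForm_eq h.pos, hd.fForm_eq h.pos,
        hb.mForm_eq]
      simp only [inner_add_right, inner_smul_right, Complex.add_re, Complex.re_ofReal_mul]
      rw [hc]
      ring) hg
  have e1 : thermalMean β (h.eigen α μ) _ = _ :=
    h.mean_add h1 (h2.add (h3.add (h4.add h5)))
  rw [e1, h.mean_add h2 (h3.add (h4.add h5)), h.mean_add h3 (h4.add h5), h.mean_add h4 h5,
    h.mean_mul_left, h.mean_mul_left, h.mean_mul_left, h.mean_mul_left] at key
  have e2 : thermalMean β (h.eigen α μ) _ = _ := h.mean_energy (α := α) (μ := μ) hβ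
  rw [e2] at key
  refine le_trans (le_of_eq ?_) key
  rw [partition, hc]
  ring

end TorusStable

end

section

variable {L R : ℝ} {W : Space → ℝ}

/-! ### The virial as a derivative under dilations -/

/-- The virial function of a pair potential. -/
def virialFun (W : Space → ℝ) (z : Space) : ℝ := inner ℝ (gradient W z) z

lemma virialFun_eq (W : Space → ℝ) (z : Space) : virialFun W z = fderiv ℝ W z z := by
  rw [virialFun, gradient, InnerProductSpace.toDual_symm_apply]

lemma continuous_virialFun (hW : ContDiff ℝ 1 W) : Continuous (virialFun W) := by
  have h : virialFun W = fun z => fderiv ℝ W z z := funext (virialFun_eq W)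
  rw [h]
  exact (hW.continuous_fderiv one_ne_zero).clm_apply continuous_id

lemma virialFun_eq_zero (hsupp : ∀ z, R < ‖z‖ → W z = 0) {z : Space} (hz : R < ‖z‖) :
    virialFun W z = 0 := by
  have h : W =ᶠ[𝓝 z] fun _ => 0 := by
    filter_upwards [(isOpen_lt continuous_const continuous_norm).mem_nhds hz] with y hy
    exact hsupp y hy
  rw [virialFun_eq, h.fderiv_eq]
  simp

lemma exists_bound_of_range {U : Space → ℝ} (hU : Continuous U) (hsupp : ∀ z, R < ‖z‖ → U z = 0) :
    ∃ B, 0 ≤ B ∧ ∀ z, |U z| ≤ B := by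
  obtain ⟨B, hB⟩ := (isCompact_closedBall (0 : Space) R).exists_bound_of_continuousOn
    hU.continuousOn
  refine ⟨max B 0, le_max_right _ _, fun z => ?_⟩
  rcases le_or_gt ‖z‖ R with hz | hz
  · exact (hB z (mem_closedBall_zero_iff.2 hz)).trans (le_max_left _ _)
  · rw [hsupp z hz]
    simp

/-- A dilation changes the potential by the virial to first order, uniformly. -/
lemma exists_dilation_estimate (hW : ContDiff ℝ 1 W) (hc : HasCompactSupport W) (hR : 0 < R)
    (hsupp : ∀ z, R < ‖z‖ → W z = 0) {η : ℝ} (hη : 0 < η) :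
    ∃ δ, 0 < δ ∧ δ ≤ 1 / 2 ∧ ∀ r, |r - 1| ≤ δ → ∀ z,
      |W (r • z) - W z - (r - 1) * virialFun W z| ≤ η * |r - 1| := by
  have huc : UniformContinuous (fderiv ℝ W) :=
    (hc.fderiv ℝ).uniformContinuous_of_continuous (hW.continuous_fderiv one_ne_zero)
  obtain ⟨ρ, hρ, hρW⟩ := Metric.uniformContinuous_iff.1 huc (η / (2 * R)) (by positivity)
  refine ⟨min (1 / 2) (ρ / (4 * R)), by positivity, min_le_left _ _, fun r hr z => ?_⟩
  have hr1 := hr.trans (min_le_left _ _)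
  have hr2 := hr.trans (min_le_right _ _)
  -- For ‖z‖ ≤ 2R the mean value inequality applies on the ball of radius |r-1|‖z‖ about z, where
  -- the derivative varies by at most η/(2R). Beyond 2R every term vanishes, because r ≥ 1/2 keeps r
  -- • z outside the range R.
  rcases le_or_gt ‖z‖ (2 * R) with hz | hz
  · have hball : ∀ y ∈ Metric.closedBall z (|r - 1| * ‖z‖),
        ‖fderiv ℝ W y - fderiv ℝ W z‖ ≤ η / (2 * R) := by
      intro y hy
      rw [← dist_eq_norm]
      refine (hρW (lt_of_le_of_lt (Metric.mem_closedBall.1 hy) ?_)).le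
      calc |r - 1| * ‖z‖ ≤ ρ / (4 * R) * (2 * R) := by gcongr
        _ < ρ := by field_simp; linarith
    have e : r • z - z = (r - 1) • z := by rw [sub_smul, one_smul]
    have hmv := (convex_closedBall z (|r - 1| * ‖z‖)).norm_image_sub_le_of_norm_fderiv_le'
      (𝕜 := ℝ) (f := W) (φ := fderiv ℝ W z) (C := η / (2 * R)) (y := r • z) (x := z)
      (fun y _ => (hW.differentiable one_ne_zero) y) hball
      (Metric.mem_closedBall_self (by positivity)) (by
        rw [Metric.mem_closedBall, dist_eq_norm, e, norm_smul, Real.norm_eq_abs])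
    rw [e, map_smul, smul_eq_mul, ← virialFun_eq, norm_smul, Real.norm_eq_abs,
      Real.norm_eq_abs] at hmv
    refine hmv.trans ?_
    calc η / (2 * R) * (|r - 1| * ‖z‖) ≤ η / (2 * R) * (|r - 1| * (2 * R)) := by gcongr
      _ = η * |r - 1| := by field_simp
  · have h1 : R < ‖z‖ := by linarith
    have h2 : R < ‖r • z‖ := by
      rw [norm_smul, Real.norm_eq_abs]
      have : 1 / 2 ≤ |r| := by
        have := (abs_le.1 hr1).1
        exact le_trans (by linarith) (le_abs_self r)
      nlinarith
    rw [hsupp _ h2, hsupp _ h1, virialFun_eq_zero hsupp h1]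
    simp only [sub_zero, mul_zero, abs_zero]
    positivity

lemma MMul.congr {u u' : ∀ N : ℕ, Conf N → ℝ} {ψ φ : Fock L} (h : MMul u ψ φ)
    (hu : ∀ N x, u N x = u' N x) : MMul u' ψ φ := fun N => by
  simp only [← hu]
  exact h N

lemma pairEnergy_add_mul (hL : 0 < L) (hR : 2 * R < L) {U U' : Space → ℝ}
    (hU : ∀ z, R < ‖z‖ → U z = 0) (hU' : ∀ z, R < ‖z‖ → U' z = 0) (c : ℝ) (N : ℕ) (x : Conf N) :
    pairEnergy L (fun z => U z + c * U' z) N x = pairEnergy L U N x + c * pairEnergy L U' N x := by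
  have hs : ∀ z, R < ‖z‖ → U z + c * U' z = 0 := fun z hz => by rw [hU z hz, hU' z hz]; simp
  have h1 : ∀ z, periodise L (fun z => U z + c * U' z) z = periodise L U z + c * periodise L U' z := by
    intro z
    by_cases hn : Near L R z
    · obtain ⟨n, hn⟩ := hn
      rw [periodise_eq hL hR hs hn, periodise_eq hL hR hU hn, periodise_eq hL hR hU' hn]
    · rw [periodise_eq_zero hs hn, periodise_eq_zero hU hn, periodise_eq_zero hU' hn]
      simp
  simp only [pairEnergy, h1, Finset.sum_add_distrib, ← Finset.mul_sum]
  ring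

/-- Superstability in the form in which it is used: all large tori are stable and all bounded
interactions of fixed range are uniformly dominated. -/
lemma AdmissiblePotential.exists_uniform (hW : AdmissiblePotential W) :
    ∃ R C L₁, 0 < R ∧ 0 ≤ C ∧ 0 < L₁ ∧ (∀ z, R < ‖z‖ → W z = 0) ∧
      ∀ L, L₁ ≤ L → 2 * (2 * R) < L ∧ TorusStable W L ∧ ∀ (U : Space → ℝ) (B : ℝ),
        Measurable U → (∀ z, 2 * R < ‖z‖ → U z = 0) → (∀ z, |U z| ≤ B) →
          Dominated W L U (B * C) := by
  obtain ⟨R, hR, hsupp⟩ := exists_range hW.compactSupport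
  obtain ⟨L₀, hL₀, h1, h2⟩ := hW.superstability
  -- Range 2R leaves room for the dilated potentials W(r ·) with r ≥ 1/2. The constant C/2 announced
  -- below contains the factor 1/2 of the pair energy.
  obtain ⟨C, hC, h3⟩ := h1 (2 * R)
  obtain ⟨B, hB0, hB⟩ := exists_bound_of_range hW.contDiff.continuous hsupp
  refine ⟨R, C / 2, max L₀ (4 * R + 1), hR, by positivity, lt_max_of_lt_left hL₀, hsupp,
    fun L hL => ?_⟩
  have hL0 := (le_max_left _ _).trans hL
  have hL1 : 2 * (2 * R) < L := by linarith [(le_max_right L₀ (4 * R + 1)).trans hL]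
  have hpos : 0 < L := hL₀.trans_le hL0
  refine ⟨hL1, ⟨hpos, hW.contDiff.continuous.measurable, fun N => ?_, ?_⟩,
    fun U B hm hs hb => ⟨hm, fun N x => ?_⟩⟩
  · refine ⟨B / 2 * (N : ℝ) ^ 2, fun x => ?_⟩
    refine (abs_pairEnergy_le hpos (R := R) (by linarith) hsupp hB N x).trans ?_
    exact mul_le_mul_of_nonneg_left (pairCount_le L R N x) (by positivity)
  · obtain ⟨C', hC', h4⟩ := h2 L hL0
    -- `TorusStable` asks for a positive constant. Enlarging it requires a non-negative shifted
    -- energy, which follows from the bound itself when N > 0 and is trivial for N = 0.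
    refine ⟨C' + 1, by positivity, fun N x => ?_⟩
    have h5 := h4 N x
    rcases Nat.eq_zero_or_pos N with rfl | hN
    · simp [shiftedEnergy, pairEnergy]
    · have h6 : 0 < (N : ℝ) ^ 2 := by positivity
      have h7 : 0 ≤ shiftedEnergy L W N x := by
        by_contra h8
        nlinarith
      linarith
  · have h4 := abs_pairEnergy_le hpos hL1 hs hb N x
    have hB' : 0 ≤ B := (abs_nonneg _).trans (hb 0)
    refine h4.trans (le_trans (mul_le_mul_of_nonneg_left (h3 L hL0 N x) (by positivity))
      (le_of_eq (by ring)))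

namespace TorusStable

variable {β : ℝ} {α : Space} {μ : ℝ} (h : TorusStable W L)
include h

/-- First-order expansion of the mean interaction under dilations. -/
lemma abs_mean_dilation_le (hβ : 0 < β) (hL : 2 * (2 * R) < L) (hR : 0 < R) {C B C' r η : ℝ}
    (hsupp : ∀ z, R < ‖z‖ → W z = 0)
    (hdom : ∀ (U : Space → ℝ) (B : ℝ), Measurable U → (∀ z, 2 * R < ‖z‖ → U z = 0) →
      (∀ z, |U z| ≤ B) → Dominated W L U (B * C))
    (hv : Dominated W L (virialFun W) B) (hr : Dominated W L (fun z => W (r • z)) C')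
    (hr1 : |r - 1| ≤ 1 / 2)
    (hη : ∀ z, |W (r • z) - W z - (r - 1) * virialFun W z| ≤ η * |r - 1|) :
    |h.mean β α μ (pairForm L fun z => W (r • z)) - h.mean β α μ (pairForm L W) -
      (r - 1) * h.mean β α μ (pairForm L (virialFun W))| ≤
        η * |r - 1| * C * h.mean β α μ (shiftForm L W) := by
  obtain ⟨C₀, hself⟩ := h.dominated_self
  set U : Space → ℝ := fun z => W (r • z) - W z - (r - 1) * virialFun W z with hUdef
  have hs1 : ∀ z, 2 * R < ‖z‖ → W z = 0 := fun z hz => hsupp z (by linarith)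
  have hs2 : ∀ z, 2 * R < ‖z‖ → virialFun W z = 0 := fun z hz =>
    virialFun_eq_zero hsupp (by linarith)
  have hs3 : ∀ z, 2 * R < ‖z‖ → W (r • z) = 0 := fun z hz => by
    refine hsupp _ ?_
    rw [norm_smul, Real.norm_eq_abs]
    have : 1 / 2 ≤ |r| := by
      have := (abs_le.1 hr1).1
      exact le_trans (by linarith) (le_abs_self r)
    nlinarith
  have hUs : ∀ z, 2 * R < ‖z‖ → U z = 0 := fun z hz => by
    simp only [hUdef]
    rw [hs1 z hz, hs2 z hz, hs3 z hz]
    simp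
  have hUm : Measurable U := (hr.meas.sub h.meas).sub (hv.meas.const_mul _)
  -- The remainder is at most η|r-1| in size and has range 2R, so superstability bounds its
  -- interaction by that small factor, with C independent of the remainder.
  have hU : Dominated W L U (η * |r - 1| * C) := hdom U _ hUm hUs hη
  have hpair : ∀ ψ : Fock L, Regular W ψ → pairForm L U ψ =
      pairForm L (fun z => W (r • z)) ψ + (-1 * pairForm L W ψ +
        -(r - 1) * pairForm L (virialFun W) ψ) := by
    intro ψ hψ
    obtain ⟨a, ha⟩ := hr.exists_mMul h hψ
    obtain ⟨b, hb⟩ := hψ.pot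
    obtain ⟨c, hc⟩ := hv.exists_mMul h hψ
    have he : ∀ N x, pairEnergy L (fun z => W (r • z)) N x +
        (-1 * pairEnergy L W N x + -(r - 1) * pairEnergy L (virialFun W) N x) =
          pairEnergy L U N x := by
      intro N x
      have hs4 : ∀ z, 2 * R < ‖z‖ → W (r • z) + -1 * W z = 0 := fun z hz => by
        rw [hs1 z hz, hs3 z hz]; simp
      have e1 : U = fun z => (W (r • z) + -1 * W z) + -(r - 1) * virialFun W z := by
        funext z
        simp only [hUdef]
        ring
      rw [e1, pairEnergy_add_mul h.pos hL hs4 hs2, pairEnergy_add_mul h.pos hL hs3 hs1]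
      ring
    have hsum := (ha.add ((hb.smul (-1)).add (hc.smul (-(r - 1))))).congr he
    rw [pairForm, hsum.mForm_eq, pairForm, pairForm, pairForm, ha.mForm_eq, hb.mForm_eq,
      hc.mForm_eq]
    simp only [inner_add_right, inner_smul_right, Complex.add_re, Complex.re_ofReal_mul]
  have h1 := h.summable_pair (α := α) (μ := μ) hβ hr
  have h2 := (h.summable_pair (α := α) (μ := μ) hβ hself).mul_left (-1)
  have h3 := (h.summable_pair (α := α) (μ := μ) hβ hv).mul_left (-(r - 1))
  have hmean : h.mean β α μ (pairForm L U) = h.mean β α μ (pairForm L fun z => W (r • z)) -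
      h.mean β α μ (pairForm L W) - (r - 1) * h.mean β α μ (pairForm L (virialFun W)) := by
    rw [h.mean_congr hpair, h.mean_add h1 (h2.add h3), h.mean_add h2 h3, h.mean_mul_left,
      h.mean_mul_left]
    ring
  rw [← hmean, ← h.mean_mul_left, abs_le]
  have hs := (h.summable_shift (α := α) (μ := μ) hβ).mul_left (η * |r - 1| * C)
  have hp := h.summable_pair (α := α) (μ := μ) hβ hU
  constructor
  · have := h.mean_mono hβ (hs.mul_left (-1)) hp fun ψ hψ => by
      linarith [(abs_le.1 (hU.abs_pairForm_le h hψ)).1]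
    rw [h.mean_mul_left] at this
    linarith
  · exact h.mean_mono hβ hp hs fun ψ hψ => (abs_le.1 (hU.abs_pairForm_le h hψ)).2

end TorusStable

end

/-! ### Limits of slopes, boosts and a priori bounds -/

section

variable {L : ℝ} {W : Space → ℝ}

/-- A sequence of slopes of functions converging to a differentiable function converges to the
derivative. -/
lemma tendsto_of_slope {f : ℝ → ℝ → ℝ} {F : ℝ → ℝ} {F' : ℝ} {a : ℝ → ℝ}
    (hF : HasDerivAt F F' 0) (hf : ∀ᶠ ε in 𝓝 0, Tendsto (f ε) atTop (𝓝 (F ε)))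
    (h : ∀ t > 0, ∀ᶠ ε in 𝓝 0, ∀ᶠ L in atTop, ε * a L - |ε| * t ≤ f ε L - f 0 L) :
    Tendsto a atTop (𝓝 F') := by
  rw [Metric.tendsto_atTop']
  suffices hs : ∀ t > 0, ∀ᶠ L in atTop, |a L - F'| ≤ 4 * t by
    intro t ht
    obtain ⟨M, hM⟩ := eventually_atTop.1 (hs (t / 8) (by positivity))
    refine ⟨M, fun L hL => ?_⟩
    rw [Real.dist_eq]
    have := hM L hL.le
    linarith
  intro t ht
  have h0 := hf.self_of_nhds
  have h1 := hF.isLittleO.def ht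
  -- The hypothesis is used only at ε = δ/2 and ε = -δ/2: the positive one bounds `a` from above,
  -- the negative one from below. After division by |ε|, the slack, the derivative error and the two
  -- limits at ε and 0 each cost t, which makes 4t.
  obtain ⟨δ, hδ, hball⟩ := Metric.eventually_nhds_iff_ball.1 ((h1.and hf).and (h t ht))
  have hp : δ / 2 ∈ Metric.ball (0 : ℝ) δ := by
    rw [mem_ball_zero_iff, Real.norm_eq_abs, abs_of_pos (by positivity)]
    linarith
  have hn : -(δ / 2) ∈ Metric.ball (0 : ℝ) δ := by
    rw [mem_ball_zero_iff, norm_neg, ← mem_ball_zero_iff]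
    exact hp
  obtain ⟨⟨p1, p2⟩, p3⟩ := hball _ hp
  obtain ⟨⟨n1, n2⟩, n3⟩ := hball _ hn
  have hε : 0 < δ / 2 := by positivity
  set ε := δ / 2
  have hclose : ∀ {g : ℝ → ℝ} {x : ℝ}, Tendsto g atTop (𝓝 x) → ∀ᶠ L in atTop, |g L - x| < t * ε :=
    fun hg => by
      filter_upwards [Metric.tendsto_nhds.1 hg (t * ε) (by positivity)] with L hL
      rwa [← Real.dist_eq]
  filter_upwards [hclose h0, hclose p2, hclose n2, p3, n3] with L c0 cp cn q3 m3
  simp only [sub_zero, smul_eq_mul, Real.norm_eq_abs, abs_neg] at p1 n1 q3 m3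
  rw [abs_of_pos hε] at p1 n1 q3 m3
  rw [abs_le] at p1 n1
  rw [abs_lt] at c0 cp cn
  rw [abs_le]
  constructor
  · have : ε * (F' - a L) ≤ ε * (4 * t) := by linarith
    have := le_of_mul_le_mul_left this hε
    linarith
  · have : ε * (a L - F') ≤ ε * (4 * t) := by linarith
    have := le_of_mul_le_mul_left this hε
    linarith

namespace TorusStable

variable {β : ℝ} {α : Space} {μ : ℝ} (h : TorusStable W L)
include h

lemma mean_mom_zero : h.mean β α μ (momForm L 0) = 0 := by
  have := h.mean_mom_smul (β := β) (α := α) (μ := μ) 0 0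
  simpa using this

lemma log_partition_ge_boost (hβ : 0 < β) {β' : ℝ} (hβ' : 0 < β') (μ' : ℝ) (n : Fin 3 → ℤ) :
    Real.log (partition W L β α μ) -
        (β' * (h.mean β α μ (kinForm L) + h.mean β α μ (momForm L (boostVec L n)) +
            ‖boostVec L n‖ ^ 2 / 2 * h.mean β α μ (numForm L) +
          h.mean β α μ (pairForm L W) -
          (h.mean β α μ (momForm L α) +
            inner ℝ α (boostVec L n) * h.mean β α μ (numForm L)) -
          μ' * h.mean β α μ (numForm L)) -
        β * (h.mean β α μ (kinForm L) + h.mean β α μ (pairForm L W) - h.mean β α μ (momForm L α) -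
          μ * h.mean β α μ (numForm L))) ≤
      Real.log (partition W L β' α μ') := by
  obtain ⟨C, hC⟩ := h.dominated_self
  have := h.log_partition_ge (α := α) (μ := μ) one_pos (by rwa [one_mul]) hβ hβ' μ' n (C := C)
    (by simpa only [one_smul] using hC)
  simpa only [one_smul, inv_one, one_pow, one_mul] using this

lemma log_partition_chemical (hβ : 0 < β) (s : ℝ) :
    Real.log (partition W L β α μ) + β * s * h.mean β α μ (numForm L) ≤
      Real.log (partition W L β α (μ + s)) := by
  have := h.log_partition_ge_boost (α := α) (μ := μ) hβ hβ (μ + s) 0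
  rw [boostVec_zero, h.mean_mom_zero, norm_zero, inner_zero_right] at this
  linarith

lemma log_partition_temperature (hβ : 0 < β) {d : ℝ} (hd : d < β) :
    Real.log (partition W L β α μ) + d * (h.mean β α μ (kinForm L) + h.mean β α μ (pairForm L W) -
      h.mean β α μ (momForm L α) - μ * h.mean β α μ (numForm L)) ≤
      Real.log (partition W L (β - d) α μ) := by
  have := h.log_partition_ge_boost (α := α) (μ := μ) hβ (sub_pos.2 hd) μ 0
  rw [boostVec_zero, h.mean_mom_zero, norm_zero, inner_zero_right] at this
  linarith

/-- With the same torus and parameters on both sides `log Z` cancels, and what remains is that a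
boost cannot lower the mean energy. -/
lemma mean_boost_nonneg (hβ : 0 < β) (n : Fin 3 → ℤ) :
    0 ≤ h.mean β α μ (momForm L (boostVec L n)) +
      ‖boostVec L n‖ ^ 2 / 2 * h.mean β α μ (numForm L) -
        inner ℝ α (boostVec L n) * h.mean β α μ (numForm L) := by
  have := h.log_partition_ge_boost (α := α) (μ := μ) hβ hβ μ n
  refine nonneg_of_mul_nonneg_right (a := β) ?_ hβ
  linarith

/-- The smallest admissible boosts ±2π/L along one axis give opposite inequalities; their quadratic
term q²/2, divided by q = 2π/L, leaves π/L. -/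
lemma abs_mean_mom_single_sub_le (hβ : 0 < β) (a : Fin 3) :
    |h.mean β α μ (momForm L (EuclideanSpace.single a 1)) - α a * h.mean β α μ (numForm L)| ≤
      Real.pi / L * h.mean β α μ (numForm L) := by
  have hL := h.pos
  have hq : ∀ s : ℤ, boostVec L (Pi.single a s) =
      (2 * Real.pi / L * s) • (EuclideanSpace.single a 1 : Space) := by
    intro s
    ext b
    by_cases hb : b = a
    · subst hb; simp [boostVec]
    · simp [boostVec, hb]
  have key := fun s : ℤ => h.mean_boost_nonneg (α := α) (μ := μ) hβ (Pi.single a s)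
  have h1 := key 1
  have h2 := key (-1)
  rw [hq, h.mean_mom_smul, norm_smul, inner_smul_right, EuclideanSpace.inner_single_right,
    PiLp.norm_single] at h1 h2
  simp only [Int.cast_one, Int.cast_neg, mul_one, norm_one, Real.norm_eq_abs, sq_abs, mul_neg,
    conj_trivial, one_mul, abs_neg] at h1 h2
  set N := h.mean β α μ (numForm L)
  set M := h.mean β α μ (momForm L (EuclideanSpace.single a 1))
  have hc : 0 < 2 * Real.pi / L := by positivity
  have e : 2 * Real.pi / L * (Real.pi / L * N) = (2 * Real.pi / L) ^ 2 / 2 * N := by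
    field_simp
  rw [abs_le]
  constructor
  · refine le_of_mul_le_mul_left ?_ hc
    linarith
  · refine le_of_mul_le_mul_left ?_ hc
    linarith

/-- The mean momentum is that of the moving gas, up to boundary terms. -/
lemma abs_mean_mom_sub_le (hβ : 0 < β) :
    |h.mean β α μ (momForm L α) - ‖α‖ ^ 2 * h.mean β α μ (numForm L)| ≤
      (∑ a, |α a|) * (Real.pi / L * h.mean β α μ (numForm L)) := by
  have hα : α = α 0 • (EuclideanSpace.single 0 1 : Space) +
      (α 1 • (EuclideanSpace.single 1 1 : Space) + α 2 • (EuclideanSpace.single 2 1 : Space)) := by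
    ext b
    fin_cases b <;> simp
  have hm : h.mean β α μ (momForm L α) =
      ∑ a, α a * h.mean β α μ (momForm L (EuclideanSpace.single a 1)) := by
    conv_lhs => rw [show momForm L α = momForm L (α 0 • (EuclideanSpace.single 0 1 : Space) +
      (α 1 • (EuclideanSpace.single 1 1 : Space) + α 2 • (EuclideanSpace.single 2 1 : Space)))
        from congrArg _ hα]
    rw [h.mean_mom_add hβ, h.mean_mom_add hβ, h.mean_mom_smul, h.mean_mom_smul, h.mean_mom_smul,
      Fin.sum_univ_three, add_assoc]
  have hn : ‖α‖ ^ 2 = ∑ a, α a * α a := by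
    rw [EuclideanSpace.real_norm_sq_eq]
    exact Finset.sum_congr rfl fun a _ => sq _
  rw [hm, hn, Finset.sum_mul, Finset.sum_mul, ← Finset.sum_sub_distrib]
  refine (Finset.abs_sum_le_sum_abs _ _).trans (Finset.sum_le_sum fun a _ => ?_)
  rw [mul_assoc, ← mul_sub, abs_mul]
  exact mul_le_mul_of_nonneg_left (h.abs_mean_mom_single_sub_le hβ a) (abs_nonneg _)

/-- Kinetic energy and interaction are controlled by the energy and the particle number. -/
lemma mean_kin_add_shift_le (hβ : 0 < β) :
    h.mean β α μ (kinForm L) + h.mean β α μ (shiftForm L W) ≤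
      2 * (h.mean β α μ (kinForm L) + h.mean β α μ (pairForm L W) - h.mean β α μ (momForm L α) -
        μ * h.mean β α μ (numForm L)) +
      2 * (|W 0| / 2 + ‖α‖ ^ 2 + |μ|) * h.mean β α μ (numForm L) := by
  -- Taking 2α bounds twice the momentum by one kinetic energy plus 2‖α‖² N, so one of the two
  -- kinetic energies on the right survives.
  have h1 := (abs_le.1 (h.abs_mean_mom_le (α := α) (μ := μ) hβ ((2 : ℝ) • α))).2
  rw [h.mean_mom_smul, norm_smul] at h1
  norm_num [mul_pow] at h1
  have h2 := h.mean_pair_eq (α := α) (μ := μ) hβ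
  have h3 := h.mean_num_nonneg (β := β) (α := α) (μ := μ)
  have h4 := mul_le_mul_of_nonneg_right (le_abs_self (W 0)) h3
  have h5 := mul_le_mul_of_nonneg_right (le_abs_self μ) h3
  linarith

end TorusStable

/-- The Gibbs mean of a family of functions of state vectors, as a function of the torus. -/
def stateMean (W : Space → ℝ) (β : ℝ) (α : Space) (μ : ℝ) (f : ∀ L, Fock L → ℝ) (L : ℝ) : ℝ :=
  open Classical in if h : TorusStable W L then h.mean β α μ (f L) else 0

lemma TorusStable.mean_eq (h : TorusStable W L) (β : ℝ) (α : Space) (μ : ℝ)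
    (f : ∀ L, Fock L → ℝ) : h.mean β α μ (f L) = stateMean W β α μ f L := by
  rw [stateMean, dif_pos h]

end

/-! ### Thermodynamic limits -/

section

variable {L : ℝ} {W : Space → ℝ} {β : ℝ} {α : Space} {μ : ℝ}

/-- The expansion of the partition function under dilations. -/
lemma TorusStable.log_partition_dilation (h : TorusStable W L) {R C B ε η : ℝ} (hβ : 0 < β)
    (h' : TorusStable W ((1 + ε) * L)) (hL : 2 * (2 * R) < L) (hR : 0 < R)
    (hsupp : ∀ z, R < ‖z‖ → W z = 0)
    (hdom : ∀ (U : Space → ℝ) (B : ℝ), Measurable U → (∀ z, 2 * R < ‖z‖ → U z = 0) →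
      (∀ z, |U z| ≤ B) → Dominated W L U (B * C))
    (hB : ∀ z, |W z| ≤ B) (hv : ∃ C', Dominated W L (virialFun W) C') (hε : |ε| ≤ 1 / 2)
    (hη : ∀ z, |W ((1 + ε) • z) - W z - (1 + ε - 1) * virialFun W z| ≤ η * |1 + ε - 1|) :
    β * (ε * (2 * h.mean β α μ (kinForm L) - h.mean β α μ (momForm L α) -
        h.mean β α μ (pairForm L (virialFun W))) -
      |ε| * (16 * |ε| * h.mean β α μ (kinForm L) + 2 * |ε| * |h.mean β α μ (momForm L α)| +
        η * C * h.mean β α μ (shiftForm L W))) ≤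
      Real.log (partition W ((1 + ε) * L) β α μ) - Real.log (partition W L β α μ) := by
  obtain ⟨C', hv⟩ := hv
  have hε' := abs_le.1 hε
  have hr : 0 < 1 + ε := by linarith
  have hd : Dominated W L (fun z => W ((1 + ε) • z)) (B * C) := by
    refine hdom _ B (h.meas.comp (measurable_const_smul (1 + ε))) (fun z hz => ?_) fun z => hB _
    refine hsupp _ ?_
    rw [norm_smul, Real.norm_of_nonneg hr.le]
    nlinarith
  have key := h.log_partition_ge (α := α) (μ := μ) hr h' hβ hβ μ 0 hd
  have hdil := (abs_le.1 (h.abs_mean_dilation_le (α := α) (μ := μ) hβ hL hR hsupp hdom hv hd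
    (by simpa using hε) hη)).2
  rw [boostVec_zero, h.mean_mom_zero, norm_zero, inner_zero_right] at key
  rw [add_sub_cancel_left] at hdil
  set K := h.mean β α μ (kinForm L)
  set M := h.mean β α μ (momForm L α)
  set V := h.mean β α μ (pairForm L W)
  set V' := h.mean β α μ (pairForm L fun z => W ((1 + ε) • z))
  set X := h.mean β α μ (pairForm L (virialFun W))
  set Y := h.mean β α μ (shiftForm L W)
  have hK : 0 ≤ K := h.mean_kin_nonneg
  have hinv : (1 + ε)⁻¹ ≤ 2 := by
    rw [inv_le_comm₀ hr two_pos]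
    linarith
  have hinv0 : 0 < (1 + ε)⁻¹ := inv_pos.2 hr
  have hsq : |ε| * |ε| = ε ^ 2 := by rw [← abs_mul, ← sq, abs_of_nonneg (sq_nonneg ε)]
  -- The second-order remainder is ε²(3+2ε)/(1+ε)²; for |ε| ≤ 1/2 the numerator is at most 4 and
  -- (1+ε)⁻² at most 4, whence 16.
  have h1 : ((1 + ε)⁻¹) ^ 2 - 1 + 2 * ε ≤ 16 * ε ^ 2 := by
    have e : ((1 + ε)⁻¹) ^ 2 - 1 + 2 * ε = ε ^ 2 * ((3 + 2 * ε) * ((1 + ε)⁻¹) ^ 2) := by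
      field_simp
      ring
    have e2 : ((1 + ε)⁻¹) ^ 2 ≤ 2 ^ 2 := pow_le_pow_left₀ hinv0.le hinv 2
    have e3 : (3 + 2 * ε) * ((1 + ε)⁻¹) ^ 2 ≤ 4 * 2 ^ 2 :=
      mul_le_mul (by linarith) e2 (by positivity) (by norm_num)
    rw [e]
    have := mul_le_mul_of_nonneg_left e3 (sq_nonneg ε)
    linarith
  have h2 : |1 - (1 + ε)⁻¹ - ε| ≤ 2 * ε ^ 2 := by
    have e : 1 - (1 + ε)⁻¹ - ε = -(ε ^ 2 * (1 + ε)⁻¹) := by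
      field_simp
      ring
    rw [e, abs_neg, abs_of_nonneg (by positivity)]
    have := mul_le_mul_of_nonneg_left hinv (sq_nonneg ε)
    linarith
  have h3 := mul_le_mul_of_nonneg_right h1 hK
  have h4 : (1 - (1 + ε)⁻¹ - ε) * M ≤ 2 * ε ^ 2 * |M| := by
    refine (le_abs_self _).trans ?_
    rw [abs_mul]
    exact mul_le_mul_of_nonneg_right h2 (abs_nonneg M)
  have h5 : |ε| * (16 * |ε| * K + 2 * |ε| * |M| + η * C * Y) =
      16 * ε ^ 2 * K + 2 * ε ^ 2 * |M| + η * |ε| * C * Y := by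
    rw [← hsq]; ring
  have h6 : ε * (2 * K - M - X) - (16 * ε ^ 2 * K + 2 * ε ^ 2 * |M| + η * |ε| * C * Y) ≤
      (1 - ((1 + ε)⁻¹) ^ 2) * K - (1 - (1 + ε)⁻¹) * M + V - V' := by linarith
  rw [h5]
  have h7 := mul_le_mul_of_nonneg_left h6 hβ.le
  linarith

/-- The particle density is the derivative of the pressure. -/
lemma tendsto_density (hβ : 0 < β) (hst : ∀ᶠ L in atTop, TorusStable W L) {F : ℝ → ℝ} {ρ : ℝ}
    (hF : HasDerivAt F ρ 0) (hp : ∀ᶠ s in 𝓝 0, IsPressure W β α (μ + s) (F s)) :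
    Tendsto (fun L : ℝ => stateMean W β α μ numForm L / L ^ 3) atTop (𝓝 ρ) := by
  refine tendsto_of_slope (f := fun s L => Real.log (partition W L β α (μ + s)) / (β * L ^ 3))
    hF hp fun t ht => Eventually.of_forall fun s => ?_
  filter_upwards [hst] with L h
  have h1 := h.log_partition_chemical (α := α) (μ := μ) hβ s
  rw [h.mean_eq] at h1
  have hL : 0 < β * L ^ 3 := mul_pos hβ (pow_pos h.pos 3)
  have h2 : 0 ≤ |s| * t := by positivity
  have h3 : s * (stateMean W β α μ numForm L / L ^ 3) =
      β * s * stateMean W β α μ numForm L / (β * L ^ 3) := by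
    field_simp
  rw [add_zero, ← sub_div, h3]
  refine (sub_le_self _ h2).trans ((div_le_div_iff_of_pos_right hL).2 ?_)
  linarith

/-- Kinetic energy and interaction are bounded by the volume. -/
lemma eventually_bounded (hβ : 0 < β) (hst : ∀ᶠ L in atTop, TorusStable W L) {d ρ p p' : ℝ}
    (hd : 0 < d) (hdβ : d < β) (hp : IsPressure W β α μ p) (hp' : IsPressure W (β - d) α μ p')
    (hρ : Tendsto (fun L : ℝ => stateMean W β α μ numForm L / L ^ 3) atTop (𝓝 ρ)) :
    ∃ B, ∀ᶠ L in atTop, stateMean W β α μ kinForm L / L ^ 3 +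
      stateMean W β α μ (fun L => shiftForm L W) L / L ^ 3 ≤ B := by
  set c := 2 * (|W 0| / 2 + ‖α‖ ^ 2 + |μ|) with hc
  -- Lowering β by d raises `log Z` by at least d times the mean energy, so the energy density is
  -- bounded by a difference quotient of limits. Only an upper bound is needed, hence a single
  -- smaller inverse temperature.
  have hlim := ((((hp'.const_mul (β - d)).sub (hp.const_mul β)).const_mul (2 / d)).add
    (hρ.const_mul c))
  refine ⟨2 / d * ((β - d) * p' - β * p) + c * ρ + 1, ?_⟩
  filter_upwards [hlim.eventually_lt_const (lt_add_one _), hst] with L hlt h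
  refine le_trans ?_ hlt.le
  have hL := pow_pos h.pos 3
  have hdβ' := sub_pos.2 hdβ
  have h1 := h.log_partition_temperature (α := α) (μ := μ) hβ hdβ
  have h2 := h.mean_kin_add_shift_le (α := α) (μ := μ) hβ
  set E := h.mean β α μ (kinForm L) + h.mean β α μ (pairForm L W) - h.mean β α μ (momForm L α) -
        μ * h.mean β α μ (numForm L)
  rw [← h.mean_eq β α μ kinForm, ← h.mean_eq β α μ numForm, ← h.mean_eq β α μ (fun L => shiftForm L W),
    ← add_div]
  have e : 2 / d * ((β - d) * (Real.log (partition W L (β - d) α μ) / ((β - d) * L ^ 3)) -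
      β * (Real.log (partition W L β α μ) / (β * L ^ 3))) +
        c * (h.mean β α μ (numForm L) / L ^ 3) =
      (2 * ((Real.log (partition W L (β - d) α μ) - Real.log (partition W L β α μ)) / d) +
        c * h.mean β α μ (numForm L)) / L ^ 3 := by
    field_simp
  rw [e]
  refine (div_le_div_iff_of_pos_right hL).2 ?_
  have h3 : E ≤ (Real.log (partition W L (β - d) α μ) - Real.log (partition W L β α μ)) / d := by
    rw [le_div_iff₀ hd]
    linarith
  rw [hc]
  linarith

/-- The momentum differs from |α|²N by at most a constant times N/L, which vanishes per volume
because the particle density converges. -/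
lemma tendsto_momentum (hβ : 0 < β) (hst : ∀ᶠ L in atTop, TorusStable W L) {ρ : ℝ}
    (hρ : Tendsto (fun L : ℝ => stateMean W β α μ numForm L / L ^ 3) atTop (𝓝 ρ)) :
    Tendsto (fun L : ℝ => stateMean W β α μ (fun L => momForm L α) L / L ^ 3) atTop
      (𝓝 (‖α‖ ^ 2 * ρ)) := by
  have h1 : Tendsto (fun L : ℝ => (∑ a, |α a|) * (Real.pi / L *
      (stateMean W β α μ numForm L / L ^ 3))) atTop (𝓝 ((∑ a, |α a|) * (0 * ρ))) :=
    ((tendsto_const_nhds.div_atTop tendsto_id).mul hρ).const_mul _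
  rw [zero_mul, mul_zero] at h1
  have h2 : Tendsto (fun L : ℝ => stateMean W β α μ (fun L => momForm L α) L / L ^ 3 -
      ‖α‖ ^ 2 * (stateMean W β α μ numForm L / L ^ 3)) atTop (𝓝 0) := by
    refine squeeze_zero_norm' ?_ h1
    filter_upwards [hst] with L h
    have h3 := h.abs_mean_mom_sub_le (α := α) (μ := μ) hβ
    have hL := pow_pos h.pos 3
    rw [← h.mean_eq β α μ numForm, ← h.mean_eq β α μ (fun L => momForm L α), ← mul_div_assoc,
      ← sub_div,
      Real.norm_eq_abs, abs_div, abs_of_pos hL, ← mul_div_assoc, ← mul_div_assoc]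
    exact (div_le_div_iff_of_pos_right hL).2 h3
  have h4 := h2.add (hρ.const_mul (‖α‖ ^ 2))
  rw [zero_add] at h4
  exact h4.congr fun L => sub_add_cancel _ _

/-- The virial theorem for the means of quadratic forms. -/
lemma tendsto_virial (hβ : 0 < β) (hW : AdmissiblePotential W) {d ρ p p' : ℝ}
    (hd : 0 < d) (hdβ : d < β) (hp : IsPressure W β α μ p) (hp' : IsPressure W (β - d) α μ p')
    (hρ : Tendsto (fun L : ℝ => stateMean W β α μ numForm L / L ^ 3) atTop (𝓝 ρ)) :
    Tendsto (fun L : ℝ => 2 * (stateMean W β α μ kinForm L / L ^ 3) -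
      stateMean W β α μ (fun L => momForm L α) L / L ^ 3 -
      stateMean W β α μ (fun L => pairForm L (virialFun W)) L / L ^ 3) atTop (𝓝 (3 * p)) := by
  obtain ⟨R, C, L₁, hR, hC, hL₁, hsupp, huni⟩ := hW.exists_uniform
  have hst : ∀ᶠ L in atTop, TorusStable W L :=
    (eventually_ge_atTop L₁).mono fun L hL => (huni L hL).2.1
  obtain ⟨B, hB⟩ := eventually_bounded hβ hst hd hdβ hp hp' hρ
  have hmom := (tendsto_momentum hβ hst hρ).abs.eventually_le_const (lt_add_one _)
  set B' := |‖α‖ ^ 2 * ρ| + 1 with hB'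
  obtain ⟨BW, -, hBW⟩ := exists_bound_of_range hW.contDiff.continuous hsupp
  have hvc := continuous_virialFun hW.contDiff
  obtain ⟨BX, -, hBX⟩ := exists_bound_of_range hvc fun z hz => virialFun_eq_zero hsupp hz
  -- The logarithm on side (1+ε)L is divided by the volume of the undilated torus; this produces the
  -- factor (1+ε)³, whose derivative is the 3 of the theorem.
  have hF : HasDerivAt (fun ε : ℝ => (1 + ε) ^ 3 * p) (3 * p) 0 := by
    have := ((((hasDerivAt_id (0 : ℝ)).const_add 1).pow 3).mul_const p)
    simpa using this
  refine tendsto_of_slope (f := fun ε L =>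
    (1 + ε) ^ 3 * (Real.log (partition W ((1 + ε) * L) β α μ) / (β * ((1 + ε) * L) ^ 3))) hF ?_ ?_
  · filter_upwards [(eventually_gt_nhds (by norm_num : (-1 : ℝ) < 0))] with ε hε
    refine Tendsto.const_mul _ (hp.comp (tendsto_id.const_mul_atTop (by linarith)))
  · intro t ht
    set D := |B| + 1 with hD
    have hD0 : 0 < D := by positivity
    have hB'0 : 0 < B' := by positivity
    -- The error t is split in two: this η makes the remainder of the potential cost at most t/2 per
    -- volume, and the second smallness condition on ε below does the same for the terms quadratic
    -- in ε. D and B' bound the kinetic, interaction and momentum densities.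
    obtain ⟨δ, hδ, hδ2, hest⟩ := exists_dilation_estimate hW.contDiff hW.compactSupport hR hsupp
      (η := t / (2 * (C + 1) * D)) (by positivity)
    filter_upwards [Metric.closedBall_mem_nhds (0 : ℝ) hδ, Metric.closedBall_mem_nhds (0 : ℝ)
      (show 0 < t / (2 * (16 * D + 2 * B')) by positivity)] with ε hε1 hε2
    rw [mem_closedBall_zero_iff, Real.norm_eq_abs] at hε1 hε2
    have hε3 := hε1.trans hδ2
    have hr : 0 < 1 + ε := by linarith [(abs_le.1 hε3).1]
    filter_upwards [eventually_ge_atTop L₁, hB, hmom,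
      (tendsto_id.const_mul_atTop hr).eventually_ge_atTop L₁] with L hL hBL hmL hrL
    obtain ⟨hRL, h, hdom⟩ := huni L hL
    obtain ⟨-, h', -⟩ := huni _ hrL
    have hL3 := pow_pos h.pos 3
    have key := h.log_partition_dilation (α := α) (μ := μ) (B := BW) hβ h' hRL hR hsupp hdom hBW
      ⟨_, hdom _ _ hvc.measurable (fun z hz => virialFun_eq_zero hsupp (by linarith)) hBX⟩ hε3
      (hest (1 + ε) (by simpa using hε1))
    have hk0 := h.mean_kin_nonneg (β := β) (α := α) (μ := μ)
    have hy0 := h.mean_shift_nonneg (β := β) (α := α) (μ := μ)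
    rw [← h.mean_eq β α μ kinForm, ← h.mean_eq β α μ (fun L => momForm L α),
      ← h.mean_eq β α μ (fun L => pairForm L (virialFun W))]
    rw [← h.mean_eq β α μ kinForm, ← h.mean_eq β α μ (fun L => shiftForm L W)] at hBL
    rw [← h.mean_eq β α μ (fun L => momForm L α), abs_div, abs_of_pos hL3] at hmL
    set K := h.mean β α μ (kinForm L)
    set M := h.mean β α μ (momForm L α)
    set X := h.mean β α μ (pairForm L (virialFun W))
    set Y := h.mean β α μ (shiftForm L W)
    have hkD : K / L ^ 3 ≤ D := by
      have : 0 ≤ Y / L ^ 3 := by positivity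
      linarith [le_abs_self B]
    have hyD : Y / L ^ 3 ≤ D := by
      have : 0 ≤ K / L ^ 3 := by positivity
      linarith [le_abs_self B]
    have herr : 16 * |ε| * (K / L ^ 3) + 2 * |ε| * (|M| / L ^ 3) +
        t / (2 * (C + 1) * D) * C * (Y / L ^ 3) ≤ t := by
      have e1 : 16 * |ε| * (K / L ^ 3) + 2 * |ε| * (|M| / L ^ 3) ≤ t / 2 := by
        calc 16 * |ε| * (K / L ^ 3) + 2 * |ε| * (|M| / L ^ 3)
            ≤ 16 * |ε| * D + 2 * |ε| * B' := by gcongr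
          _ = |ε| * (16 * D + 2 * B') := by ring
          _ ≤ t / (2 * (16 * D + 2 * B')) * (16 * D + 2 * B') := by gcongr
          _ = t / 2 := by field_simp
      have e2 : t / (2 * (C + 1) * D) * C * (Y / L ^ 3) ≤ t / 2 := by
        calc t / (2 * (C + 1) * D) * C * (Y / L ^ 3) ≤ t / (2 * (C + 1) * D) * (C + 1) * D := by
              gcongr
              linarith
          _ = t / 2 := by field_simp
      linarith
    have hdiv := (div_le_div_iff_of_pos_right (mul_pos hβ hL3)).2 key
    have e3 : (1 + ε) ^ 3 * (Real.log (partition W ((1 + ε) * L) β α μ) /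
        (β * ((1 + ε) * L) ^ 3)) - (1 + 0) ^ 3 * (Real.log (partition W ((1 + 0) * L) β α μ) /
        (β * ((1 + 0) * L) ^ 3)) = (Real.log (partition W ((1 + ε) * L) β α μ) -
          Real.log (partition W L β α μ)) / (β * L ^ 3) := by
      rw [add_zero, one_mul, one_pow, one_mul, mul_pow]
      field_simp
    rw [e3]
    refine le_trans ?_ hdiv
    have e4 : β * (ε * (2 * K - M - X) - |ε| * (16 * |ε| * K + 2 * |ε| * |M| +
        t / (2 * (C + 1) * D) * C * Y)) / (β * L ^ 3) =
        ε * (2 * (K / L ^ 3) - M / L ^ 3 - X / L ^ 3) - |ε| * (16 * |ε| * (K / L ^ 3) +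
          2 * |ε| * (|M| / L ^ 3) + t / (2 * (C + 1) * D) * C * (Y / L ^ 3)) := by
      field_simp
    rw [e4]
    have := mul_le_mul_of_nonneg_left herr (abs_nonneg ε)
    linarith

lemma AdmissiblePotential.eventually_torusStable (hW : AdmissiblePotential W) :
    ∀ᶠ L in atTop, TorusStable W L := by
  obtain ⟨R, C, L₁, -, -, -, -, huni⟩ := hW.exists_uniform
  exact (eventually_ge_atTop L₁).mono fun L hL => (huni L hL).2.1

lemma AdmissiblePotential.eventually_dominated_virial (hW : AdmissiblePotential W) :
    ∀ᶠ L in atTop, TorusStable W L ∧ ∃ C, Dominated W L (virialFun W) C := by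
  obtain ⟨R, C, L₁, hR, -, -, hsupp, huni⟩ := hW.exists_uniform
  have hvc := continuous_virialFun hW.contDiff
  obtain ⟨B, -, hB⟩ := exists_bound_of_range hvc fun z hz => virialFun_eq_zero hsupp hz
  filter_upwards [eventually_ge_atTop L₁] with L hL
  obtain ⟨-, h, hdom⟩ := huni L hL
  exact ⟨h, _, hdom _ _ hvc.measurable (fun z hz => virialFun_eq_zero hsupp (by linarith)) hB⟩

end

end FermiGas

end

/-! ### The virial theorem -/

open FermiGas
theorem mainTheorem3 (W : Space → ℝ) (hW : AdmissiblePotential W)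
    (D : Set (ℝ × Space × ℝ)) (hD : IsOpen D) (P : ℝ × Space × ℝ → ℝ)
    (hP : ∀ β α μ, (β, α, μ) ∈ D → IsPressure W β α μ (P (β, α, μ)))
    (hP1 : ContDiffOn ℝ 1 P D)
    (β : ℝ) (hβ : 0 < β) (α : Space) (μ : ℝ) (hmem : (β, α, μ) ∈ D) :
    ∃ ρ : ℝ, IsParticleDensity W β α μ ρ ∧
      Tendsto (fun L : ℝ =>
          2 * (gibbs W L β α μ (kinetic L) / (L : ℂ) ^ 3 - (1 / 2) * (‖α‖ : ℂ) ^ 2 * (ρ : ℂ)) -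
            gibbs W L β α μ (virial L W) / (L : ℂ) ^ 3)
        atTop (𝓝 ((3 * P (β, α, μ) : ℝ) : ℂ)) ∧
      ∀ e : ℝ, IsKineticDensity W β α μ e →
        ∃ v : ℝ, IsVirialDensity W β α μ v ∧
          2 * (e - 1 / 2 * ‖α‖ ^ 2 * ρ) - v = 3 * P (β, α, μ) := by
  have hdiff : DifferentiableAt ℝ P (β, α, μ) :=
    (hP1.contDiffAt (hD.mem_nhds hmem)).differentiableAt one_ne_zero
  have hline : HasDerivAt (fun s : ℝ => ((β, α, μ + s) : ℝ × Space × ℝ)) (0, 0, 1) 0 :=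
    (hasDerivAt_const _ _).prodMk ((hasDerivAt_const _ _).prodMk
      ((hasDerivAt_id (0 : ℝ)).const_add μ))
  have hF : HasDerivAt (fun s : ℝ => P (β, α, μ + s)) (fderiv ℝ P (β, α, μ) (0, 0, 1)) 0 := by
    refine HasFDerivAt.comp_hasDerivAt (0 : ℝ) (l := P) ?_ hline
    simpa only [add_zero] using hdiff.hasFDerivAt
  -- The density is the partial derivative of the pressure in μ.
  set ρ := fderiv ℝ P (β, α, μ) (0, 0, 1)
  have hp : ∀ᶠ s in 𝓝 (0 : ℝ), IsPressure W β α (μ + s) (P (β, α, μ + s)) := by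
    have hc : ContinuousAt (fun s : ℝ => ((β, α, μ + s) : ℝ × Space × ℝ)) 0 := hline.continuousAt
    filter_upwards [hc.preimage_mem_nhds (hD.mem_nhds (by simpa using hmem))] with s hs
    exact hP _ _ _ hs
  -- A slightly smaller inverse temperature, still positive and in D, feeds the a priori bound on
  -- the energy density.
  obtain ⟨d, hdD, hd, hdβ⟩ : ∃ d : ℝ, (β - d, α, μ) ∈ D ∧ 0 < d ∧ d < β := by
    have hc : ContinuousAt (fun s : ℝ => ((β - s, α, μ) : ℝ × Space × ℝ)) 0 := by fun_prop
    have h1 := hc.preimage_mem_nhds (hD.mem_nhds (by simpa using hmem))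
    have h2 : ∀ᶠ s in 𝓝[>] (0 : ℝ), (β - s, α, μ) ∈ D ∧ 0 < s ∧ s < β := by
      filter_upwards [mem_nhdsWithin_of_mem_nhds h1, self_mem_nhdsWithin,
        mem_nhdsWithin_of_mem_nhds (gt_mem_nhds hβ)] with s h1 h2 h3
      exact ⟨h1, h2, h3⟩
    exact h2.exists
  have hst := hW.eventually_torusStable
  have hρ := tendsto_density hβ hst hF hp
  have hvir := tendsto_virial hβ hW hd hdβ (hP _ _ _ hmem) (hP _ _ _ hdD) hρ
  have hmom := tendsto_momentum hβ hst hρ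
  have hk : ∀ᶠ L : ℝ in atTop, gibbs W L β α μ (kinetic L) / (L : ℂ) ^ 3 =
      ((stateMean W β α μ kinForm L / L ^ 3 : ℝ) : ℂ) := by
    filter_upwards [hst] with L h
    rw [h.gibbs_kinetic, h.mean_eq β α μ kinForm]
    push_cast
    rfl
  have hv : ∀ᶠ L : ℝ in atTop, gibbs W L β α μ (virial L W) / (L : ℂ) ^ 3 =
      ((stateMean W β α μ (fun L => pairForm L (virialFun W)) L / L ^ 3 : ℝ) : ℂ) := by
    filter_upwards [hW.eventually_dominated_virial] with L h
    obtain ⟨h, C, hC⟩ := h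
    have e : gibbs W L β α μ (virial L W) = (h.mean β α μ (pairForm L (virialFun W)) : ℂ) :=
      h.gibbs_interaction hC
    rw [e, h.mean_eq β α μ fun L => pairForm L (virialFun W)]
    push_cast
    rfl
  have hlim : Tendsto (fun L : ℝ =>
      2 * (stateMean W β α μ kinForm L / L ^ 3 - 1 / 2 * ‖α‖ ^ 2 * ρ) -
        stateMean W β α μ (fun L => pairForm L (virialFun W)) L / L ^ 3) atTop
      (𝓝 (3 * P (β, α, μ))) := by
    -- The momentum density is exchanged for its limit |α|²ρ, which is twice the subtracted kinetic
    -- energy ½|α|²ρ of the moving gas.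
    have h1 := hvir.add (hmom.sub_const (‖α‖ ^ 2 * ρ))
    rw [sub_self, add_zero] at h1
    exact h1.congr fun L => by ring
  -- The virial density is defined by the identity to be proved; its convergence then follows by
  -- subtracting the two known limits.
  refine ⟨ρ, ?_, ?_, fun e he => ⟨2 * (e - 1 / 2 * ‖α‖ ^ 2 * ρ) - 3 * P (β, α, μ), ?_, by ring⟩⟩
  · refine ((Complex.continuous_ofReal.tendsto ρ).comp hρ).congr' ?_
    filter_upwards [hst] with L h
    rw [h.gibbs_number, h.mean_eq β α μ numForm]
    simp
  · refine ((Complex.continuous_ofReal.tendsto _).comp hlim).congr' ?_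
    filter_upwards [hk, hv] with L h1 h2
    rw [h1, h2]
    simp
  · have he' : Tendsto (fun L : ℝ => stateMean W β α μ kinForm L / L ^ 3) atTop (𝓝 e) := by
      refine ((Complex.continuous_re.tendsto _).comp he).congr' ?_
      filter_upwards [hk] with L h1
      rw [Function.comp_apply, h1, Complex.ofReal_re]
    have h1 := ((he'.sub_const (1 / 2 * ‖α‖ ^ 2 * ρ)).const_mul 2).sub hlim
    refine ((Complex.continuous_ofReal.tendsto _).comp h1).congr' ?_
    filter_upwards [hv] with L h2
    rw [h2, Function.comp_apply]
    congr 1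
    ring
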